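/- Let $d\ge 1$, $m\ge 0$ be integers and $\mathbb T^d=(\mathbb R/2\pi\mathbb Z)^d$. For $f:\mathbb T^d\to\mathbb R^m$ let $f_\alpha=(2\pi)^{-d}\int_{\mathbb T^d}e^{-i\alpha\cdot x}f(x)\,dx\in\mathbb C^m$ ($\alpha\in\mathbb Z^d$) be its Fourier coefficients, let $$\mathrm{Gen}[f](z)=\sum_{\alpha\in\mathbb Z^d}e^{z|\alpha|}\,|f_\alpha|\in[0,\infty]\qquad(z\in\mathbb R)$$ be its generator function, where $|\cdot|$ is the Euclidean norm, and let $X_\rho$ be the space of continuous $f:\mathbb T^d\to\mathbb R^m$ with $\mathrm{Gen}[f](\rho)<\infty$. Let $A:\mathbb R^m\times(\mathbb R^m)^d\to\mathbb R^m$ be a continuous function, $C_0$ a real constant and $F$ a real function that is real-analytic at every point of $[0,\infty)$, such that $$\mathrm{Gen}[A(u,\nabla_xu)](z)\le C_0\,F\big(\mathrm{Gen}[u](z)\big)\,\big(1+\partial_z\mathrm{Gen}[u](z)\big)$$ for every $z\ge 0$ and every $u$ that belongs to $X_{z'}$ for some $z'>z$. Let $\rho>0$ and $u_0\in X_\rho$.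 Then there is a constant $C_1>0$ (which may depend on $u_0$, as well as on $\rho$ and on the data $d,m,A,C_0,F$) such that, with $\rho(t)=\rho-C_1t$, the Cauchy problem $$\partial_tu=A(u,\nabla_xu),\qquad u(0)=u_0,$$ has one and only one solution $u(t)\in X_{\rho(t)}$ on the time interval $\{t\ge 0:\rho(t)>0\}$. Here a solution is a family of functions $u(t)\in X_{\rho(t)}$, defined for all $t\ge0$ with $\rho(t)>0$, such that $u(0)=u_0$, the equation holds at every such $t$ and every $x\in\mathbb T^d$ (with the one-sided time derivative at $t=0$), and $u$ is continuous in time with values in the scale of spaces: $\mathrm{Gen}[u(t)-u(t_0)](s)\to0$ as $t\to t_0$, for every $t_0$ in the interval and every $s<\rho(t_0)$. -/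

import Mathlib

open scoped Topology

noncomputable section

namespace GenFun

/-- `2π`-periodicity in each of the `d` space variables: functions on the torus
`𝕋^d = (ℝ / 2πℤ)^d` are represented by such functions on `ℝ^d`. -/
def Periodic {d m : ℕ} (f : (Fin d → ℝ) → EuclideanSpace ℝ (Fin m)) : Prop :=
  ∀ (x : Fin d → ℝ) (j : Fin d), f (x + Pi.single j (2 * Real.pi)) = f x

/-- The Fourier coefficient `f_α = (2π)^{-d} ∫_{[0,2π]^d} e^{-i α·x} f(x) dx ∈ ℂ^m`. -/
def fourierCoeff {d m : ℕ} (f : (Fin d → ℝ) → EuclideanSpace ℝ (Fin m)) (α : Fin d → ℤ) :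
    EuclideanSpace ℂ (Fin m) :=
  WithLp.toLp 2 fun i =>
    ((2 * Real.pi : ℝ) : ℂ)⁻¹ ^ d *
      ∫ x in Set.Icc (0 : Fin d → ℝ) (fun _ => 2 * Real.pi),
        Complex.exp (-Complex.I * ((∑ j, (α j : ℝ) * x j : ℝ) : ℂ)) * ((f x i : ℝ) : ℂ)

/-- The Euclidean length `|α|` of a frequency `α ∈ ℤ^d`. -/
def freqNorm {d : ℕ} (α : Fin d → ℤ) : ℝ :=
  Real.sqrt (∑ j, (α j : ℝ) ^ 2)

/-- The generator function `Gen[f](z) = ∑_{α ∈ ℤ^d} e^{z|α|} |f_α|`, with values in `[0, ∞]`. -/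
def Gen {d m : ℕ} (f : (Fin d → ℝ) → EuclideanSpace ℝ (Fin m)) (z : ℝ) : ENNReal :=
  ∑' α : Fin d → ℤ, ENNReal.ofReal (Real.exp (z * freqNorm α) * ‖fourierCoeff f α‖)

/-- The space `X_ρ` of (continuous) functions on the torus with `Gen[f](ρ) < ∞`. -/
def X (d m : ℕ) (ρ : ℝ) : Set ((Fin d → ℝ) → EuclideanSpace ℝ (Fin m)) :=
  {f | Continuous f ∧ Periodic f ∧ Gen f ρ < ⊤}

/-- The gradient `∇_x f = (∂_1 f, …, ∂_d f)`. -/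
def grad {d m : ℕ} (f : (Fin d → ℝ) → EuclideanSpace ℝ (Fin m)) (x : Fin d → ℝ) :
    Fin d → EuclideanSpace ℝ (Fin m) :=
  fun j => fderiv ℝ f x (Pi.single j 1)

/-- The generator bound `Gen[A(u, ∇_x u)] ≤ C₀ F(Gen[u]) (1 + ∂_z Gen[u])`, at every `z ≥ 0`
and for every `u` whose generator function is finite beyond `z`
(so that `Gen[u]` is finite and differentiable at `z`). -/
def GeneratorBound {d m : ℕ}
    (A : EuclideanSpace ℝ (Fin m) → (Fin d → EuclideanSpace ℝ (Fin m)) →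
      EuclideanSpace ℝ (Fin m))
    (C₀ : ℝ) (F : ℝ → ℝ) : Prop :=
  ∀ z z' : ℝ, 0 ≤ z → z < z' → ∀ u ∈ X d m z',
    Gen (fun x => A (u x) (grad u x)) z ≤
      ENNReal.ofReal (C₀ * F (Gen u z).toReal *
        (1 + deriv (fun y : ℝ => (Gen u y).toReal) z))

/-- `u` solves `∂_t u = A(u, ∇_x u)`, `u(0) = u₀`, with `u(t) ∈ X_{ρ(t)}`, `ρ(t) = ρ - C₁ t`,
for all times `t ≥ 0` with `ρ(t) > 0`. The equation holds classically at every point (with the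
one-sided time derivative at `t = 0`), and `t ↦ u(t)` is continuous with values in the scale
of spaces: near each time `t₀` it is continuous at `t₀` in `X_s` for every `s < ρ(t₀)`. -/
structure IsSolution {d m : ℕ}
    (A : EuclideanSpace ℝ (Fin m) → (Fin d → EuclideanSpace ℝ (Fin m)) →
      EuclideanSpace ℝ (Fin m))
    (ρ C₁ : ℝ) (u₀ : (Fin d → ℝ) → EuclideanSpace ℝ (Fin m))
    (u : ℝ → (Fin d → ℝ) → EuclideanSpace ℝ (Fin m)) : Prop where
  initial : u 0 = u₀
  mem : ∀ t : ℝ, 0 ≤ t → 0 < ρ - C₁ * t → u t ∈ X d m (ρ - C₁ * t)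
  continuous_scale : ∀ t₀ : ℝ, 0 ≤ t₀ → 0 < ρ - C₁ * t₀ → ∀ s : ℝ, s < ρ - C₁ * t₀ →
    Filter.Tendsto (fun t => Gen (u t - u t₀) s) (𝓝[{t | 0 ≤ t ∧ 0 < ρ - C₁ * t}] t₀) (𝓝 0)
  equation : ∀ t : ℝ, 0 ≤ t → 0 < ρ - C₁ * t → ∀ x : Fin d → ℝ,
    HasDerivWithinAt (fun τ => u τ x) (A (u t x) (grad (u t) x))
      {τ | 0 ≤ τ ∧ 0 < ρ - C₁ * τ} t

end GenFun

end

/-! ### Fourier coefficients on the box and on the torus -/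

noncomputable section

namespace GenFun

open MeasureTheory Set Complex
open scoped Pointwise

/-! The generator bound constrains `A` itself. Tested on trigonometric functions it forces `A` to be
affine in the gradient, with coefficients that have rapidly convergent expansions on every cube. The
Cauchy problem is then quasilinear, and a Cauchy–Kovalevskaya contraction solves it on the whole
interval where the radius is positive.

Structure of `A`. Suppose that, for every shift `φ`, a function `h` of several phases appears along
`x ↦ L x + φ` as a component of `A(u, ∇u)`, with `k·L x = α·x`. Averaging over `φ` turns the bound
`e^{-z|α|}` times a constant for the composed functions into the same bound for the coefficient of
`h` at `k` (`norm_coeff_le_of_pullback`). Two families of test functions are used. (1) `u = a + w(N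
x + φ)/N` stays near `a` while its gradient runs over a product of ellipses. At `z = y/N`, as `N →
∞`, only the factor `1 + ∂_z Gen` grows, like `e^y`, against a decay `e^{-y|k|}`. Letting `y → ∞`
kills all frequencies `|k| > 1`, so `A(a, ·)` is a trigonometric polynomial of degree one on
ellipses, hence affine (`exists_affine`). (2) `u_i = r cos(N_i x_j + φ_i)` with small integers `N_i`
gives decay `e^{-z Σ|k_i|}`, for every `z`, of the coefficients of `A(·, 0)` and of the slopes
composed with `r cos θ` (`norm_coeff_entries_le`). By parity these Fourier series are Chebyshev
series in `y/r`.

Existence. The norm is the sum over modes of the supremum over time of `e^{ρ(t)|ν|} |b(t)|`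
(`Majorized`); the supremum stands inside the sum. Products are bounded in this norm, and Chebyshev
polynomials of degree `n` act with bounds `5^n`, so the coefficients of `A` act as bounded Lipschitz
maps on balls. The derivative lost in `a(u) ∂u` is regained by time integration, because `∫ n
e^{-C(t-τ)n} dτ ≤ 1/C` for every `n` (`integral_mul_exp_le`). For large `C` the Picard map is
therefore a contraction up to the time when the radius vanishes.

Uniqueness. Near any time a given solution is continuous at a larger radius than needed, so on a
short interval with a smaller radius and a larger speed it has finite norm. Two solutions that agree
at that time are fixed points of the same contraction, and they agree a little longer; continuous
induction concludes. -/

/-- The linear phase `α·x`. -/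
def phase {d : ℕ} (α : Fin d → ℤ) (x : Fin d → ℝ) : ℝ := ∑ j, (α j : ℝ) * x j

/-- The character `e^{i α·x}`. -/
def character {d : ℕ} (α : Fin d → ℤ) (x : Fin d → ℝ) : ℂ := Complex.exp (Complex.I * (phase α x : ℂ))

/-- Scalar Fourier coefficients. -/
def coeff {d : ℕ} (h : (Fin d → ℝ) → ℂ) (α : Fin d → ℤ) : ℂ :=
  ((2 * Real.pi : ℝ) : ℂ)⁻¹ ^ d *
    ∫ x in Set.Icc (0 : Fin d → ℝ) (fun _ => 2 * Real.pi),
      Complex.exp (-Complex.I * ((∑ j, (α j : ℝ) * x j : ℝ) : ℂ)) * h x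

/-- `2π`-periodicity in each variable, for functions with arbitrary values. -/
def BoxPeriodic {d : ℕ} {β : Type*} (h : (Fin d → ℝ) → β) : Prop :=
  ∀ (x : Fin d → ℝ) (j : Fin d), h (x + Pi.single j (2 * Real.pi)) = h x

variable {d : ℕ}

theorem fourierCoeff_apply {m : ℕ} (f : (Fin d → ℝ) → EuclideanSpace ℝ (Fin m)) (α : Fin d → ℤ)
    (i : Fin m) : fourierCoeff f α i = coeff (fun x => ((f x i : ℝ) : ℂ)) α := rfl

theorem phase_add (α : Fin d → ℤ) (x y : Fin d → ℝ) : phase α (x + y) = phase α x + phase α y := by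
  simp [phase, mul_add, Finset.sum_add_distrib]

theorem phase_add_left (α β : Fin d → ℤ) (x : Fin d → ℝ) :
    phase (α + β) x = phase α x + phase β x := by
  simp [phase, add_mul, Finset.sum_add_distrib]

theorem phase_neg_left (α : Fin d → ℤ) (x : Fin d → ℝ) : phase (-α) x = -phase α x := by
  simp [phase]

@[simp] theorem phase_zero_left (x : Fin d → ℝ) : phase 0 x = 0 := by simp [phase]

theorem continuous_phase (α : Fin d → ℤ) : Continuous (phase α) := by
  unfold phase; fun_prop

theorem continuous_character (α : Fin d → ℤ) : Continuous (character α) := by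
  have := continuous_phase α
  unfold character; fun_prop

@[simp] theorem norm_character (α : Fin d → ℤ) (x : Fin d → ℝ) : ‖character α x‖ = 1 := by
  rw [character, mul_comm, Complex.norm_exp_ofReal_mul_I]

theorem character_add_left (α β : Fin d → ℤ) (x : Fin d → ℝ) :
    character (α + β) x = character α x * character β x := by
  rw [character, character, character, phase_add_left, ← Complex.exp_add]; push_cast; ring_nf

theorem character_add (α : Fin d → ℤ) (x y : Fin d → ℝ) :
    character α (x + y) = character α x * character α y := by
  rw [character, character, character, phase_add, ← Complex.exp_add]; push_cast; ring_nf

@[simp] theorem character_zero_left (x : Fin d → ℝ) : character 0 x = 1 := by simp [character]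

theorem exp_neg_phase (α : Fin d → ℤ) (x : Fin d → ℝ) :
    Complex.exp (-Complex.I * ((∑ j, (α j : ℝ) * x j : ℝ) : ℂ)) = character (-α) x := by
  rw [character, phase_neg_left, phase]; push_cast; ring_nf

theorem coeff_eq (h : (Fin d → ℝ) → ℂ) (α : Fin d → ℤ) :
    coeff h α = ((2 * Real.pi : ℝ) : ℂ)⁻¹ ^ d *
      ∫ x in Set.Icc (0 : Fin d → ℝ) (fun _ => 2 * Real.pi), character (-α) x * h x := by
  simp only [coeff, exp_neg_phase]

theorem boxPeriodic_character (α : Fin d → ℤ) : BoxPeriodic (character α) := by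
  intro x j
  have h : character α (Pi.single j (2 * Real.pi)) = 1 := by
    have : phase α (Pi.single j (2 * Real.pi)) = α j * (2 * Real.pi) := by
      rw [phase, Finset.sum_eq_single j] <;> simp +contextual
    rw [character, this, Complex.exp_eq_one_iff]
    exact ⟨α j, by push_cast; ring⟩
  rw [character_add, h, mul_one]

theorem BoxPeriodic.mul {h k : (Fin d → ℝ) → ℂ} (hh : BoxPeriodic h) (hk : BoxPeriodic k) :
    BoxPeriodic (fun x => h x * k x) := fun x j => by simp only [hh x j, hk x j]

theorem BoxPeriodic.add_int {β : Type*} {h : (Fin d → ℝ) → β} (hh : BoxPeriodic h)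
    (x : Fin d → ℝ) (n : Fin d → ℤ) : h (x + fun j => 2 * Real.pi * (n j : ℝ)) = h x := by
  have one : ∀ (j : Fin d) (k : ℤ) (x : Fin d → ℝ), h (x + Pi.single j (2 * Real.pi * (k : ℝ))) = h x := by
    intro j k
    induction k with
    | zero => intro x; simp
    | succ k ih =>
      intro x
      have := hh (x + Pi.single (M := fun _ => ℝ) j (2 * Real.pi * ((k : ℤ) : ℝ))) j
      rw [ih x, add_assoc x, ← Pi.single_add] at this
      rw [← this]; push_cast; ring_nf
    | pred k ih =>
      intro x
      have := hh (x + Pi.single (M := fun _ => ℝ) j (2 * Real.pi * ((-(k : ℤ) - 1 : ℤ) : ℝ))) j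
      rw [add_assoc x, ← Pi.single_add] at this
      rw [← this, ← ih x]; push_cast; ring_nf
  have many : ∀ (S : Finset (Fin d)) (x : Fin d → ℝ),
      h (x + ∑ j ∈ S, Pi.single j (2 * Real.pi * (n j : ℝ))) = h x := by
    intro S
    induction S using Finset.induction_on with
    | empty => intro x; simp
    | insert j S hj ih => intro x; rw [Finset.sum_insert hj, ← add_assoc, ih, one]
  have := many Finset.univ x
  rwa [Finset.univ_sum_single] at this

/-- The function on the torus `(ℝ/ℤ)^d` induced by a function on `ℝ^d`. -/
def torusLift {β : Type*} (h : (Fin d → ℝ) → β) (y : UnitAddTorus (Fin d)) : β :=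
  h (fun i => 2 * Real.pi * (AddCircle.equivIco (1 : ℝ) 0 (y i) : ℝ))

theorem torusLift_coe {β : Type*} {h : (Fin d → ℝ) → β} (hh : BoxPeriodic h) (x : Fin d → ℝ) :
    torusLift h (fun i => (x i : UnitAddCircle)) = h (fun i => 2 * Real.pi * x i) := by
  rw [torusLift, ← hh.add_int _ (fun i => ⌊x i⌋)]
  congr 1
  ext i
  simp only [AddCircle.coe_equivIco_mk_apply, Pi.add_apply, div_one, mul_one, ← mul_add]
  rw [Int.fract_add_floor]

theorem continuous_torusLift {β : Type*} [TopologicalSpace β] {h : (Fin d → ℝ) → β}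
    (hh : BoxPeriodic h) (hc : Continuous h) : Continuous (torusLift h) := by
  have q : IsOpenQuotientMap (Pi.map fun (_ : Fin d) (x : ℝ) => (x : UnitAddCircle)) :=
    IsOpenQuotientMap.piMap fun _ => QuotientAddGroup.isOpenQuotientMap_mk
  rw [q.isQuotientMap.continuous_iff]
  have : torusLift h ∘ (Pi.map fun (_ : Fin d) (x : ℝ) => (x : UnitAddCircle)) =
      fun x => h (fun i => 2 * Real.pi * x i) := by
    ext x; exact torusLift_coe hh x
  rw [this]; fun_prop

theorem mFourier_coe (α : Fin d → ℤ) (x : Fin d → ℝ) :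
    UnitAddTorus.mFourier α (fun i => (x i : UnitAddCircle)) =
      character α (fun i => 2 * Real.pi * x i) := by
  simp only [UnitAddTorus.mFourier, ContinuousMap.coe_mk, fourier_coe_apply, character, phase]
  rw [← Complex.exp_sum]
  congr 1
  push_cast
  rw [Finset.mul_sum]
  refine Finset.sum_congr rfl fun i _ => ?_
  simp; ring

/-- Rescaling of a box integral to a unit box. -/
theorem integral_box_eq (h : (Fin d → ℝ) → ℂ) (a : Fin d → ℝ) :
    ∫ x in Set.Icc (fun i => 2 * Real.pi * a i) (fun i => 2 * Real.pi * a i + 2 * Real.pi), h x =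
      ((2 * Real.pi : ℝ) : ℂ) ^ d *
        ∫ x in {x : Fin d → ℝ | ∀ i, x i ∈ Ioc (a i) (a i + 1)}, h (fun i => 2 * Real.pi * x i) := by
  have hpi : (0 : ℝ) < 2 * Real.pi := by positivity
  simp_rw [show ∀ x : Fin d → ℝ, h (fun i => 2 * Real.pi * x i) = h ((2 * Real.pi) • x) from fun x => rfl]
  rw [Measure.setIntegral_comp_smul volume h _ hpi.ne']
  have hs : (2 * Real.pi) • {x : Fin d → ℝ | ∀ i, x i ∈ Ioc (a i) (a i + 1)} =
      Set.univ.pi fun i => Ioc (2 * Real.pi * a i) (2 * Real.pi * a i + 2 * Real.pi) := by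
    ext x
    rw [Set.mem_smul_set_iff_inv_smul_mem₀ hpi.ne']
    simp only [mem_ofPred_eq, Pi.smul_apply, smul_eq_mul, mem_Ioc, mem_pi, mem_univ, true_imp_iff]
    refine forall_congr' fun i => ?_
    rw [← div_eq_inv_mul, lt_div_iff₀ hpi, div_le_iff₀ hpi]
    constructor <;> rintro ⟨h1, h2⟩ <;> constructor <;> nlinarith
  -- The half-open box is the fundamental domain of the torus; it differs from the closed box by a
  -- null set.
  rw [hs, volume_pi, setIntegral_congr_set Measure.univ_pi_Ioc_ae_eq_Icc]
  have hfin : Module.finrank ℝ (Fin d → ℝ) = d := by simp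
  rw [hfin, abs_of_pos (by positivity), Complex.real_smul, ← mul_assoc]
  push_cast
  rw [mul_inv_cancel₀ (pow_ne_zero _ (mul_ne_zero two_ne_zero (ofReal_ne_zero.2 Real.pi_ne_zero))), one_mul]

/-- The bridge through which Fourier inversion on `UnitAddTorus` becomes available for periodic
functions on `ℝ^d`. -/
theorem coeff_eq_mFourierCoeff {h : (Fin d → ℝ) → ℂ} (hh : BoxPeriodic h) (α : Fin d → ℤ) :
    coeff h α = UnitAddTorus.mFourierCoeff (torusLift h) α := by
  rw [UnitAddTorus.mFourierCoeff_eq_integral _ _ (0 : Fin d → ℝ), coeff_eq]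
  have := integral_box_eq (fun x => character (-α) x * h x) 0
  simp only [Pi.zero_apply, mul_zero, zero_add] at this
  simp only [Pi.zero_apply, zero_add, smul_eq_mul, mFourier_coe, torusLift_coe hh]
  rw [show (0 : Fin d → ℝ) = fun _ => 0 from rfl, this, ← mul_assoc, ← mul_pow, inv_mul_cancel₀, one_pow, one_mul]
  exact_mod_cast (by positivity : (2 * Real.pi : ℝ) ≠ 0)

/-- After rescaling, the integral over a period box with any corner is the zeroth Fourier
coefficient of the induced function on the torus, so the corner does not matter. -/
theorem integral_box_translate {h : (Fin d → ℝ) → ℂ} (hh : BoxPeriodic h) (c : Fin d → ℝ) :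
    ∫ x in Set.Icc (0 : Fin d → ℝ) (fun _ => 2 * Real.pi), h (x + c) =
      ∫ x in Set.Icc (0 : Fin d → ℝ) (fun _ => 2 * Real.pi), h x := by
  have hpi : (2 * Real.pi) ≠ 0 := by positivity
  have key : ∀ a : Fin d → ℝ,
      ∫ x in Set.Icc (fun i => 2 * Real.pi * a i) (fun i => 2 * Real.pi * a i + 2 * Real.pi), h x =
        ((2 * Real.pi : ℝ) : ℂ) ^ d * UnitAddTorus.mFourierCoeff (torusLift h) 0 := by
    intro a
    rw [integral_box_eq, UnitAddTorus.mFourierCoeff_eq_integral _ _ a]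
    simp only [torusLift_coe hh, neg_zero, UnitAddTorus.mFourier_zero, ContinuousMap.one_apply,
      one_smul]
  have k0 := key 0
  simp only [Pi.zero_apply, mul_zero, zero_add] at k0
  have k1 := key (fun i => c i / (2 * Real.pi))
  simp only [mul_div_cancel₀ _ hpi] at k1
  rw [show (0 : Fin d → ℝ) = fun _ => 0 from rfl, k0, ← k1]
  have := (measurePreserving_add_right (volume : Measure (Fin d → ℝ)) c).setIntegral_preimage_emb
    (measurableEmbedding_addRight c) h (Set.Icc (fun i => c i) (fun i => c i + 2 * Real.pi))
  rw [← this]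
  congr 2
  ext x
  simp only [mem_Icc, mem_preimage, Pi.le_def, Pi.add_apply]
  constructor <;> rintro ⟨h1, h2⟩ <;> constructor <;> intro i <;> have a := h1 i <;> have b := h2 i <;> 
    linarith

/-- Fourier inversion for continuous functions with summable Fourier coefficients. -/
theorem hasSum_coeff {h : (Fin d → ℝ) → ℂ} (hh : BoxPeriodic h) (hc : Continuous h)
    (hs : Summable fun α => ‖coeff h α‖) (x : Fin d → ℝ) :
    HasSum (fun α => coeff h α * character α x) (h x) := by
  have hpi : (2 * Real.pi) ≠ 0 := by positivity
  let f : C(UnitAddTorus (Fin d), ℂ) := ⟨torusLift h, continuous_torusLift hh hc⟩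
  have hs' : Summable (UnitAddTorus.mFourierCoeff f) := by
    refine (Summable.of_norm hs).congr fun α => ?_
    exact coeff_eq_mFourierCoeff hh α
  have := UnitAddTorus.hasSum_mFourier_series_apply_of_summable hs'
    (fun i => ((x i / (2 * Real.pi) : ℝ) : UnitAddCircle))
  have e : f (fun i => ((x i / (2 * Real.pi) : ℝ) : UnitAddCircle)) = h x := by
    change torusLift h _ = _
    rw [torusLift_coe hh]
    simp only [mul_div_cancel₀ _ hpi]
  rw [e] at this
  refine this.congr_fun fun α => ?_
  rw [mFourier_coe, coeff_eq_mFourierCoeff hh, smul_eq_mul]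
  simp only [mul_div_cancel₀ _ hpi]
  rfl

/-- For `α ≠ 0`, a translation by `π/α_j` in a coordinate with `α_j ≠ 0` changes the sign of the
character and leaves the integral unchanged, so the integral is zero. -/
theorem integral_box_character (α : Fin d → ℤ) :
    ∫ x in Set.Icc (0 : Fin d → ℝ) (fun _ => 2 * Real.pi), character α x =
      if α = 0 then ((2 * Real.pi : ℝ) : ℂ) ^ d else 0 := by
  split_ifs with h
  · subst h
    simp [Measure.real, Real.volume_Icc_pi, ENNReal.toReal_ofReal Real.pi_pos.le]
  · obtain ⟨j, hj⟩ := Function.ne_iff.mp h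
    let c : Fin d → ℝ := Pi.single j (Real.pi / α j)
    have hαj : (α j : ℝ) ≠ 0 := by exact_mod_cast hj
    have hc : character α c = -1 := by
      have : phase α c = Real.pi := by
        rw [phase, Finset.sum_eq_single j]
        · simp [c]; field_simp
        · intro b _ hb; simp [c, hb]
        · simp
      rw [character, this, mul_comm, Complex.exp_pi_mul_I]
    have := integral_box_translate (boxPeriodic_character α) c
    simp only [character_add, hc, mul_neg, mul_one, integral_neg] at this
    have h2 : (2 : ℂ) * ∫ x in Set.Icc (0 : Fin d → ℝ) (fun _ => 2 * Real.pi), character α x = 0 := by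
      linear_combination -this
    simpa using h2

theorem coeff_character (ν α : Fin d → ℤ) :
    coeff (character ν) α = if ν = α then 1 else 0 := by
  have hpi : ((2 * Real.pi : ℝ) : ℂ) ≠ 0 := by exact_mod_cast (by positivity : (2 * Real.pi : ℝ) ≠ 0)
  simp only [coeff_eq, ← character_add_left, integral_box_character]
  have : -α + ν = 0 ↔ ν = α := by rw [neg_add_eq_zero, eq_comm]
  simp only [this]
  split_ifs
  · rw [← mul_pow, inv_mul_cancel₀ hpi, one_pow]
  · simp

theorem integrable_box {h : (Fin d → ℝ) → ℂ} (hc : Continuous h) :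
    IntegrableOn h (Set.Icc (0 : Fin d → ℝ) (fun _ => 2 * Real.pi)) :=
  hc.continuousOn.integrableOn_compact isCompact_Icc

/-- Fourier coefficients of an absolutely convergent sum of characters. -/
theorem coeff_of_hasSum {ι : Type*} [Countable ι] {h : (Fin d → ℝ) → ℂ} {ν : ι → Fin d → ℤ}
    {b : ι → ℂ} (hb : Summable fun i => ‖b i‖)
    (hh : ∀ x, HasSum (fun i => b i * character (ν i) x) (h x)) (α : Fin d → ℤ) :
    HasSum (fun i => if ν i = α then b i else 0) (coeff h α) := by
  have hint := hasSum_integral_of_summable_integral_norm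
    (μ := volume.restrict (Set.Icc (0 : Fin d → ℝ) (fun _ => 2 * Real.pi)))
    (F := fun i x => character (-α) x * (b i * character (ν i) x))
    (fun i => integrable_box (by
      have := continuous_character (-α); have := continuous_character (ν i); fun_prop))
    (by
      simp only [norm_mul, norm_character, one_mul, mul_one, integral_const]
      exact hb.mul_left _)
  have h2 := hint.mul_left (((2 * Real.pi : ℝ) : ℂ)⁻¹ ^ d)
  have e : ∀ x, ∑' i, character (-α) x * (b i * character (ν i) x) = character (-α) x * h x :=
    fun x => ((hh x).mul_left _).tsum_eq
  simp only [e] at h2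
  rw [← coeff_eq] at h2
  refine h2.congr_fun fun i => ?_
  have : (if ν i = α then b i else 0) = b i * coeff (character (ν i)) α := by
    rw [coeff_character]; split_ifs <;> simp
  rw [this, coeff_eq, ← mul_assoc, mul_comm (b i), mul_assoc, ← integral_const_mul]
  congr 2
  ext x; ring

end GenFun
end

/-! ### Linearity of the coefficients, averages and pull-backs -/

noncomputable section

namespace GenFun

open MeasureTheory Set Complex

variable {d m : ℕ}

theorem coeff_add {f g : (Fin d → ℝ) → ℂ} (hf : Continuous f) (hg : Continuous g)
    (α : Fin d → ℤ) : coeff (fun x => f x + g x) α = coeff f α + coeff g α := by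
  have := continuous_character (-α)
  simp only [coeff_eq, mul_add]
  rw [integral_add (integrable_box (by fun_prop)) (integrable_box (by fun_prop)), mul_add]

theorem coeff_const_mul (c : ℂ) (f : (Fin d → ℝ) → ℂ) (α : Fin d → ℤ) :
    coeff (fun x => c * f x) α = c * coeff f α := by
  simp only [coeff_eq, mul_left_comm _ c, integral_const_mul]

theorem coeff_sub {f g : (Fin d → ℝ) → ℂ} (hf : Continuous f) (hg : Continuous g)
    (α : Fin d → ℤ) : coeff (fun x => f x - g x) α = coeff f α - coeff g α := by
  have h := coeff_add hf (hg.const_mul (-1 : ℂ)) α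
  rw [coeff_const_mul] at h
  simpa only [neg_mul, one_mul, ← sub_eq_add_neg] using h

theorem coeff_sum {ι : Type*} (s : Finset ι) {f : ι → (Fin d → ℝ) → ℂ} (hf : ∀ i, Continuous (f i))
    (α : Fin d → ℤ) : coeff (fun x => ∑ i ∈ s, f i x) α = ∑ i ∈ s, coeff (f i) α := by
  have := continuous_character (-α)
  simp only [coeff_eq, Finset.mul_sum]
  rw [integral_finsetSum _ fun i _ => integrable_box (by have := hf i; fun_prop), Finset.mul_sum]

theorem norm_box_average_le {f : (Fin d → ℝ) → ℂ} {K : ℝ} (hf : ∀ x, ‖f x‖ ≤ K) :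
    ‖((2 * Real.pi : ℝ) : ℂ)⁻¹ ^ d *
      ∫ x in Set.Icc (0 : Fin d → ℝ) (fun _ => 2 * Real.pi), f x‖ ≤ K := by
  have hpi : (0 : ℝ) < 2 * Real.pi := by positivity
  have h := norm_setIntegral_le_of_norm_le_const (μ := volume)
    (s := Set.Icc (0 : Fin d → ℝ) (fun _ => 2 * Real.pi)) (f := f) (C := K)
    isCompact_Icc.measure_lt_top (fun x _ => hf x)
  have hv : volume.real (Set.Icc (0 : Fin d → ℝ) (fun _ => 2 * Real.pi)) = (2 * Real.pi) ^ d := by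
    simp [Measure.real, Real.volume_Icc_pi, ENNReal.toReal_ofReal Real.pi_pos.le]
  rw [hv] at h
  rw [norm_mul, norm_pow, norm_inv, Complex.norm_real, Real.norm_of_nonneg hpi.le]
  calc (2 * Real.pi)⁻¹ ^ d * _ ≤ (2 * Real.pi)⁻¹ ^ d * (K * (2 * Real.pi) ^ d) := by gcongr
    _ = K := by rw [mul_left_comm, ← mul_pow, inv_mul_cancel₀ hpi.ne', one_pow, mul_one]

theorem box_average_const (c : ℂ) :
    ((2 * Real.pi : ℝ) : ℂ)⁻¹ ^ d *
      ∫ _x in Set.Icc (0 : Fin d → ℝ) (fun _ => 2 * Real.pi), c = c := by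
  have hpi : ((2 * Real.pi : ℝ) : ℂ) ≠ 0 := by
    exact_mod_cast (by positivity : (2 * Real.pi : ℝ) ≠ 0)
  have hv : volume.real (Set.Icc (0 : Fin d → ℝ) (fun _ => 2 * Real.pi)) = (2 * Real.pi) ^ d := by
    simp [Measure.real, Real.volume_Icc_pi, ENNReal.toReal_ofReal Real.pi_pos.le]
  rw [setIntegral_const, hv, Complex.real_smul, Complex.ofReal_pow, ← mul_assoc, ← mul_pow,
    inv_mul_cancel₀ hpi, one_pow, one_mul]

/-- A bound on the `α`-th Fourier coefficients of all the translated pull-backs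
`x ↦ h (L x + φ)` bounds the `k`-th Fourier coefficient of `h`, when `k·L x = α·x`. -/
theorem norm_coeff_le_of_pullback {n : ℕ} {h : (Fin n → ℝ) → ℂ} (hp : BoxPeriodic h)
    (hc : Continuous h) {L : (Fin d → ℝ) → Fin n → ℝ} (hL : Continuous L) {k : Fin n → ℤ}
    {α : Fin d → ℤ} (hk : ∀ x, phase k (L x) = phase α x) {K : ℝ}
    (hK : ∀ φ, ‖coeff (fun x => h (L x + φ)) α‖ ≤ K) : ‖coeff h k‖ ≤ K := by
  have hchar : Continuous (character (-k)) := continuous_character _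
  set bn := Set.Icc (0 : Fin n → ℝ) (fun _ => 2 * Real.pi)
  set bd := Set.Icc (0 : Fin d → ℝ) (fun _ => 2 * Real.pi)
  -- By translation invariance the average over `φ` is the same for every `x`. Averaging over `x` as
  -- well and exchanging the integrals leaves, for each fixed `φ`, the `α`-th coefficient of the
  -- pull-back times a unimodular factor.
  have e1 : ∀ x, coeff h k = ((2 * Real.pi : ℝ) : ℂ)⁻¹ ^ n *
      ∫ φ in bn, character (-k) (φ + L x) * h (φ + L x) := by
    intro x
    rw [coeff_eq, integral_box_translate ((boxPeriodic_character (-k)).mul hp)]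
  have e2 : coeff h k = ((2 * Real.pi : ℝ) : ℂ)⁻¹ ^ d * ∫ x in bd,
      (((2 * Real.pi : ℝ) : ℂ)⁻¹ ^ n * ∫ φ in bn, character (-k) (φ + L x) * h (φ + L x)) := by
    simp only [← e1]
    rw [box_average_const]
  have swap : ∫ x in bd, ∫ φ in bn, character (-k) (φ + L x) * h (φ + L x) =
      ∫ φ in bn, ∫ x in bd, character (-k) (φ + L x) * h (φ + L x) := by
    apply integral_integral_swap
    have hcont : Continuous (Function.uncurry fun (x : Fin d → ℝ) (φ : Fin n → ℝ) =>
        character (-k) (φ + L x) * h (φ + L x)) := by fun_prop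
    rw [Measure.prod_restrict]
    exact hcont.continuousOn.integrableOn_compact (isCompact_Icc.prod isCompact_Icc)
  have e3 : coeff h k = ((2 * Real.pi : ℝ) : ℂ)⁻¹ ^ n * ∫ φ in bn,
      character (-k) φ * coeff (fun x => h (L x + φ)) α := by
    rw [e2, integral_const_mul, swap, mul_left_comm]
    congr 1
    rw [← integral_const_mul]
    congr 1
    ext φ
    rw [coeff_eq, mul_left_comm, ← integral_const_mul (character (-k) φ)]
    congr 2
    ext x
    have : character (-k) (L x) = character (-α) x := by
      simp only [character, phase_neg_left, hk]
    rw [character_add, this, add_comm φ]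
    ring
  rw [e3]
  apply norm_box_average_le
  intro φ
  rw [norm_mul, norm_character, one_mul]
  exact hK φ

/-! ### Frequency lengths and cosine sums as test functions -/

theorem freqNorm_nonneg (α : Fin d → ℤ) : 0 ≤ freqNorm α := Real.sqrt_nonneg _

@[simp] theorem freqNorm_zero : freqNorm (0 : Fin d → ℤ) = 0 := by simp [freqNorm]

@[simp] theorem freqNorm_neg (α : Fin d → ℤ) : freqNorm (-α) = freqNorm α := by simp [freqNorm]

theorem freqNorm_eq_norm (α : Fin d → ℤ) :
    freqNorm α = ‖(WithLp.toLp 2 fun j => (α j : ℝ) : EuclideanSpace ℝ (Fin d))‖ := by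
  simp [freqNorm, EuclideanSpace.norm_eq]

theorem freqNorm_add_le (α β : Fin d → ℤ) : freqNorm (α + β) ≤ freqNorm α + freqNorm β := by
  simp only [freqNorm_eq_norm]
  refine le_trans (le_of_eq ?_) (norm_add_le _ _)
  congr 1; ext j; simp

theorem abs_le_freqNorm (α : Fin d → ℤ) (j : Fin d) : |(α j : ℝ)| ≤ freqNorm α := by
  rw [freqNorm, ← Real.sqrt_sq_eq_abs]
  exact Real.sqrt_le_sqrt (Finset.single_le_sum (f := fun j => (α j : ℝ) ^ 2)
    (fun i _ => sq_nonneg _) (Finset.mem_univ j))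

/-- The sum of the absolute values of the components. -/
def sumAbs (V : EuclideanSpace ℝ (Fin m)) : ℝ := ∑ i, |V i|

theorem sumAbs_nonneg (V : EuclideanSpace ℝ (Fin m)) : 0 ≤ sumAbs V :=
  Finset.sum_nonneg fun _ _ => abs_nonneg _

theorem norm_le_sum_norm (v : EuclideanSpace ℂ (Fin m)) : ‖v‖ ≤ ∑ i, ‖v i‖ := by
  have : v = ∑ i, EuclideanSpace.single i (v i) := by
    ext j
    simp [Finset.sum_apply]
  calc ‖v‖ = ‖∑ i, EuclideanSpace.single i (v i)‖ := by rw [← this]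
    _ ≤ ∑ i, ‖EuclideanSpace.single i (v i)‖ := norm_sum_le _ _
    _ = _ := by simp

theorem norm_apply_le_norm (v : EuclideanSpace ℂ (Fin m)) (i : Fin m) : ‖v i‖ ≤ ‖v‖ :=
  PiLp.norm_apply_le v i

/-- Finite sums of phase-shifted cosines with vector amplitudes. -/
def cosSum {ι : Type*} [Fintype ι] (β : ι → Fin d → ℤ) (φ : ι → ℝ)
    (V : ι → EuclideanSpace ℝ (Fin m)) (x : Fin d → ℝ) : EuclideanSpace ℝ (Fin m) :=
  ∑ l, Real.cos (phase (β l) x + φ l) • V l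

section CosSum

variable {ι : Type*} [Fintype ι] (β : ι → Fin d → ℤ) (φ : ι → ℝ)
  (V : ι → EuclideanSpace ℝ (Fin m))

theorem continuous_cosSum : Continuous (cosSum β φ V) := by
  have := fun l => continuous_phase (β l)
  unfold cosSum; fun_prop

theorem ofReal_cos_phase (α : Fin d → ℤ) (c : ℝ) (x : Fin d → ℝ) :
    ((Real.cos (phase α x + c) : ℝ) : ℂ) =
      Complex.exp (Complex.I * c) / 2 * character α x +
        Complex.exp (-(Complex.I * c)) / 2 * character (-α) x := by
  rw [Complex.ofReal_cos, Complex.cos, character, character, phase_neg_left]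
  push_cast
  rw [show ((phase α x : ℂ) + c) * I = I * c + I * phase α x by ring,
    show -((phase α x : ℂ) + c) * I = -(I * c) + I * -phase α x by ring, Complex.exp_add,
    Complex.exp_add]
  ring

theorem boxPeriodic_cos_phase (α : Fin d → ℤ) (c : ℝ) :
    BoxPeriodic fun x : Fin d → ℝ => Real.cos (phase α x + c) := by
  intro x j
  apply Complex.ofReal_injective
  simp only [ofReal_cos_phase, boxPeriodic_character α x j, boxPeriodic_character (-α) x j]

theorem periodic_cosSum : Periodic (cosSum β φ V) := by
  intro x j
  simp only [cosSum]
  exact Finset.sum_congr rfl fun l _ => by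
    rw [show Real.cos _ = Real.cos _ from boxPeriodic_cos_phase (β l) (φ l) x j]

/-- A cosine splits into two characters of amplitude `1/2`. The two contributions are added instead
of being separated into cases, so that `β = 0`, where both frequencies coincide, is covered too. -/
theorem norm_coeff_cos_le (α β : Fin d → ℤ) (c : ℝ) :
    ‖coeff (fun x => ((Real.cos (phase β x + c) : ℝ) : ℂ)) α‖ ≤
      (if β = α then 1 / 2 else 0) + (if -β = α then 1 / 2 else 0) := by
  have h1 := continuous_character β
  have h2 := continuous_character (-β)
  simp only [ofReal_cos_phase]
  rw [coeff_add (by fun_prop) (by fun_prop), coeff_const_mul, coeff_const_mul, coeff_character,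
    coeff_character]
  have n1 : ‖Complex.exp (Complex.I * c)‖ = 1 := by rw [mul_comm, norm_exp_ofReal_mul_I]
  have n2 : ‖Complex.exp (-(Complex.I * c))‖ = 1 := by
    rw [mul_comm, ← neg_mul, ← Complex.ofReal_neg, norm_exp_ofReal_mul_I]
  refine (norm_add_le _ _).trans (le_of_eq ?_)
  congr 1 <;> split_ifs <;> simp [n1, n2]

theorem norm_fourierCoeff_cosSum_le (α : Fin d → ℤ) :
    ‖fourierCoeff (cosSum β φ V) α‖ ≤
      ∑ l, sumAbs (V l) * ((if β l = α then 1 / 2 else 0) + (if -β l = α then 1 / 2 else 0)) := by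
  refine (norm_le_sum_norm _).trans ?_
  have hi : ∀ i, ‖fourierCoeff (cosSum β φ V) α i‖ ≤
      ∑ l, |V l i| * ((if β l = α then 1 / 2 else 0) + (if -β l = α then 1 / 2 else 0)) := by
    intro i
    rw [fourierCoeff_apply]
    have : (fun x => ((cosSum β φ V x i : ℝ) : ℂ)) =
        fun x => ∑ l, ((V l i : ℝ) : ℂ) * ((Real.cos (phase (β l) x + φ l) : ℝ) : ℂ) := by
      ext x
      simp [cosSum, mul_comm]
    rw [this, coeff_sum _ (fun l => by have := continuous_phase (β l); fun_prop)]
    refine (norm_sum_le _ _).trans (Finset.sum_le_sum fun l _ => ?_)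
    rw [coeff_const_mul, norm_mul, Complex.norm_real, Real.norm_eq_abs]
    gcongr
    exact norm_coeff_cos_le _ _ _
  refine (Finset.sum_le_sum fun i _ => hi i).trans (le_of_eq ?_)
  rw [Finset.sum_comm]
  simp only [sumAbs, Finset.sum_mul]

theorem hasDerivAt_gen_toReal_of_finite_support {f : (Fin d → ℝ) → EuclideanSpace ℝ (Fin m)}
    {S : Finset (Fin d → ℤ)} (hS : ∀ α ∉ S, fourierCoeff f α = 0) :
    (∀ z, Gen f z = ENNReal.ofReal (∑ α ∈ S, Real.exp (z * freqNorm α) * ‖fourierCoeff f α‖)) ∧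
    ∀ z, HasDerivAt (fun y => (Gen f y).toReal)
      (∑ α ∈ S, freqNorm α * Real.exp (z * freqNorm α) * ‖fourierCoeff f α‖) z := by
  have h1 : ∀ z, Gen f z =
      ENNReal.ofReal (∑ α ∈ S, Real.exp (z * freqNorm α) * ‖fourierCoeff f α‖) := by
    intro z
    rw [Gen, tsum_eq_sum (s := S), ENNReal.ofReal_sum_of_nonneg]
    · intro α _; positivity
    · intro α hα; simp [hS α hα]
  refine ⟨h1, fun z => ?_⟩
  have h2 : (fun y => (Gen f y).toReal) =
      fun y => ∑ α ∈ S, Real.exp (y * freqNorm α) * ‖fourierCoeff f α‖ := by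
    ext y
    rw [h1, ENNReal.toReal_ofReal]
    exact Finset.sum_nonneg fun α _ => by positivity
  rw [h2]
  refine HasDerivAt.fun_sum fun α _ => ?_
  have := ((hasDerivAt_id z).mul_const (freqNorm α)).exp.mul_const ‖fourierCoeff f α‖
  simp only [id, one_mul] at this
  rwa [mul_comm (Real.exp _)] at this

/-- The frequencies of a sum of cosines. -/
def cosSupport : Finset (Fin d → ℤ) :=
  Finset.univ.image β ∪ Finset.univ.image (fun l => -β l)

theorem fourierCoeff_cosSum_eq_zero (α : Fin d → ℤ) (hα : α ∉ cosSupport β) :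
    fourierCoeff (cosSum β φ V) α = 0 := by
  rw [← norm_le_zero_iff]
  refine (norm_fourierCoeff_cosSum_le β φ V α).trans (le_of_eq ?_)
  simp only [cosSupport, Finset.mem_union, Finset.mem_image, Finset.mem_univ, true_and, not_or,
    not_exists] at hα
  simp [hα.1, hα.2]

/-- Each cosine puts half of its amplitude at `β l` and half at `-β l`, where the even weight `w`
has equal values; coinciding frequencies are absorbed by the triangle inequality. The weights
`e^{z|α|}` and `|α| e^{z|α|}` give the generator function and its derivative. -/
theorem sum_cosSupport_le {w : (Fin d → ℤ) → ℝ} (hw : ∀ α, 0 ≤ w α) (hw' : ∀ α, w (-α) = w α) :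
    ∑ α ∈ cosSupport β, w α * ‖fourierCoeff (cosSum β φ V) α‖ ≤ ∑ l, sumAbs (V l) * w (β l) := by
  calc _ ≤ ∑ α ∈ cosSupport β, w α * ∑ l, sumAbs (V l) *
        ((if β l = α then 1 / 2 else 0) + (if -β l = α then 1 / 2 else 0)) := by
        refine Finset.sum_le_sum fun α _ => ?_
        exact mul_le_mul_of_nonneg_left (norm_fourierCoeff_cosSum_le β φ V α) (hw α)
    _ = ∑ l, sumAbs (V l) * ∑ α ∈ cosSupport β, w α *
        ((if β l = α then 1 / 2 else 0) + (if -β l = α then 1 / 2 else 0)) := by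
        simp only [Finset.mul_sum]
        rw [Finset.sum_comm]
        exact Finset.sum_congr rfl fun l _ => Finset.sum_congr rfl fun α _ => by ring
    _ = _ := by
        refine Finset.sum_congr rfl fun l _ => ?_
        have m1 : β l ∈ cosSupport β := by simp [cosSupport]
        have m2 : -β l ∈ cosSupport β := by simp [cosSupport]
        simp only [mul_add, mul_ite, mul_zero, Finset.sum_add_distrib, Finset.sum_ite_eq, m1, m2,
          if_true, hw']
        ring

theorem cosSum_mem_X (z : ℝ) : cosSum β φ V ∈ X d m z := by
  refine ⟨continuous_cosSum β φ V, periodic_cosSum β φ V, ?_⟩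
  rw [(hasDerivAt_gen_toReal_of_finite_support (fourierCoeff_cosSum_eq_zero β φ V)).1]
  exact ENNReal.ofReal_lt_top

theorem hasFDerivAt_cos_phase (α : Fin d → ℤ) (c : ℝ) (x : Fin d → ℝ) :
    HasFDerivAt (fun x => Real.cos (phase α x + c))
      (-(Real.sin (phase α x + c)) • ∑ j, (α j : ℝ) • ContinuousLinearMap.proj (R := ℝ) (φ := fun _ : Fin d => ℝ) j) x := by
  have h : HasFDerivAt (phase α)
      (∑ j, (α j : ℝ) • ContinuousLinearMap.proj (R := ℝ) (φ := fun _ : Fin d => ℝ) j) x := by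
    unfold phase
    refine HasFDerivAt.fun_sum fun j _ => ?_
    exact (ContinuousLinearMap.proj (R := ℝ) (φ := fun _ : Fin d => ℝ) j).hasFDerivAt.const_mul _
  exact (h.add_const c).cos

theorem grad_cosSum (x : Fin d → ℝ) (j : Fin d) :
    grad (cosSum β φ V) x j = ∑ l, (-(Real.sin (phase (β l) x + φ l)) * β l j) • V l := by
  have : HasFDerivAt (cosSum β φ V) (∑ l, ((-(Real.sin (phase (β l) x + φ l)) • ∑ j, (β l j : ℝ) •
      ContinuousLinearMap.proj (R := ℝ) (φ := fun _ : Fin d => ℝ) j) : (Fin d → ℝ) →L[ℝ] ℝ).smulRight (V l)) x := by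
    unfold cosSum
    exact HasFDerivAt.fun_sum fun l _ => (hasFDerivAt_cos_phase (β l) (φ l) x).smul_const (V l)
  rw [grad, this.fderiv]
  simp only [_root_.sum_apply, ContinuousLinearMap.smulRight_apply,
    _root_.smul_apply, ContinuousLinearMap.proj_apply, smul_eq_mul]
  refine Finset.sum_congr rfl fun l _ => ?_
  congr 2
  rw [Finset.sum_eq_single j]
  · simp
  · intro b _ hb; simp [hb]
  · simp

/-- The generator bound tested on a sum of cosines. -/
theorem GeneratorBound.norm_coeff_le {A : EuclideanSpace ℝ (Fin m) →
      (Fin d → EuclideanSpace ℝ (Fin m)) → EuclideanSpace ℝ (Fin m)}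
    {C₀ : ℝ} {F : ℝ → ℝ} (hb : GeneratorBound A C₀ F) {z K₁ K₂ KF : ℝ} (hz : 0 ≤ z)
    (h1 : ∑ l, sumAbs (V l) * Real.exp (z * freqNorm (β l)) ≤ K₁)
    (h2 : ∑ l, sumAbs (V l) * (freqNorm (β l) * Real.exp (z * freqNorm (β l))) ≤ K₂)
    (hF : ∀ y ∈ Set.Icc 0 K₁, |F y| ≤ KF) (α : Fin d → ℤ) (i : Fin m) :
    ‖coeff (fun x => ((A (cosSum β φ V x) (grad (cosSum β φ V) x) i : ℝ) : ℂ)) α‖ ≤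
      Real.exp (-(z * freqNorm α)) * (|C₀| * KF * (1 + K₂)) := by
  set u := cosSum β φ V
  obtain ⟨hg, hd⟩ := hasDerivAt_gen_toReal_of_finite_support (fourierCoeff_cosSum_eq_zero β φ V)
  -- Finite cosine sums belong to `X d m z'` for every `z'`, so any radius beyond `z` would do.
  have key := hb z (z + 1) hz (by linarith) u (cosSum_mem_X β φ V _)
  rw [(hd z).deriv, hg z] at key
  set G := ∑ α ∈ cosSupport β, Real.exp (z * freqNorm α) * ‖fourierCoeff u α‖
  set G' := ∑ α ∈ cosSupport β, freqNorm α * Real.exp (z * freqNorm α) * ‖fourierCoeff u α‖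
  have hG0 : 0 ≤ G := Finset.sum_nonneg fun α _ => by positivity
  have hG0' : 0 ≤ G' := Finset.sum_nonneg fun α _ => by
    have := freqNorm_nonneg α; positivity
  have hG : G ≤ K₁ := (sum_cosSupport_le β φ V (w := fun α => Real.exp (z * freqNorm α))
    (fun α => by positivity) (fun α => by simp)).trans h1
  have hG' : G' ≤ K₂ := (sum_cosSupport_le β φ V
    (w := fun α => freqNorm α * Real.exp (z * freqNorm α))
    (fun α => by have := freqNorm_nonneg α; positivity) (fun α => by simp)).trans h2
  rw [ENNReal.toReal_ofReal hG0] at key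
  have hFG := hF G ⟨hG0, hG⟩
  have hKF : 0 ≤ KF := (abs_nonneg _).trans hFG
  have hle : C₀ * F G * (1 + G') ≤ |C₀| * KF * (1 + K₂) := by
    have : C₀ * F G ≤ |C₀| * KF := by
      calc C₀ * F G ≤ |C₀ * F G| := le_abs_self _
        _ = |C₀| * |F G| := abs_mul _ _
        _ ≤ _ := by gcongr
    exact mul_le_mul this (by linarith) (by linarith) (by positivity)
  have hR : 0 ≤ |C₀| * KF * (1 + K₂) := by
    have : 0 ≤ K₂ := hG0'.trans hG'
    positivity
  set g := fun x => A (u x) (grad u x)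
  have h3 : ENNReal.ofReal (Real.exp (z * freqNorm α) * ‖fourierCoeff g α‖) ≤
      ENNReal.ofReal (|C₀| * KF * (1 + K₂)) :=
    ((ENNReal.le_tsum α).trans key).trans (ENNReal.ofReal_le_ofReal hle)
  rw [ENNReal.ofReal_le_ofReal_iff hR] at h3
  rw [← fourierCoeff_apply g α i]
  refine (norm_apply_le_norm _ i).trans ?_
  rw [Real.exp_neg, ← div_eq_inv_mul, le_div_iff₀ (Real.exp_pos _), mul_comm]
  exact h3

end CosSum

end GenFun
end

/-! ### `A` is affine in the gradient -/

noncomputable section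

namespace GenFun

open MeasureTheory Set Complex

variable {d m : ℕ}

@[simp] theorem phase_single (j : Fin d) (n : ℤ) (x : Fin d → ℝ) :
    phase (Pi.single j n) x = n * x j := by
  rw [phase, Finset.sum_eq_single j]
  · simp
  · intro b _ hb; simp [hb]
  · simp

@[simp] theorem freqNorm_single (j : Fin d) (n : ℤ) : freqNorm (Pi.single j n) = |(n : ℝ)| := by
  rw [freqNorm, Finset.sum_eq_single j]
  · simp [Real.sqrt_sq_eq_abs]
  · intro b _ hb; simp [hb]
  · simp

theorem freqNorm_nsmul (n : ℕ) (α : Fin d → ℤ) : freqNorm ((n : ℤ) • α) = n * freqNorm α := by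
  simp only [freqNorm, Pi.smul_apply, smul_eq_mul, Int.cast_mul, Int.cast_natCast, mul_pow,
    ← Finset.mul_sum]
  rw [Real.sqrt_mul (by positivity), Real.sqrt_sq (by positivity)]

theorem sumAbs_smul (c : ℝ) (V : EuclideanSpace ℝ (Fin m)) : sumAbs (c • V) = |c| * sumAbs V := by
  simp [sumAbs, abs_mul, Finset.mul_sum]

theorem sin_add_single (x : Fin d → ℝ) (j l : Fin d) :
    Real.sin ((x + Pi.single (M := fun _ => ℝ) j (2 * Real.pi)) l) = Real.sin (x l) := by
  by_cases h : l = j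
  · subst h; simp
  · simp [h]

theorem cos_add_single (x : Fin d → ℝ) (j l : Fin d) :
    Real.cos ((x + Pi.single (M := fun _ => ℝ) j (2 * Real.pi)) l) = Real.cos (x l) := by
  by_cases h : l = j
  · subst h; simp
  · simp [h]

theorem continuous_coeff_param {Y : Type*} [TopologicalSpace Y] [FirstCountableTopology Y]
    [LocallyCompactSpace Y] {f : Y → (Fin d → ℝ) → ℂ} (hf : Continuous (Function.uncurry f))
    (α : Fin d → ℤ) : Continuous fun y => coeff (f y) α := by
  have := continuous_character (-α)
  simp only [coeff_eq]
  refine continuous_const.mul ?_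
  exact continuous_parametric_integral_of_continuous
    (f := fun y x => character (-α) x * f y x) (by
      have h : (Function.uncurry fun y x => character (-α) x * f y x) =
        fun p => character (-α) p.2 * Function.uncurry f p := rfl
      rw [h]; fun_prop) isCompact_Icc

section Affine

variable {A : EuclideanSpace ℝ (Fin m) → (Fin d → EuclideanSpace ℝ (Fin m)) →
      EuclideanSpace ℝ (Fin m)} {C₀ : ℝ} {F : ℝ → ℝ}

/-- Boundedness on compact intervals is all that the argument takes from the analyticity of `F`. -/
theorem exists_bound_of_analytic (hF : AnalyticOnNhd ℝ F (Set.Ici 0)) (K : ℝ) :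
    ∃ KF, 0 ≤ KF ∧ ∀ y ∈ Set.Icc 0 K, |F y| ≤ KF := by
  have hc : ContinuousOn F (Set.Icc 0 K) := hF.continuousOn.mono fun y hy => hy.1
  obtain ⟨C, hC⟩ := isCompact_Icc.exists_bound_of_continuousOn hc
  exact ⟨max C 0, le_max_right _ _, fun y hy => (hC y hy).trans (le_max_left _ _)⟩

/-- The test function is `a + w(N x + φ)/N`, where `∂_j w` is the required gradient `cos θ_j p_j +
sin θ_j q_j`: a fast, small oscillation with gradient of order one. With `z = y/N` the weight of a
frequency of length `N` is `e^y`, independent of `N`. As `N → ∞` the argument `u` collapses to `a`,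
while the bound survives. It matters that `D` and `S` do not depend on `y`. -/
theorem norm_coeff_gradient_circle_le (hA : Continuous (Function.uncurry A))
    (hF : AnalyticOnNhd ℝ F (Set.Ici 0)) (hb : GeneratorBound A C₀ F)
    (a : EuclideanSpace ℝ (Fin m)) (p q : Fin d → EuclideanSpace ℝ (Fin m)) :
    ∃ D S : ℝ, 0 ≤ D ∧ 0 ≤ S ∧ ∀ y : ℝ, 0 ≤ y → ∀ (k : Fin d → ℤ) (i : Fin m),
      ‖coeff (fun θ => ((A a (fun j => Real.cos (θ j) • p j + Real.sin (θ j) • q j) i : ℝ) : ℂ)) k‖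
        ≤ Real.exp (-(y * freqNorm k)) * (D * (1 + S * Real.exp y)) := by
  obtain ⟨KF, hKF0, hKF⟩ := exists_bound_of_analytic hF (sumAbs a + 1)
  set S := ∑ j, (sumAbs (p j) + sumAbs (q j)) with hS
  have hS0 : 0 ≤ S := Finset.sum_nonneg fun j _ => add_nonneg (sumAbs_nonneg _) (sumAbs_nonneg _)
  refine ⟨|C₀| * KF, S, by positivity, hS0, fun y hy k i => ?_⟩
  let w : (Fin d → ℝ) → EuclideanSpace ℝ (Fin m) := fun θ =>
    ∑ j, (Real.sin (θ j) • p j - Real.cos (θ j) • q j)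
  let P : (Fin d → ℝ) → Fin d → EuclideanSpace ℝ (Fin m) := fun θ j =>
    Real.cos (θ j) • p j + Real.sin (θ j) • q j
  let H : ℝ → (Fin d → ℝ) → ℂ := fun ε θ => ((A (a + ε • w θ) (P θ) i : ℝ) : ℂ)
  have hH : Continuous (Function.uncurry H) := by
    have h1 : Continuous fun e : ℝ × (Fin d → ℝ) => (a + e.1 • w e.2, P e.2) := by
      simp only [w, P]; fun_prop
    have h2 := hA.comp h1
    have h3 : Continuous fun v : EuclideanSpace ℝ (Fin m) => ((v i : ℝ) : ℂ) := by fun_prop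
    exact h3.comp h2
  have hlim : Filter.Tendsto (fun n : ℕ => coeff (H (1 / ((n : ℝ) + 1))) k) Filter.atTop
      (𝓝 (coeff (H 0) k)) :=
    ((continuous_coeff_param hH k).tendsto 0).comp tendsto_one_div_add_atTop_nhds_zero_nat
  have hH0 : H 0 = fun θ => ((A a (P θ) i : ℝ) : ℂ) := by
    ext θ; simp [H]
  rw [hH0] at hlim
  refine le_of_tendsto hlim.norm ?_
  -- Once `N ≥ S e^y`, the oscillating part contributes at most `1` to the generator function at
  -- `y/N`, so `F` is only evaluated on `[0, sumAbs a + 1]`.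
  obtain ⟨n₀, hn₀⟩ := exists_nat_ge (S * Real.exp y)
  filter_upwards [Filter.eventually_ge_atTop n₀] with n hn
  have hper : BoxPeriodic (H (1 / ((n : ℝ) + 1))) := by
    intro x j
    simp only [H, w, P, sin_add_single, cos_add_single]
  have hN : (0 : ℝ) < (n : ℝ) + 1 := by positivity
  set N : ℝ := (n : ℝ) + 1 with hNdef
  have hNc : (((n + 1 : ℕ) : ℤ) : ℝ) = N := by push_cast; rfl
  let L : (Fin d → ℝ) → Fin d → ℝ := fun x j => N * x j
  refine norm_coeff_le_of_pullback (d := d) (L := L) (α := ((n + 1 : ℕ) : ℤ) • k) hper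
    (hH.comp (Continuous.prodMk_right _)) (by fun_prop) ?_ ?_
  · intro x
    simp only [phase, L, Pi.smul_apply, smul_eq_mul, Int.cast_mul, hNc]
    exact Finset.sum_congr rfl fun j _ => by ring
  intro φ
  -- The constant `a` is a cosine of frequency zero, and the sines are cosines with phase shifted by
  -- `-π/2`.
  let β : Unit ⊕ (Fin d ⊕ Fin d) → Fin d → ℤ :=
    Sum.elim (fun _ => 0) (Sum.elim (fun j => Pi.single j ((n + 1 : ℕ) : ℤ))
      (fun j => Pi.single j ((n + 1 : ℕ) : ℤ)))
  let ψ : Unit ⊕ (Fin d ⊕ Fin d) → ℝ :=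
    Sum.elim (fun _ => 0) (Sum.elim (fun j => φ j - Real.pi / 2) (fun j => φ j))
  let V : Unit ⊕ (Fin d ⊕ Fin d) → EuclideanSpace ℝ (Fin m) :=
    Sum.elim (fun _ => a) (Sum.elim (fun j => (1 / N) • p j) (fun j => (-(1 / N)) • q j))
  have hu : ∀ x, cosSum β ψ V x = a + (1 / N) • w (L x + φ) := by
    intro x
    simp only [cosSum, β, ψ, V, Fintype.sum_sum_type, Sum.elim_inl, Sum.elim_inr, phase_single,
      hNc, Finset.univ_unique, Finset.sum_singleton, phase_zero_left, add_zero, Real.cos_zero,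
      one_smul, w, L, Pi.add_apply]
    rw [← Finset.sum_add_distrib, Finset.smul_sum]
    congr 1
    refine Finset.sum_congr rfl fun j _ => ?_
    rw [← add_sub_assoc, Real.cos_sub_pi_div_two]
    module
  have hg : ∀ x, grad (cosSum β ψ V) x = P (L x + φ) := by
    intro x
    ext1 j
    have e1 : N * (1 / N) = 1 := by field_simp
    have hsingle : ∀ (c : Fin d → ℝ) (W : Fin d → EuclideanSpace ℝ (Fin m)),
        ∑ l, (c l * ((Pi.single l ((n + 1 : ℕ) : ℤ) : Fin d → ℤ) j : ℝ)) • W l =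
          (c j * N) • W j := by
      intro c W
      rw [Finset.sum_eq_single j]
      · simp [N]
      · intro b _ hb; simp [hb.symm]
      · simp
    rw [grad_cosSum]
    simp only [β, ψ, V, Fintype.sum_sum_type, Sum.elim_inl, Sum.elim_inr, phase_single,
      hNc, Finset.univ_unique, Finset.sum_singleton, phase_zero_left, add_zero, Pi.zero_apply,
      Int.cast_zero, mul_zero, zero_smul, zero_add, ← add_sub_assoc, Real.sin_sub_pi_div_two,
      P, L, Pi.add_apply]
    have s1 := hsingle (fun l => - -Real.cos (N * x l + φ l)) (fun l => (1 / N) • p l)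
    have s2 := hsingle (fun l => -Real.sin (N * x l + φ l)) (fun l => -(1 / N) • q l)
    rw [s1, s2, smul_smul, smul_smul]
    congr 2
    · rw [neg_neg, mul_assoc, e1, mul_one]
    · rw [mul_neg, mul_assoc, e1, mul_one, neg_neg]
  have hz : y / N * N = y := by field_simp
  have habs : |N| = N := abs_of_pos hN
  have habs' : |1 / N| = 1 / N := abs_of_pos (by positivity)
  have := hb.norm_coeff_le β ψ V (z := y / N) (K₁ := sumAbs a + 1) (K₂ := S * Real.exp y)
    (KF := KF) (by positivity) ?_ ?_ hKF (((n + 1 : ℕ) : ℤ) • k) i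
  · rw [freqNorm_nsmul] at this
    have e2 : y / N * (((n + 1 : ℕ) : ℝ) * freqNorm k) = y * freqNorm k := by
      rw [show ((n + 1 : ℕ) : ℝ) = N by push_cast; rfl, ← mul_assoc, hz]
    rw [e2] at this
    simpa only [hu, hg, H] using this
  · simp only [β, V, Fintype.sum_sum_type, Sum.elim_inl, Sum.elim_inr, Finset.univ_unique,
      Finset.sum_singleton, freqNorm_zero, mul_zero, Real.exp_zero, mul_one, freqNorm_single, hNc,
      habs, hz, sumAbs_smul, abs_neg, habs']
    have : S * Real.exp y ≤ N := hn₀.trans (by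
      have : (n₀ : ℝ) ≤ n := by exact_mod_cast hn
      linarith)
    have e3 : ∑ x, 1 / N * sumAbs (p x) * Real.exp y + ∑ x, 1 / N * sumAbs (q x) * Real.exp y =
        1 / N * (S * Real.exp y) := by
      rw [hS, ← Finset.sum_add_distrib, Finset.sum_mul, Finset.mul_sum]
      exact Finset.sum_congr rfl fun j _ => by ring
    rw [e3]
    have : 1 / N * (S * Real.exp y) ≤ 1 := by
      rw [one_div, ← div_eq_inv_mul, div_le_one hN]; exact this
    linarith
  · simp only [β, V, Fintype.sum_sum_type, Sum.elim_inl, Sum.elim_inr, Finset.univ_unique,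
      Finset.sum_singleton, freqNorm_zero, zero_mul, mul_zero, freqNorm_single, hNc,
      habs, hz, sumAbs_smul, abs_neg, habs']
    rw [hS, zero_add, ← Finset.sum_add_distrib, Finset.sum_mul]
    refine le_of_eq (Finset.sum_congr rfl fun j _ => ?_)
    field_simp

/-- Integers satisfy `|k_j| ≤ k_j²`. On the diagonal `θ = (s, …, s)` the character of `k` has
frequency `∑ k_j`, so only the frequencies `-1, 0, 1` remain there. -/
theorem abs_sum_le_one {k : Fin d → ℤ} (hk : freqNorm k ≤ 1) : |∑ j, k j| ≤ 1 := by
  have h1 : ∑ j, (k j) ^ 2 ≤ 1 := by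
    rw [freqNorm, Real.sqrt_le_one] at hk
    exact_mod_cast hk
  calc |∑ j, k j| ≤ ∑ j, |k j| := Finset.abs_sum_le_sum_abs _ _
    _ ≤ ∑ j, (k j) ^ 2 := Finset.sum_le_sum fun j _ => by
        rw [← sq_abs]
        rcases (abs_nonneg (k j)).eq_or_lt with h | h
        · rw [← h]; simp
        · nlinarith
    _ ≤ 1 := h1

/-- `A(a, ·)` is a trigonometric polynomial of degree one on ellipses centred at the origin. -/
theorem gradient_circle_identity (hA : Continuous (Function.uncurry A))
    (hF : AnalyticOnNhd ℝ F (Set.Ici 0)) (hb : GeneratorBound A C₀ F)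
    (a : EuclideanSpace ℝ (Fin m)) (p q : Fin d → EuclideanSpace ℝ (Fin m)) (s : ℝ) :
    A a (Real.cos s • p + Real.sin s • q) =
      (1 / 2 : ℝ) • (A a p + A a (-p)) +
        Real.cos s • (A a p - (1 / 2 : ℝ) • (A a p + A a (-p))) +
        Real.sin s • (A a q - (1 / 2 : ℝ) • (A a p + A a (-p))) := by
  obtain ⟨D, S, hD, hS, hbound⟩ := norm_coeff_gradient_circle_le hA hF hb a p q
  ext i
  set G : (Fin d → ℝ) → ℂ := fun θ =>
    ((A a (fun j => Real.cos (θ j) • p j + Real.sin (θ j) • q j) i : ℝ) : ℂ)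
  have hzero : ∀ k, ¬ freqNorm k ≤ 1 → coeff G k = 0 := by
    intro k hk
    push Not at hk
    rw [← norm_le_zero_iff]
    -- Taking `y = n`, the growth `e^n` of the bound loses against `e^{-n|k|}` as soon as `|k| > 1`.
    have hle : ∀ n : ℕ, ‖coeff G k‖ ≤ Real.exp (-(n * (freqNorm k - 1))) * (D * (1 + S)) := by
      intro n
      refine (hbound n (by positivity) k i).trans ?_
      have : Real.exp (-(n * (freqNorm k - 1))) = Real.exp (-(n * freqNorm k)) * Real.exp n := by
        rw [← Real.exp_add]; ring_nf
      rw [this, mul_assoc]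
      refine mul_le_mul_of_nonneg_left ?_ (Real.exp_pos _).le
      have h1 : 1 ≤ Real.exp (n : ℝ) := Real.one_le_exp (by positivity)
      nlinarith
    have hlim : Filter.Tendsto (fun n : ℕ => Real.exp (-(n * (freqNorm k - 1))) * (D * (1 + S)))
        Filter.atTop (𝓝 (0 * (D * (1 + S)))) := by
      refine Filter.Tendsto.mul_const _ ?_
      refine Real.tendsto_exp_neg_atTop_nhds_zero.comp ?_
      exact tendsto_natCast_atTop_atTop.atTop_mul_const (by linarith)
    rw [zero_mul] at hlim
    exact ge_of_tendsto' hlim hle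
  have hper : BoxPeriodic G := by
    intro x j
    simp only [G, sin_add_single, cos_add_single]
  have hcont : Continuous G := by
    have h1 : Continuous fun θ : Fin d → ℝ =>
        (a, fun j => Real.cos (θ j) • p j + Real.sin (θ j) • q j) := by fun_prop
    have h2 := hA.comp h1
    have h3 : Continuous fun v : EuclideanSpace ℝ (Fin m) => ((v i : ℝ) : ℂ) := by fun_prop
    exact h3.comp h2
  have hsum : Summable fun k => ‖coeff G k‖ := by
    refine summable_of_ne_finset_zero (s := Fintype.piFinset fun _ => Finset.Icc (-1) 1) ?_
    intro k hk
    rw [hzero k, norm_zero]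
    contrapose! hk
    rw [Fintype.mem_piFinset]
    intro j
    have := (abs_le_freqNorm k j).trans hk
    rw [abs_le] at this
    rw [Finset.mem_Icc]
    exact ⟨by exact_mod_cast this.1, by exact_mod_cast this.2⟩
  have hG := fun s : ℝ => hasSum_coeff hper hcont hsum (fun _ => s)
  have hGs : ∀ s, G (fun _ => s) = ((A a (Real.cos s • p + Real.sin s • q) i : ℝ) : ℂ) :=
    fun s => rfl
  have hchar : ∀ (k : Fin d → ℤ) (s : ℝ), character k (fun _ => s) =
      Complex.exp (Complex.I * (((∑ j, k j : ℤ) : ℂ) * s)) := by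
    intro k s
    rw [character, phase, ← Finset.sum_mul]; push_cast; rfl
  -- A function `c₀ + c₁ cos s + c₂ sin s` has `c₀` as the mean of its values at `0` and `π`; then
  -- `c₁` and `c₂` are read off at `0` and `π/2`. Both sides are compared mode by mode.
  have hc := ((hG 0).add (hG Real.pi)).mul_left (1 / 2 : ℂ)
  have hrhs := (hc.add (((hG 0).sub hc).mul_left (Real.cos s : ℂ))).add
    (((hG (Real.pi / 2)).sub hc).mul_left (Real.sin s : ℂ))
  have heq := (hG s).unique (hrhs.congr_fun fun k => ?_)
  · simp only [hGs] at heq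
    have e0 : Real.cos 0 • p + Real.sin 0 • q = p := by simp
    have e1 : Real.cos Real.pi • p + Real.sin Real.pi • q = -p := by simp
    have e2 : Real.cos (Real.pi / 2) • p + Real.sin (Real.pi / 2) • q = q := by simp
    rw [e0, e1, e2] at heq
    simp only [PiLp.add_apply, PiLp.sub_apply, PiLp.smul_apply, smul_eq_mul]
    apply Complex.ofReal_injective
    rw [heq]
    push_cast
    ring
  · by_cases hk : freqNorm k ≤ 1
    · have h1 := abs_sum_le_one hk
      simp only [hchar]
      set κ : ℤ := ∑ j, k j
      have hI : Complex.exp (Complex.I * Real.pi) = -1 := by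
        rw [mul_comm, Complex.exp_pi_mul_I]
      have hI2 : Complex.exp (Complex.I * ((Real.pi / 2 : ℝ) : ℂ)) = Complex.I := by
        rw [mul_comm]; push_cast; rw [Complex.exp_pi_div_two_mul_I]
      have hIs : Complex.exp (Complex.I * (s : ℂ)) = Complex.cos s + Complex.sin s * Complex.I := by
        rw [mul_comm, Complex.exp_mul_I]
      rw [abs_le] at h1
      obtain h | h | h : κ = -1 ∨ κ = 0 ∨ κ = 1 := by omega
      · have neg : ∀ t : ℝ, Complex.exp (Complex.I * (((κ : ℤ) : ℂ) * t)) =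
            (Complex.exp (Complex.I * t))⁻¹ := by
          intro t; rw [h, ← Complex.exp_neg]; push_cast; ring_nf
        have hIs' : (Complex.exp (Complex.I * (s : ℂ)))⁻¹ =
            Complex.cos s - Complex.sin s * Complex.I := by
          rw [← Complex.exp_neg, show -(Complex.I * (s : ℂ)) = (-(s : ℂ)) * Complex.I by ring,
            Complex.exp_mul_I, Complex.cos_neg, Complex.sin_neg]; ring
        simp only [neg, hI, hI2, hIs']
        simp
        ring
      · simp [h]
        ring
      · simp only [h, Int.cast_one, one_mul, hI, hI2, hIs]
        simp
        ring
    · simp [hzero k hk]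

/-- `A(a, ·)` is affine. -/
theorem exists_affine (hA : Continuous (Function.uncurry A))
    (hF : AnalyticOnNhd ℝ F (Set.Ici 0)) (hb : GeneratorBound A C₀ F)
    (a : EuclideanSpace ℝ (Fin m)) :
    ∃ l : (Fin d → EuclideanSpace ℝ (Fin m)) →ₗ[ℝ] EuclideanSpace ℝ (Fin m),
      ∀ p, A a p = A a 0 + l p := by
  have id := gradient_circle_identity hA hF hb a
  set h : (Fin d → EuclideanSpace ℝ (Fin m)) → EuclideanSpace ℝ (Fin m) := fun p => A a p - A a 0
  -- The degenerate ellipse `p = 0` is the segment between `-q` and `q`, which gives homogeneity for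
  -- factors in `[-1, 1]`.
  have hsin : ∀ (s : ℝ) q, h (Real.sin s • q) = Real.sin s • h q := by
    intro s q
    have := id 0 q s
    simp only [smul_zero, zero_add, neg_zero] at this
    have e : (1 / 2 : ℝ) • (A a 0 + A a 0) = A a 0 := by
      rw [← two_smul ℝ, smul_smul]; norm_num
    simp only [h, this, e]
    module
  have hsmall : ∀ (c : ℝ) q, |c| ≤ 1 → h (c • q) = c • h q := by
    intro c q hc
    rw [abs_le] at hc
    have := hsin (Real.arcsin c) q
    rwa [Real.sin_arcsin hc.1 hc.2] at this
  have hsmul : ∀ (c : ℝ) q, h (c • q) = c • h q := by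
    intro c q
    by_cases hc : |c| ≤ 1
    · exact hsmall c q hc
    · push Not at hc
      have hc0 : c ≠ 0 := by rintro rfl; simp at hc; linarith
      -- A factor larger than one in absolute value is handled by applying the previous case to its
      -- inverse.
      have := hsmall c⁻¹ (c • q) (by rw [abs_inv]; exact inv_le_one_of_one_le₀ hc.le)
      rw [smul_smul, inv_mul_cancel₀ hc0, one_smul] at this
      rw [this, smul_smul, mul_inv_cancel₀ hc0, one_smul]
  have hadd : ∀ p q, h (p + q) = h p + h q := by
    intro p q
    -- The point `p + q` lies at the angle `π/4` on the ellipse with axes `√2 p` and `√2 q`.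
    have h1 := id (Real.sqrt 2 • p) (Real.sqrt 2 • q) (Real.pi / 4)
    have hr : Real.sqrt 2 / 2 * Real.sqrt 2 = 1 := by
      have := Real.mul_self_sqrt (show (0 : ℝ) ≤ 2 by norm_num)
      linarith
    have hneg : h (-(Real.sqrt 2 • p)) = -h (Real.sqrt 2 • p) := by
      have := hsmul (-1) (Real.sqrt 2 • p); simpa using this
    have hp : A a (Real.sqrt 2 • p) = A a 0 + Real.sqrt 2 • h p := by
      rw [← hsmul]; simp [h]
    have hq : A a (Real.sqrt 2 • q) = A a 0 + Real.sqrt 2 • h q := by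
      rw [← hsmul]; simp [h]
    have hm : A a (-(Real.sqrt 2 • p)) = A a 0 - Real.sqrt 2 • h p := by
      rw [← hsmul, sub_eq_add_neg, ← hneg]; simp [h]
    rw [Real.cos_pi_div_four, Real.sin_pi_div_four, smul_smul, smul_smul, hr, one_smul, one_smul,
      hp, hq, hm] at h1
    have h2 : h (p + q) = A a (p + q) - A a 0 := rfl
    have h3 : h p + h q = (Real.sqrt 2 / 2 * Real.sqrt 2) • (h p + h q) := by rw [hr, one_smul]
    rw [h2, h1, h3]
    module
  exact ⟨⟨⟨h, hadd⟩, hsmul⟩, fun p => by simp [h]⟩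

end Affine

end GenFun
end

/-! ### Chebyshev expansions of the coefficients of `A` -/

noncomputable section

namespace GenFun

open MeasureTheory Set Complex

variable {d m : ℕ}

theorem summable_prod_int {g : ℤ → ℝ} (hg : Summable g) (h0 : ∀ n, 0 ≤ g n) (m : ℕ) :
    Summable fun k : Fin m → ℤ => ∏ i, g (k i) := by
  induction m with
  | zero => exact Summable.of_finite
  | succ n ih =>
    let e : ℤ × (Fin n → ℤ) ≃ (Fin (n + 1) → ℤ) := Fin.consEquiv fun _ => ℤ
    have he : ∀ p, ∏ i, g (e p i) = g p.1 * ∏ i, g (p.2 i) := fun p => by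
      rw [Fin.prod_univ_succ]; rfl
    refine e.summable_iff.1 ?_
    exact (hg.mul_of_nonneg ih h0 fun k => Finset.prod_nonneg fun i _ => h0 _).congr fun p => (he p).symm

theorem summable_pow_natAbs {q : ℝ} (h0 : 0 ≤ q) (h1 : q < 1) :
    Summable fun n : ℤ => q ^ n.natAbs := by
  have h := summable_geometric_of_lt_one h0 h1
  refine Summable.of_nat_of_neg ?_ ?_
  · simpa using h
  · simpa using h

/-- The weight `∏ q^{|k_i|}` on `ℤ^m`. -/
def geomWeight (q : ℝ) (k : Fin m → ℤ) : ℝ := ∏ i, q ^ (k i).natAbs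

theorem summable_geomWeight {q : ℝ} (h0 : 0 ≤ q) (h1 : q < 1) :
    Summable fun k : Fin m → ℤ => geomWeight q k :=
  summable_prod_int (summable_pow_natAbs h0 h1) (fun _ => pow_nonneg h0 _) m

theorem geomWeight_nonneg {q : ℝ} (h0 : 0 ≤ q) (k : Fin m → ℤ) : 0 ≤ geomWeight q k :=
  Finset.prod_nonneg fun _ _ => pow_nonneg h0 _

theorem geomWeight_eq_exp {q : ℝ} (h0 : 0 < q) (k : Fin m → ℤ) :
    geomWeight q k = Real.exp (Real.log q * ∑ i, |(k i : ℝ)|) := by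
  rw [geomWeight, Finset.mul_sum, Real.exp_sum]
  refine Finset.prod_congr rfl fun i _ => ?_
  rw [← Int.cast_abs, Int.abs_eq_natAbs, Int.cast_natCast, mul_comm, Real.exp_nat_mul,
    Real.exp_log h0]

theorem character_mul_sign (k ε : Fin m → ℤ) (θ : Fin m → ℝ) :
    character k (fun i => ε i * θ i) =
      ∏ i, Complex.exp (Complex.I * ((k i : ℂ) * ((ε i : ℂ) * θ i))) := by
  rw [character, phase, ← Complex.exp_sum]
  congr 1
  push_cast
  rw [Finset.mul_sum]

/-- Fourier expansion of a function with prescribed parities in its variables. -/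
theorem hasSum_of_parity {h : (Fin m → ℝ) → ℂ} (hp : BoxPeriodic h) (hc : Continuous h)
    (hs : Summable fun k => ‖coeff h k‖) (χ : Fin m → ℤ → ℂ)
    (hχ : ∀ i, ∀ ε ∈ ({1, -1} : Finset ℤ), χ i ε * χ i ε = 1)
    (hpar : ∀ ε ∈ Fintype.piFinset fun _ : Fin m => ({1, -1} : Finset ℤ), ∀ θ,
      h (fun i => ε i * θ i) = (∏ i, χ i (ε i)) * h θ) (θ : Fin m → ℝ) :
    HasSum (fun k => coeff h k * ∏ i, (1 / 2 : ℂ) *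
      (χ i 1 * Complex.exp (Complex.I * ((k i : ℂ) * θ i)) +
        χ i (-1) * Complex.exp (-(Complex.I * ((k i : ℂ) * θ i))))) (h θ) := by
  set T := Fintype.piFinset fun _ : Fin m => ({1, -1} : Finset ℤ) with hT
  -- The inversion formula is averaged over the `2^m` sign changes of the variables, each weighted
  -- by its parity factor. The average factorises over the coordinates.
  have h1 := (hasSum_sum (s := T) fun ε _ =>
    (hasSum_coeff hp hc hs (fun i => ε i * θ i)).mul_left (∏ i, χ i (ε i))).mul_left
      ((1 / 2 : ℂ) ^ m)
  have hcard : T.card = 2 ^ m := by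
    rw [hT, Fintype.card_piFinset]; simp
  have hsum : (1 / 2 : ℂ) ^ m * ∑ ε ∈ T, (∏ i, χ i (ε i)) * h (fun i => ε i * θ i) = h θ := by
    have : ∀ ε ∈ T, (∏ i, χ i (ε i)) * h (fun i => ε i * θ i) = h θ := by
      intro ε hε
      rw [hpar ε hε, ← mul_assoc, ← Finset.prod_mul_distrib]
      rw [Finset.prod_eq_one, one_mul]
      intro i _
      exact hχ i _ (Fintype.mem_piFinset.1 hε i)
    rw [Finset.sum_congr rfl this, Finset.sum_const, hcard, nsmul_eq_mul, ← mul_assoc]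
    push_cast
    rw [← mul_pow]; norm_num
  rw [hsum] at h1
  refine h1.congr_fun fun k => ?_
  have h2 : ∀ i, (1 / 2 : ℂ) * (χ i 1 * Complex.exp (Complex.I * ((k i : ℂ) * θ i)) +
        χ i (-1) * Complex.exp (-(Complex.I * ((k i : ℂ) * θ i)))) =
      ∑ e ∈ ({1, -1} : Finset ℤ), (1 / 2 : ℂ) *
        (χ i e * Complex.exp (Complex.I * ((k i : ℂ) * ((e : ℂ) * θ i)))) := by
    intro i
    rw [Finset.sum_pair (by norm_num)]
    push_cast
    ring_nf
  simp only [h2]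
  rw [Finset.prod_univ_sum, Finset.mul_sum, Finset.mul_sum]
  refine Finset.sum_congr rfl fun ε _ => ?_
  rw [Finset.prod_mul_distrib, Finset.prod_mul_distrib, character_mul_sign, Finset.prod_const]
  simp
  ring

/-- The vector `(r cos θ_1, …, r cos θ_m)`. -/
def cosVec (r : ℝ) (θ : Fin m → ℝ) : EuclideanSpace ℝ (Fin m) :=
  WithLp.toLp 2 fun i => r * Real.cos (θ i)

theorem continuous_cosVec (r : ℝ) : Continuous (cosVec (m := m) r) := by
  unfold cosVec
  exact (PiLp.continuous_toLp 2 _).comp (by fun_prop)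

section Expansion

variable {A : EuclideanSpace ℝ (Fin m) → (Fin d → EuclideanSpace ℝ (Fin m)) →
      EuclideanSpace ℝ (Fin m)} {C₀ : ℝ} {F : ℝ → ℝ}

/-- The matrix entries of the linear part of `A(y, ·)`. -/
def slope (A : EuclideanSpace ℝ (Fin m) → (Fin d → EuclideanSpace ℝ (Fin m)) →
      EuclideanSpace ℝ (Fin m)) (j : Fin d) (i : Fin m) (y : EuclideanSpace ℝ (Fin m)) :
    EuclideanSpace ℝ (Fin m) :=
  A y (Pi.single j (EuclideanSpace.single i 1)) - A y 0

theorem eq_add_sum_slope (hA : Continuous (Function.uncurry A))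
    (hF : AnalyticOnNhd ℝ F (Set.Ici 0)) (hb : GeneratorBound A C₀ F)
    (y : EuclideanSpace ℝ (Fin m)) (p : Fin d → EuclideanSpace ℝ (Fin m)) :
    A y p = A y 0 + ∑ j, ∑ i, p j i • slope A j i y := by
  obtain ⟨l, hl⟩ := exists_affine hA hF hb y
  have hslope : ∀ j i, slope A j i y = l (Pi.single j (EuclideanSpace.single i 1)) := by
    intro j i; rw [slope, hl]; abel
  have hp : p = ∑ j, ∑ i, p j i • Pi.single (M := fun _ : Fin d => EuclideanSpace ℝ (Fin m)) j
      (EuclideanSpace.single i (1 : ℝ)) := by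
    have h1 : ∀ j, ∑ i, p j i • Pi.single (M := fun _ : Fin d => EuclideanSpace ℝ (Fin m)) j
        (EuclideanSpace.single i (1 : ℝ)) = Pi.single j (p j) := by
      intro j
      have h2 : p j = ∑ i, p j i • EuclideanSpace.single i (1 : ℝ) := by
        ext l; simp [Finset.sum_apply, Pi.single_apply]
      conv_rhs => rw [h2]
      ext1 j'
      by_cases h : j' = j
      · subst h; simp
      · simp [h]
    simp only [h1, Finset.univ_sum_single]
  rw [hl p]
  congr 1
  conv_lhs => rw [hp]
  simp only [map_sum, map_smul, hslope]

theorem continuous_at_zero_slope (hA : Continuous (Function.uncurry A)) :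
    (Continuous fun y => A y 0) ∧ ∀ j i, Continuous (slope A j i) := by
  have h : ∀ p, Continuous fun y => A y p := fun p => hA.comp (by fun_prop : Continuous fun y => (y, p))
  exact ⟨h 0, fun j i => (h _).sub (h 0)⟩

/-- The test function is `u_i = r cos(N_i x_j + φ_i)`, which depends on the single variable `x_j`.
By affineness `A(u, ∇u)` is then the displayed combination at `θ_i = N_i x_j + φ_i`, and the
frequency `k` in `θ` pulls back to `k·N` in `x_j`. One constant `K` serves for all `N` with entries
at most `2`, so different choices of `N` can be combined. -/
theorem norm_coeff_combination_le (hA : Continuous (Function.uncurry A))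
    (hF : AnalyticOnNhd ℝ F (Set.Ici 0)) (hb : GeneratorBound A C₀ F) {r z : ℝ} (hr : 0 < r)
    (hz : 0 ≤ z) (j : Fin d) (l : Fin m) :
    ∃ K, 0 ≤ K ∧ ∀ N : Fin m → ℤ, (∀ i, |N i| ≤ 2) → ∀ k : Fin m → ℤ,
      ‖coeff (fun θ => ((A (cosVec r θ) 0 l : ℝ) : ℂ)) k - ∑ i, ((r * N i : ℝ) : ℂ) *
        coeff (fun θ => ((Real.sin (θ i) * slope A j i (cosVec r θ) l : ℝ) : ℂ)) k‖ ≤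
      Real.exp (-(z * |∑ i, (k i : ℝ) * N i|)) * K := by
  -- `K₁` and `K₂` bound the generator function and its derivative for `m` cosines of amplitude `r`
  -- and frequency at most `2`.
  set K₁ : ℝ := m * (r * Real.exp (z * 2))
  set K₂ : ℝ := m * (r * (2 * Real.exp (z * 2)))
  have hK₂ : 0 ≤ K₂ := by positivity
  obtain ⟨KF, hKF0, hKF⟩ := exists_bound_of_analytic hF K₁
  refine ⟨|C₀| * KF * (1 + K₂), by positivity, fun N hN k => ?_⟩
  obtain ⟨hA0, hB⟩ := continuous_at_zero_slope hA
  have hcv := continuous_cosVec (m := m) r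
  let f : Fin m → (Fin m → ℝ) → ℂ := fun i θ =>
    ((Real.sin (θ i) * slope A j i (cosVec r θ) l : ℝ) : ℂ)
  have hap : ∀ l, Continuous fun v : EuclideanSpace ℝ (Fin m) => v l := fun l => by fun_prop
  have ha : Continuous fun θ : Fin m → ℝ => ((A (cosVec r θ) 0 l : ℝ) : ℂ) :=
    Complex.continuous_ofReal.comp ((hap l).comp (hA0.comp hcv))
  have hf : ∀ i, Continuous (f i) := by
    intro i
    have := (hap l).comp ((hB j i).comp hcv)
    exact Complex.continuous_ofReal.comp ((by fun_prop : Continuous fun θ : Fin m → ℝ =>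
      Real.sin (θ i)).mul this)
  let G : (Fin m → ℝ) → ℂ := fun θ =>
    ((A (cosVec r θ) 0 l : ℝ) : ℂ) - ∑ i, ((r * N i : ℝ) : ℂ) * f i θ
  have hGc : Continuous G := ha.sub (continuous_finsetSum _ fun i _ => (hf i).const_mul _)
  have hcoeff : coeff G k = coeff (fun θ => ((A (cosVec r θ) 0 l : ℝ) : ℂ)) k -
      ∑ i, ((r * N i : ℝ) : ℂ) * coeff (f i) k := by
    rw [coeff_sub ha (continuous_finsetSum _ fun i _ => (hf i).const_mul _),
      coeff_sum _ (fun i => (hf i).const_mul _)]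
    simp only [coeff_const_mul]
  rw [← hcoeff]
  have hGp : BoxPeriodic G := by
    intro x i
    simp only [G, f, cosVec, sin_add_single, cos_add_single]
  have habs : |∑ i, (k i : ℝ) * N i| =
      freqNorm (Pi.single j (∑ i, k i * N i) : Fin d → ℤ) := by
    rw [freqNorm_single]; push_cast; rfl
  rw [habs]
  refine norm_coeff_le_of_pullback (L := fun (x : Fin d → ℝ) i => N i * x j)
    (α := Pi.single j (∑ i, k i * N i)) hGp hGc
    (by fun_prop) ?_ ?_
  · intro x
    rw [phase_single, phase]
    push_cast
    rw [Finset.sum_mul]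
    exact Finset.sum_congr rfl fun i _ => by ring
  intro φ
  let β : Fin m → Fin d → ℤ := fun i => Pi.single j (N i)
  let V : Fin m → EuclideanSpace ℝ (Fin m) := fun i => EuclideanSpace.single i r
  have hV : ∀ i, sumAbs (V i) = r := by
    intro i
    simp only [sumAbs, V]
    rw [Finset.sum_eq_single i]
    · simp [abs_of_pos hr]
    · intro b _ hb; simp [hb]
    · simp
  have hu : ∀ x, cosSum β φ V x = cosVec r ((fun i => N i * x j) + φ) := by
    intro x
    ext i
    simp only [cosSum, β, V, phase_single, cosVec, Pi.add_apply]
    simp [Finset.sum_apply, Pi.single_apply, mul_comm]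
  have hg : ∀ x, ((A (cosSum β φ V x) (grad (cosSum β φ V) x) l : ℝ) : ℂ) =
      G ((fun i => N i * x j) + φ) := by
    intro x
    have e1 : ∀ j' i, grad (cosSum β φ V) x j' i = if j' = j then
        -(Real.sin (N i * x j + φ i)) * N i * r else 0 := by
      intro j' i
      rw [grad_cosSum]
      simp only [β, V, phase_single]
      split_ifs with h
      · subst h; simp [Finset.sum_apply, Pi.single_apply]
      · simp [h]
    rw [eq_add_sum_slope hA hF hb, hu, Finset.sum_eq_single j]
    · simp only [e1, if_true, G, f]
      simp only [PiLp.add_apply, WithLp.ofLp_sum, Finset.sum_apply, PiLp.smul_apply, smul_eq_mul,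
        Pi.add_apply]
      push_cast
      rw [sub_eq_add_neg, ← Finset.sum_neg_distrib]
      congr 1
      refine Finset.sum_congr rfl fun i _ => ?_
      ring
    · intro j' _ hj'
      simp [e1, hj']
    · simp
  have hN' : ∀ i, |(N i : ℝ)| ≤ 2 := fun i => by exact_mod_cast hN i
  have key := hb.norm_coeff_le β φ V (z := z) (K₁ := K₁) (K₂ := K₂) (KF := KF) hz ?_ ?_ hKF
    (Pi.single j (∑ i, k i * N i)) l
  · simpa only [hg] using key
  · have : ∀ i ∈ Finset.univ, sumAbs (V i) * Real.exp (z * freqNorm (β i)) ≤ r * Real.exp (z * 2) := by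
      intro i _
      rw [hV]
      simp only [β, freqNorm_single]
      gcongr
      exact hN' i
    refine (Finset.sum_le_card_nsmul _ _ _ this).trans (le_of_eq ?_)
    simp [K₁]
  · have : ∀ i ∈ Finset.univ, sumAbs (V i) * (freqNorm (β i) * Real.exp (z * freqNorm (β i))) ≤
        r * (2 * Real.exp (z * 2)) := by
      intro i _
      rw [hV]
      simp only [β, freqNorm_single]
      gcongr
      · exact hN' i
      · exact hN' i
    refine (Finset.sum_le_card_nsmul _ _ _ this).trans (le_of_eq ?_)
    simp [K₂]

/-- Superexponential decay of the Fourier coefficients of the composition of the coefficients of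
`A` with `θ ↦ (r cos θ_i)_i`. -/
theorem norm_coeff_entries_le (hA : Continuous (Function.uncurry A))
    (hF : AnalyticOnNhd ℝ F (Set.Ici 0)) (hb : GeneratorBound A C₀ F) {r z : ℝ} (hr : 0 < r)
    (hz : 0 ≤ z) (j : Fin d) (l : Fin m) :
    ∃ K, 0 ≤ K ∧ ∀ k : Fin m → ℤ,
      ‖coeff (fun θ => ((A (cosVec r θ) 0 l : ℝ) : ℂ)) k‖ ≤
        K * Real.exp (-(z * ∑ i, |(k i : ℝ)|)) ∧
      ∀ i, ‖coeff (fun θ => ((Real.sin (θ i) * slope A j i (cosVec r θ) l : ℝ) : ℂ)) k‖ ≤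
        K * Real.exp (-(z * ∑ i, |(k i : ℝ)|)) := by
  obtain ⟨K, hK0, hK⟩ := norm_coeff_combination_le hA hF hb hr hz j l
  refine ⟨K + 2 * K / r, by positivity, fun k => ?_⟩
  set a := coeff (fun θ => ((A (cosVec r θ) 0 l : ℝ) : ℂ)) k
  set f : Fin m → ℂ := fun i =>
    coeff (fun θ => ((Real.sin (θ i) * slope A j i (cosVec r θ) l : ℝ) : ℂ)) k with hf
  set W := Real.exp (-(z * ∑ i, |(k i : ℝ)|))
  have hW : 0 < W := Real.exp_pos _
  -- With `N = ±σ` the frequency `k·N` is `±∑|k_i|`. The sign at `k_i = 0` is `1`, not `0`, because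
  -- the factor `σ i` is divided out at the end.
  let σ : Fin m → ℤ := fun i => if 0 ≤ k i then 1 else -1
  have hσ : ∀ i, (k i : ℝ) * σ i = |(k i : ℝ)| := by
    intro i
    simp only [σ]
    split_ifs with h
    · have : (0 : ℝ) ≤ k i := by exact_mod_cast h
      simp [abs_of_nonneg this]
    · have : (k i : ℝ) < 0 := by exact_mod_cast not_le.1 h
      simp [abs_of_neg this]
  have hσ1 : ∀ i, |σ i| = 1 := by
    intro i; simp only [σ]; split_ifs <;> simp
  have hS0 : 0 ≤ ∑ i, |(k i : ℝ)| := Finset.sum_nonneg fun i _ => abs_nonneg _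
  have plus : ‖a - ∑ i, ((r * σ i : ℝ) : ℂ) * f i‖ ≤ W * K := by
    have := hK σ (fun i => by rw [hσ1]; norm_num) k
    simp only [hσ, abs_of_nonneg hS0] at this
    exact this
  have minus : ‖a + ∑ i, ((r * σ i : ℝ) : ℂ) * f i‖ ≤ W * K := by
    have := hK (-σ) (fun i => by rw [Pi.neg_apply, abs_neg, hσ1]; norm_num) k
    simp only [Pi.neg_apply, Int.cast_neg, mul_neg, hσ, Finset.sum_neg_distrib, abs_neg,
      abs_of_nonneg hS0, Complex.ofReal_neg, neg_mul, sub_neg_eq_add] at this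
    exact this
  have hle1 : W * K ≤ (K + 2 * K / r) * W := by
    have : 0 ≤ 2 * K / r * W := by positivity
    nlinarith
  constructor
  · refine le_trans ?_ hle1
    -- The slope terms are odd in `N`, so the mean over `σ` and `-σ` isolates the term without
    -- gradient.
    have e : a = (1 / 2 : ℂ) * ((a - ∑ i, ((r * σ i : ℝ) : ℂ) * f i) +
        (a + ∑ i, ((r * σ i : ℝ) : ℂ) * f i)) := by ring
    rw [e, norm_mul]
    have := norm_add_le (a - ∑ i, ((r * σ i : ℝ) : ℂ) * f i) (a + ∑ i, ((r * σ i : ℝ) : ℂ) * f i)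
    have h2 : ‖(1 / 2 : ℂ)‖ = 1 / 2 := by simp
    rw [h2]
    linarith
  · intro i
    -- Doubling the `i`-th entry only increases `k·N`, and the difference from the choice `σ`
    -- isolates the `i`-th slope term.
    let N : Fin m → ℤ := fun i' => if i' = i then 2 * σ i' else σ i'
    have hN : ∀ i', |N i'| ≤ 2 := by
      intro i'
      simp only [N]
      split_ifs
      · rw [abs_mul, hσ1]; norm_num
      · rw [hσ1]; norm_num
    have h2 := hK N hN k
    have hNk : ∑ i', (k i' : ℝ) * N i' = ∑ i', |(k i' : ℝ)| + |(k i : ℝ)| := by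
      have : ∀ i', (k i' : ℝ) * N i' = |(k i' : ℝ)| + if i' = i then |(k i' : ℝ)| else 0 := by
        intro i'
        simp only [N]
        split_ifs
        · push_cast; rw [← hσ]; ring
        · rw [hσ, add_zero]
      simp only [this, Finset.sum_add_distrib, Finset.sum_ite_eq', Finset.mem_univ, if_true]
    have hNs : ∑ i', ((r * N i' : ℝ) : ℂ) * f i' =
        ∑ i', ((r * σ i' : ℝ) : ℂ) * f i' + ((r * σ i : ℝ) : ℂ) * f i := by
      have : ∀ i', ((r * N i' : ℝ) : ℂ) * f i' = ((r * σ i' : ℝ) : ℂ) * f i' +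
          if i' = i then ((r * σ i' : ℝ) : ℂ) * f i' else 0 := by
        intro i'
        simp only [N]
        split_ifs
        · push_cast; ring
        · rw [add_zero]
      simp only [this, Finset.sum_add_distrib, Finset.sum_ite_eq', Finset.mem_univ, if_true]
    have h3 : ‖a - ∑ i', ((r * N i' : ℝ) : ℂ) * f i'‖ ≤ W * K := by
      refine h2.trans ?_
      gcongr
      refine Real.exp_le_exp.2 (neg_le_neg (mul_le_mul_of_nonneg_left ?_ hz))
      rw [hNk]
      exact (le_add_of_nonneg_right (abs_nonneg _)).trans (le_abs_self _)
    rw [hNs] at h3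
    have e : ((r * σ i : ℝ) : ℂ) * f i = (a - ∑ i, ((r * σ i : ℝ) : ℂ) * f i) -
        (a - (∑ i', ((r * σ i' : ℝ) : ℂ) * f i' + ((r * σ i : ℝ) : ℂ) * f i)) := by ring
    have h4 : ‖((r * σ i : ℝ) : ℂ) * f i‖ ≤ 2 * (W * K) := by
      rw [e]
      refine (norm_sub_le _ _).trans ?_
      linarith
    have hσr : |(σ i : ℝ)| = 1 := by exact_mod_cast hσ1 i
    rw [norm_mul, Complex.norm_real, Real.norm_eq_abs, abs_mul, hσr, mul_one, abs_of_pos hr] at h4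
    calc ‖f i‖ ≤ 2 * (W * K) / r := by rw [le_div_iff₀ hr]; linarith
      _ ≤ (K + 2 * K / r) * W := by
        have : (K + 2 * K / r) * W = K * W + 2 * (W * K) / r := by ring
        have : 0 ≤ K * W := by positivity
        linarith

/-- Expansion in products of Chebyshev polynomials with rapidly decaying coefficients. -/
def HasChebyshevExpansion (f : EuclideanSpace ℝ (Fin m) → ℝ) : Prop :=
  ∀ r : ℝ, 0 < r → ∃ (c : (Fin m → ℤ) → ℝ) (Q : Fin m → ℤ → Polynomial ℝ) (K : ℝ),
    (∀ i, Q i = Polynomial.Chebyshev.T ℝ ∨ Q i = fun n => Polynomial.Chebyshev.U ℝ (n - 1)) ∧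
    (∀ k, |c k| ≤ K * geomWeight (1 / 10) k) ∧
    ∀ y : EuclideanSpace ℝ (Fin m), (∀ i, |y i| < r) →
      HasSum (fun k => c k * ∏ i, (Q i (k i)).eval (y i / r)) (f y)

/-- The strict bound on `y` keeps every `sin (θ i)` away from zero, so that the odd factor can be
divided out in the expansion of the slopes. -/
theorem exists_cosVec {r : ℝ} (hr : 0 < r) {y : EuclideanSpace ℝ (Fin m)} (hy : ∀ i, |y i| < r) :
    ∃ θ : Fin m → ℝ, cosVec r θ = y ∧ (∀ i, Real.cos (θ i) = y i / r) ∧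
      ∀ i, Real.sin (θ i) ≠ 0 := by
  have h1 : ∀ i, -1 < y i / r ∧ y i / r < 1 := by
    intro i
    have := abs_lt.1 (hy i)
    constructor
    · rw [lt_div_iff₀ hr]; linarith
    · rw [div_lt_iff₀ hr]; linarith
  have hc : ∀ i, Real.cos (Real.arccos (y i / r)) = y i / r := fun i =>
    Real.cos_arccos (h1 i).1.le (h1 i).2.le
  refine ⟨fun i => Real.arccos (y i / r), ?_, hc, ?_⟩
  · ext i
    simp only [cosVec, hc]
    field_simp
  · intro i
    rw [Real.sin_arccos]
    have := h1 i
    exact (Real.sqrt_pos.2 (by nlinarith)).ne'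

theorem half_exp_add (k : ℤ) (t : ℝ) :
    (1 / 2 : ℂ) * ((1 : ℂ) * Complex.exp (Complex.I * ((k : ℂ) * t)) +
      (1 : ℂ) * Complex.exp (-(Complex.I * ((k : ℂ) * t)))) = ((Real.cos (k * t) : ℝ) : ℂ) := by
  push_cast
  rw [Complex.cos]
  ring_nf

theorem half_exp_sub (k : ℤ) (t : ℝ) :
    (1 / 2 : ℂ) * ((1 : ℂ) * Complex.exp (Complex.I * ((k : ℂ) * t)) +
      (-1 : ℂ) * Complex.exp (-(Complex.I * ((k : ℂ) * t)))) =
      Complex.I * ((Real.sin (k * t) : ℝ) : ℂ) := by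
  push_cast
  rw [Complex.sin]
  have := Complex.I_mul_I
  ring_nf
  simp only [Complex.I_sq]
  ring

theorem cosVec_sign {r : ℝ} {ε : Fin m → ℤ}
    (hε : ε ∈ Fintype.piFinset fun _ : Fin m => ({1, -1} : Finset ℤ)) (θ : Fin m → ℝ) :
    cosVec r (fun i => ε i * θ i) = cosVec r θ := by
  ext i
  simp only [cosVec]
  have := Fintype.mem_piFinset.1 hε i
  simp only [Finset.mem_insert, Finset.mem_singleton] at this
  rcases this with h | h <;> simp [h]

theorem boxPeriodic_cosVec (r : ℝ) : BoxPeriodic (cosVec (m := m) r) := by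
  intro x i
  simp only [cosVec, cos_add_single]

theorem exp_neg_log_ten (k : Fin m → ℤ) :
    Real.exp (-(Real.log 10 * ∑ i, |(k i : ℝ)|)) = geomWeight (1 / 10) k := by
  rw [geomWeight_eq_exp (by norm_num), one_div, Real.log_inv, neg_mul]

/-- The function `A (r cos θ) 0` is even in each `θ_i`, so only products of `cos (k_i θ_i) =
T_{k_i}(cos θ_i)` occur. -/
theorem hasChebyshevExpansion_zero (hd : 1 ≤ d) (hA : Continuous (Function.uncurry A))
    (hF : AnalyticOnNhd ℝ F (Set.Ici 0)) (hb : GeneratorBound A C₀ F) (l : Fin m) :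
    HasChebyshevExpansion fun y => A y 0 l := by
  intro r hr
  -- Any direction `j` would serve. The rate `log 10` gives the weight `10^{-∑|k_i|}`, which beats
  -- the growth `5^{∑|k_i|}` of the Chebyshev polynomials on majorized functions.
  obtain ⟨K, hK0, hK⟩ := norm_coeff_entries_le hA hF hb hr (Real.log_nonneg (by norm_num :
    (1 : ℝ) ≤ 10)) ⟨0, hd⟩ l
  simp only [exp_neg_log_ten] at hK
  set h : (Fin m → ℝ) → ℂ := fun θ => ((A (cosVec r θ) 0 l : ℝ) : ℂ)
  have hs : Summable fun k => ‖coeff h k‖ :=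
    Summable.of_nonneg_of_le (fun _ => norm_nonneg _) (fun k => (hK k).1)
      ((summable_geomWeight (by norm_num) (by norm_num)).mul_left K)
  have hper : BoxPeriodic h := fun x i => by simp only [h, boxPeriodic_cosVec r x i]
  have hcont : Continuous h :=
    Complex.continuous_ofReal.comp ((by fun_prop : Continuous fun v : EuclideanSpace ℝ (Fin m) =>
      v l).comp ((continuous_at_zero_slope hA).1.comp (continuous_cosVec r)))
  refine ⟨fun k => (coeff h k).re, fun _ => Polynomial.Chebyshev.T ℝ, K, fun _ => Or.inl rfl,
    fun k => (Complex.abs_re_le_norm _).trans (hK k).1, fun y hy => ?_⟩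
  obtain ⟨θ, rfl, hcos, -⟩ := exists_cosVec hr hy
  have := hasSum_of_parity hper hcont hs (fun _ _ => 1) (by simp)
    (fun ε hε θ => by simp [h, cosVec_sign hε]) θ
  have hre := Complex.hasSum_re this
  refine hre.congr_fun fun k => ?_
  simp only [half_exp_add]
  rw [← Complex.ofReal_prod, Complex.re_mul_ofReal]
  congr 1
  refine Finset.prod_congr rfl fun i _ => ?_
  rw [← hcos, Polynomial.Chebyshev.T_real_cos]

/-- The function `sin θ_i · slope(r cos θ)` is odd in `θ_i` and even in the other variables. In
`θ_i` this leaves `sin (k θ_i) = U_{k-1}(cos θ_i) sin θ_i`, and the factor `sin θ_i` cancels. -/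
theorem hasChebyshevExpansion_slope (hA : Continuous (Function.uncurry A))
    (hF : AnalyticOnNhd ℝ F (Set.Ici 0)) (hb : GeneratorBound A C₀ F) (j : Fin d) (i : Fin m)
    (l : Fin m) : HasChebyshevExpansion fun y => slope A j i y l := by
  intro r hr
  obtain ⟨K, hK0, hK⟩ := norm_coeff_entries_le hA hF hb hr (Real.log_nonneg (by norm_num :
    (1 : ℝ) ≤ 10)) j l
  simp only [exp_neg_log_ten] at hK
  set h : (Fin m → ℝ) → ℂ := fun θ =>
    ((Real.sin (θ i) * slope A j i (cosVec r θ) l : ℝ) : ℂ)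
  have hs : Summable fun k => ‖coeff h k‖ :=
    Summable.of_nonneg_of_le (fun _ => norm_nonneg _) (fun k => (hK k).2 i)
      ((summable_geomWeight (by norm_num) (by norm_num)).mul_left K)
  have hper : BoxPeriodic h := fun x i => by
    simp only [h, boxPeriodic_cosVec r x i, sin_add_single]
  have hcont : Continuous h :=
    Complex.continuous_ofReal.comp ((by fun_prop : Continuous fun θ : Fin m → ℝ =>
      Real.sin (θ i)).mul ((by fun_prop : Continuous fun v : EuclideanSpace ℝ (Fin m) =>
      v l).comp (((continuous_at_zero_slope hA).2 j i).comp (continuous_cosVec r))))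
  -- The odd half-sum of exponentials is `i sin (k θ)`; its factor `i` goes into the coefficient.
  refine ⟨fun k => (Complex.I * coeff h k).re, fun i' => if i' = i then
      fun n => Polynomial.Chebyshev.U ℝ (n - 1) else Polynomial.Chebyshev.T ℝ, K, fun i' => ?_,
    fun k => (Complex.abs_re_le_norm _).trans (by
      rw [norm_mul, Complex.norm_I, one_mul]; exact (hK k).2 i), fun y hy => ?_⟩
  · by_cases h : i' = i
    · exact Or.inr (if_pos h)
    · exact Or.inl (if_neg h)
  obtain ⟨θ, rfl, hcos, hsin⟩ := exists_cosVec hr hy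
  have := hasSum_of_parity hper hcont hs (fun i' ε => if i' = i then (ε : ℂ) else 1)
    (fun i' ε hε => by
      simp only [Finset.mem_insert, Finset.mem_singleton] at hε
      rcases hε with h | h <;> split_ifs <;> simp [h])
    (fun ε hε θ => by
      simp only [h, cosVec_sign hε, Finset.prod_ite_eq', Finset.mem_univ, if_true]
      have := Fintype.mem_piFinset.1 hε i
      simp only [Finset.mem_insert, Finset.mem_singleton] at this
      rcases this with h | h <;> simp [h]) θ
  have hre := (Complex.hasSum_re this).mul_left (Real.sin (θ i))⁻¹
  have hval : (Real.sin (θ i))⁻¹ * (h θ).re = slope A j i (cosVec r θ) l := by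
    simp only [h, Complex.ofReal_re]
    rw [← mul_assoc, inv_mul_cancel₀ (hsin i), one_mul]
  rw [hval] at hre
  refine hre.congr_fun fun k => ?_
  have hfac : ∀ i', (1 / 2 : ℂ) * ((if i' = i then ((1 : ℤ) : ℂ) else 1) *
      Complex.exp (Complex.I * ((k i' : ℂ) * θ i')) + (if i' = i then ((-1 : ℤ) : ℂ) else 1) *
      Complex.exp (-(Complex.I * ((k i' : ℂ) * θ i')))) =
      (if i' = i then Complex.I * ((Real.sin (θ i') : ℝ) : ℂ) else 1) *
      (((((if i' = i then fun n => Polynomial.Chebyshev.U ℝ (n - 1) else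
        Polynomial.Chebyshev.T ℝ) : ℤ → Polynomial ℝ) (k i')).eval (cosVec r θ i' / r) : ℝ) : ℂ) := by
    intro i'
    split_ifs with hi
    · have hU := Polynomial.Chebyshev.U_real_cos (θ i') (k i' - 1)
      push_cast at hU
      rw [sub_add_cancel] at hU
      rw [Int.cast_one, Int.cast_neg, Int.cast_one, half_exp_sub, ← hU, ← hcos]
      push_cast
      ring
    · rw [half_exp_add, ← hcos, Polynomial.Chebyshev.T_real_cos, one_mul]
  rw [Finset.prod_congr rfl fun i' _ => hfac i', Finset.prod_mul_distrib, Finset.prod_ite_eq',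
    if_pos (Finset.mem_univ i), ← Complex.ofReal_prod]
  have : coeff h k * (Complex.I * ((Real.sin (θ i) : ℝ) : ℂ) * ((∏ i',
      ((((if i' = i then fun n => Polynomial.Chebyshev.U ℝ (n - 1) else
        Polynomial.Chebyshev.T ℝ) : ℤ → Polynomial ℝ) (k i')).eval (cosVec r θ i' / r)) : ℝ) : ℂ)) =
      (Complex.I * coeff h k) * ((Real.sin (θ i) * ∏ i',
      ((((if i' = i then fun n => Polynomial.Chebyshev.U ℝ (n - 1) else
        Polynomial.Chebyshev.T ℝ) : ℤ → Polynomial ℝ) (k i')).eval (cosVec r θ i' / r)) : ℝ) : ℂ) := by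
    rw [Complex.ofReal_mul]
    ring
  rw [this, Complex.re_mul_ofReal]
  have hne := hsin i
  field_simp

end Expansion

end GenFun
end

/-! ### The mode norm with time-dependent radius -/

noncomputable section

namespace GenFun

open MeasureTheory Set Complex

variable {d m : ℕ}

/-- `h` is a sum of modes `b_i(t) e^{i ν_i·x}` with `e^{r(t)|ν_i|} |b_i(t)| ≤ μ_i` on the set `J` of
times. -/
structure IsModeExpansion {ι : Type} (J : Set ℝ) (r : ℝ → ℝ) (h : ℝ → (Fin d → ℝ) → ℝ)
    (ν : ι → Fin d → ℤ) (b : ι → ℝ → ℂ) (μ : ι → ℝ) : Prop where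
  cont : ∀ i, ContinuousOn (b i) J
  nonneg : ∀ i, 0 ≤ μ i
  bound : ∀ i, ∀ t ∈ J, Real.exp (r t * freqNorm (ν i)) * ‖b i t‖ ≤ μ i
  summable : Summable μ
  hasSum : ∀ t ∈ J, ∀ x, HasSum (fun i => b i t * character (ν i) x) ((h t x : ℝ) : ℂ)

/-- `h` has a mode expansion of total weight at most `M`. -/
def Majorized (J : Set ℝ) (r : ℝ → ℝ) (h : ℝ → (Fin d → ℝ) → ℝ) (M : ℝ) : Prop :=
  ∃ (ι : Type) (_ : Countable ι) (ν : ι → Fin d → ℤ) (b : ι → ℝ → ℂ) (μ : ι → ℝ),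
    IsModeExpansion J r h ν b μ ∧ ∑' i, μ i ≤ M

variable {J : Set ℝ} {r : ℝ → ℝ} {h g : ℝ → (Fin d → ℝ) → ℝ} {M M' : ℝ}

theorem IsModeExpansion.norm_le {ι : Type} {ν : ι → Fin d → ℤ} {b : ι → ℝ → ℂ} {μ : ι → ℝ}
    (H : IsModeExpansion J r h ν b μ) (hr : ∀ t ∈ J, 0 ≤ r t) (i : ι) {t : ℝ} (ht : t ∈ J) :
    ‖b i t‖ ≤ μ i := by
  refine le_trans ?_ (H.bound i t ht)
  refine le_mul_of_one_le_left (norm_nonneg _) (Real.one_le_exp ?_)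
  exact mul_nonneg (hr t ht) (freqNorm_nonneg _)

theorem Majorized.nonneg (H : Majorized J r h M) : 0 ≤ M := by
  obtain ⟨ι, _, ν, b, μ, H, hM⟩ := H
  exact (tsum_nonneg H.nonneg).trans hM

theorem Majorized.mono (H : Majorized J r h M) (hM : M ≤ M') : Majorized J r h M' := by
  obtain ⟨ι, hι, ν, b, μ, H, hM'⟩ := H
  exact ⟨ι, hι, ν, b, μ, H, hM'.trans hM⟩

theorem Majorized.congr (H : Majorized J r h M) (hg : ∀ t ∈ J, ∀ x, g t x = h t x) :
    Majorized J r g M := by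
  obtain ⟨ι, hι, ν, b, μ, H, hM'⟩ := H
  exact ⟨ι, hι, ν, b, μ, ⟨H.cont, H.nonneg, H.bound, H.summable,
    fun t ht x => by rw [hg t ht x]; exact H.hasSum t ht x⟩, hM'⟩

theorem Majorized.abs_le (H : Majorized J r h M) (hr : ∀ t ∈ J, 0 ≤ r t) {t : ℝ} (ht : t ∈ J)
    (x : Fin d → ℝ) : |h t x| ≤ M := by
  obtain ⟨ι, _, ν, b, μ, H, hM⟩ := H
  refine le_trans ?_ hM
  rw [← Real.norm_eq_abs, ← Complex.norm_real, ← (H.hasSum t ht x).tsum_eq]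
  refine tsum_of_norm_bounded H.summable.hasSum fun i => ?_
  rw [norm_mul, norm_character, mul_one]
  exact H.norm_le hr i ht

theorem majorized_const (J : Set ℝ) (r : ℝ → ℝ) (c : ℝ) :
    Majorized (d := d) J r (fun _ _ => c) |c| := by
  refine ⟨Unit, inferInstance, fun _ => 0, fun _ _ => (c : ℂ), fun _ => |c|,
    ⟨fun _ => continuousOn_const, fun _ => abs_nonneg _, fun _ t _ => by simp,
      Summable.of_finite, fun t _ x => by simp⟩, ?_⟩
  simp

theorem Majorized.const_mul (H : Majorized J r h M) (c : ℝ) :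
    Majorized J r (fun t x => c * h t x) (|c| * M) := by
  obtain ⟨ι, hι, ν, b, μ, H, hM⟩ := H
  refine ⟨ι, hι, ν, fun i t => (c : ℂ) * b i t, fun i => |c| * μ i,
    ⟨fun i => continuousOn_const.mul (H.cont i), fun i => mul_nonneg (abs_nonneg _) (H.nonneg i),
      fun i t ht => ?_, H.summable.mul_left _, fun t ht x => ?_⟩, ?_⟩
  · rw [norm_mul, Complex.norm_real, Real.norm_eq_abs, mul_left_comm]
    exact mul_le_mul_of_nonneg_left (H.bound i t ht) (abs_nonneg _)
  · simp only [mul_assoc]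
    rw [Complex.ofReal_mul]
    exact (H.hasSum t ht x).mul_left _
  · rw [tsum_mul_left]
    exact mul_le_mul_of_nonneg_left hM (abs_nonneg _)

/-- The modes of all terms are collected as they stand. Equal frequencies are never merged, which is
why expansions carry an arbitrary countable index type. -/
theorem Majorized.tsum {K : Type} [Countable K] {f : K → ℝ → (Fin d → ℝ) → ℝ} {M : K → ℝ}
    (hr : ∀ t ∈ J, 0 ≤ r t) (H : ∀ k, Majorized J r (f k) (M k)) (hM : Summable M)
    (hh : ∀ t ∈ J, ∀ x, HasSum (fun k => f k t x) (h t x)) : Majorized J r h (∑' k, M k) := by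
  choose ι hι ν b μ H hμ using H
  have hs : Summable fun p : Σ k, ι k => μ p.1 p.2 := by
    rw [summable_sigma_of_nonneg fun p => (H p.1).nonneg p.2]
    exact ⟨fun k => (H k).summable, Summable.of_nonneg_of_le
      (fun k => tsum_nonneg (H k).nonneg) hμ hM⟩
  refine ⟨Σ k, ι k, inferInstance, fun p => ν p.1 p.2, fun p => b p.1 p.2, fun p => μ p.1 p.2,
    ⟨fun p => (H p.1).cont p.2, fun p => (H p.1).nonneg p.2, fun p => (H p.1).bound p.2, hs,
      fun t ht x => ?_⟩, ?_⟩
  · refine HasSum.sigma_of_hasSum (Complex.hasSum_ofReal.2 (hh t ht x))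
      (fun k => (H k).hasSum t ht x) (Summable.of_norm_bounded hs fun p => ?_)
    rw [norm_mul, norm_character, mul_one]
    exact (H p.1).norm_le hr p.2 ht
  · rw [hs.tsum_sigma' fun k => (H k).summable]
    exact Summable.tsum_le_tsum hμ (Summable.of_nonneg_of_le
      (fun k => tsum_nonneg (H k).nonneg) hμ hM) hM

theorem Majorized.sum {K : Type} [Fintype K] {f : K → ℝ → (Fin d → ℝ) → ℝ} {M : K → ℝ}
    (hr : ∀ t ∈ J, 0 ≤ r t) (H : ∀ k, Majorized J r (f k) (M k)) :
    Majorized J r (fun t x => ∑ k, f k t x) (∑ k, M k) := by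
  rw [← tsum_fintype (L := SummationFilter.unconditional K)]
  exact Majorized.tsum hr H Summable.of_finite fun t _ x => hasSum_fintype _

theorem Majorized.add (hr : ∀ t ∈ J, 0 ≤ r t) (H : Majorized J r h M) (H' : Majorized J r g M') :
    Majorized J r (fun t x => h t x + g t x) (M + M') := by
  have := Majorized.sum (K := Bool) (f := fun k => if k then h else g)
    (M := fun k => if k then M else M') hr (fun k => by cases k <;> simpa)
  simpa using this

theorem Majorized.sub (hr : ∀ t ∈ J, 0 ≤ r t) (H : Majorized J r h M) (H' : Majorized J r g M') :
    Majorized J r (fun t x => h t x - g t x) (M + M') := by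
  have := H.add hr (H'.const_mul (-1))
  simpa [sub_eq_add_neg] using this

/-- Frequencies add, and `e^{r|ν|}` with `r ≥ 0` is submultiplicative by the triangle inequality for
`freqNorm`: the norm is that of a weighted Wiener algebra. -/
theorem Majorized.mul (hr : ∀ t ∈ J, 0 ≤ r t) (H : Majorized J r h M) (H' : Majorized J r g M') :
    Majorized J r (fun t x => h t x * g t x) (M * M') := by
  have hM0 := H.nonneg
  obtain ⟨ι, hι, ν, b, μ, H, hM⟩ := H
  obtain ⟨ι', hι', ν', b', μ', H', hM'⟩ := H'
  have hs : Summable fun p : ι × ι' => μ p.1 * μ' p.2 :=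
    H.summable.mul_of_nonneg H'.summable H.nonneg H'.nonneg
  refine ⟨ι × ι', inferInstance, fun p => ν p.1 + ν' p.2, fun p t => b p.1 t * b' p.2 t,
    fun p => μ p.1 * μ' p.2, ⟨fun p => (H.cont p.1).mul (H'.cont p.2),
    fun p => mul_nonneg (H.nonneg _) (H'.nonneg _), fun p t ht => ?_, hs, fun t ht x => ?_⟩, ?_⟩
  · calc Real.exp (r t * freqNorm (ν p.1 + ν' p.2)) * ‖b p.1 t * b' p.2 t‖
        ≤ Real.exp (r t * (freqNorm (ν p.1) + freqNorm (ν' p.2))) * ‖b p.1 t * b' p.2 t‖ := by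
          gcongr
          · exact hr t ht
          · exact freqNorm_add_le _ _
      _ = (Real.exp (r t * freqNorm (ν p.1)) * ‖b p.1 t‖) *
          (Real.exp (r t * freqNorm (ν' p.2)) * ‖b' p.2 t‖) := by
          rw [mul_add, Real.exp_add, norm_mul]; ring
      _ ≤ _ := mul_le_mul (H.bound _ t ht) (H'.bound _ t ht) (by positivity) (H.nonneg _)
  · have := (H.hasSum t ht x).mul (H'.hasSum t ht x) (Summable.of_norm_bounded hs fun p => by
      rw [norm_mul, norm_mul, norm_mul, norm_character, norm_character, mul_one, mul_one]
      exact mul_le_mul (H.norm_le hr _ ht) (H'.norm_le hr _ ht) (norm_nonneg _) (H.nonneg _))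
    rw [Complex.ofReal_mul]
    refine this.congr_fun fun p => ?_
    rw [character_add_left]; ring
  · rw [← H.summable.tsum_mul_tsum H'.summable hs]
    exact mul_le_mul hM hM' (tsum_nonneg H'.nonneg) hM0

/-! ### Composition with Chebyshev series -/

/-- Componentwise majorization of vector-valued functions. -/
def VMajorized (J : Set ℝ) (r : ℝ → ℝ) (u : ℝ → (Fin d → ℝ) → EuclideanSpace ℝ (Fin m))
    (M : ℝ) : Prop := ∀ i, Majorized J r (fun t x => u t x i) M

/-- Composition with `f` is bounded by `M` and `L`-Lipschitz on functions majorized by `s`. -/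
structure LiftBound (d : ℕ) (f : EuclideanSpace ℝ (Fin m) → ℝ) (s M L : ℝ) : Prop where
  nonneg : 0 ≤ M
  nonneg' : 0 ≤ L
  bound : ∀ (J : Set ℝ) (r : ℝ → ℝ), (∀ t ∈ J, 0 ≤ r t) →
    ∀ u : ℝ → (Fin d → ℝ) → EuclideanSpace ℝ (Fin m), VMajorized J r u s →
      Majorized J r (fun t x => f (u t x)) M
  lipschitz : ∀ (J : Set ℝ) (r : ℝ → ℝ), (∀ t ∈ J, 0 ≤ r t) →
    ∀ (u v : ℝ → (Fin d → ℝ) → EuclideanSpace ℝ (Fin m)) (δ : ℝ), 0 ≤ δ →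
      VMajorized J r u s → VMajorized J r v s → VMajorized J r (fun t x => u t x - v t x) δ →
        Majorized J r (fun t x => f (u t x) - f (v t x)) (L * δ)

section Lift

variable {f f' : EuclideanSpace ℝ (Fin m) → ℝ} {s L L' : ℝ}

theorem LiftBound.mono (H : LiftBound d f s M L) (hM : M ≤ M') (hL : L ≤ L') :
    LiftBound d f s M' L' :=
  ⟨H.nonneg.trans hM, H.nonneg'.trans hL, fun J r hr u hu => (H.bound J r hr u hu).mono hM,
    fun J r hr u v δ hδ hu hv huv => (H.lipschitz J r hr u v δ hδ hu hv huv).mono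
      (mul_le_mul_of_nonneg_right hL hδ)⟩

theorem liftBound_const (s c : ℝ) :
    LiftBound d (fun _ : EuclideanSpace ℝ (Fin m) => c) s |c| 0 :=
  ⟨abs_nonneg _, le_rfl, fun J r _ _ _ => majorized_const J r c, fun J r _ _ _ _ _ _ _ _ => by
    simpa using majorized_const (d := d) J r 0⟩

theorem liftBound_coord (hs : 0 ≤ s) (i : Fin m) :
    LiftBound d (fun y : EuclideanSpace ℝ (Fin m) => y i) s s 1 :=
  ⟨hs, zero_le_one, fun _ _ _ _ hu => hu i, fun _ _ _ _ _ _ _ _ _ huv => by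
    rw [one_mul]; exact huv i⟩

/-- The Lipschitz constant comes from `f(u) (f'(u) - f'(v)) + (f(u) - f(v)) f'(v)`. -/
theorem LiftBound.mul (H : LiftBound d f s M L) (H' : LiftBound d f' s M' L') :
    LiftBound d (fun y => f y * f' y) s (M * M') (M * L' + L * M') := by
  refine ⟨mul_nonneg H.nonneg H'.nonneg, add_nonneg (mul_nonneg H.nonneg H'.nonneg')
    (mul_nonneg H.nonneg' H'.nonneg), fun J r hr u hu =>
    (H.bound J r hr u hu).mul hr (H'.bound J r hr u hu), fun J r hr u v δ hδ hu hv huv => ?_⟩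
  have h1 := (H.bound J r hr u hu).mul hr (H'.lipschitz J r hr u v δ hδ hu hv huv)
  have h2 := (H.lipschitz J r hr u v δ hδ hu hv huv).mul hr (H'.bound J r hr v hv)
  exact ((h1.add hr h2).mono (by ring_nf; rfl)).congr fun t _ x => by ring

theorem LiftBound.const_mul (H : LiftBound d f s M L) (c : ℝ) :
    LiftBound d (fun y => c * f y) s (|c| * M) (|c| * L) :=
  ((liftBound_const s c).mul H).mono le_rfl (by simp)

theorem LiftBound.tsum {K : Type} [Countable K] {f : K → EuclideanSpace ℝ (Fin m) → ℝ}
    {M L : K → ℝ} {F : EuclideanSpace ℝ (Fin m) → ℝ} (H : ∀ k, LiftBound d (f k) s (M k) (L k))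
    (hM : Summable M) (hL : Summable L)
    (hF : ∀ y, (∀ i, |y i| ≤ s) → HasSum (fun k => f k y) (F y)) :
    LiftBound d F s (∑' k, M k) (∑' k, L k) := by
  refine ⟨tsum_nonneg fun k => (H k).nonneg, tsum_nonneg fun k => (H k).nonneg',
    fun J r hr u hu => ?_, fun J r hr u v δ hδ hu hv huv => ?_⟩
  · exact Majorized.tsum hr (fun k => (H k).bound J r hr u hu) hM
      fun t ht x => hF _ fun i => (hu i).abs_le hr ht x
  · rw [← tsum_mul_right]
    exact Majorized.tsum hr (fun k => (H k).lipschitz J r hr u v δ hδ hu hv huv) (hL.mul_right δ)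
      fun t ht x => (hF _ fun i => (hu i).abs_le hr ht x).sub (hF _ fun i => (hv i).abs_le hr ht x)

theorem LiftBound.sub (H : LiftBound d f s M L) (H' : LiftBound d f' s M' L') :
    LiftBound d (fun y => f y - f' y) s (M + M') (L + L') := by
  refine ⟨add_nonneg H.nonneg H'.nonneg, add_nonneg H.nonneg' H'.nonneg',
    fun J r hr u hu => (H.bound J r hr u hu).sub hr (H'.bound J r hr u hu),
    fun J r hr u v δ hδ hu hv huv => ?_⟩
  exact (((H.lipschitz J r hr u v δ hδ hu hv huv).sub hr
    (H'.lipschitz J r hr u v δ hδ hu hv huv)).mono (by rw [add_mul])).congr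
      fun t _ x => by ring

theorem LiftBound.prod {S : Finset (Fin m)} {f : Fin m → EuclideanSpace ℝ (Fin m) → ℝ}
    {a : Fin m → ℝ} (H : ∀ i, LiftBound d (f i) s (a i) (a i)) :
    LiftBound d (fun y => ∏ i ∈ S, f i y) s (∏ i ∈ S, a i) (S.card * ∏ i ∈ S, a i) := by
  induction S using Finset.induction_on with
  | empty => simpa using liftBound_const (d := d) (m := m) s 1
  | insert i S hi ih =>
    simp only [Finset.prod_insert hi, Finset.card_insert_of_notMem hi]
    refine ((H i).mul ih).mono le_rfl (le_of_eq ?_)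
    push_cast; ring

/-- Dividing by `s + 1` makes the variable of norm at most one. The recurrence then gives `2·5^{n+1}
+ 5^n` for the size and `4·5^{n+1} + 5^n` for the Lipschitz constant, both below `5^{n+2}`. The base
`5` is crude, but it covers both kinds of Chebyshev polynomials. -/
theorem liftBound_recurrence {P : ℕ → Polynomial ℝ}
    (hP : ∀ n, P (n + 2) = 2 * Polynomial.X * P (n + 1) - P n)
    (h0 : P 0 = 1) (h1 : P 1 = Polynomial.X ∨ P 1 = 2 * Polynomial.X) (hs : 0 ≤ s) (i : Fin m)
    (n : ℕ) : LiftBound d (fun y : EuclideanSpace ℝ (Fin m) => (P n).eval (y i / (s + 1))) s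
      (5 ^ n) (5 ^ n) := by
  have hs1 : 0 < s + 1 := by linarith
  have hX : LiftBound d (fun y : EuclideanSpace ℝ (Fin m) => y i / (s + 1)) s 1 1 := by
    have := (liftBound_coord (d := d) hs i).const_mul (s + 1)⁻¹
    simp only [← div_eq_inv_mul] at this
    refine this.mono ?_ ?_
    · rw [abs_of_pos (inv_pos.2 hs1), ← div_eq_inv_mul, div_le_one hs1]; linarith
    · rw [abs_of_pos (inv_pos.2 hs1), mul_one]; exact inv_le_one_of_one_le₀ (by linarith)
  have h2X : LiftBound d (fun y : EuclideanSpace ℝ (Fin m) => 2 * (y i / (s + 1))) s 2 2 :=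
    (hX.const_mul 2).mono (by norm_num) (by norm_num)
  induction n using Nat.twoStepInduction with
  | zero =>
    simp only [h0, Polynomial.eval_one, pow_zero]
    exact (liftBound_const s 1).mono (by norm_num) (by norm_num)
  | one =>
    rcases h1 with h1 | h1
    · simp only [h1, Polynomial.eval_X, pow_one]
      exact hX.mono (by norm_num) (by norm_num)
    · simp only [h1, Polynomial.eval_mul, Polynomial.eval_ofNat, Polynomial.eval_X, pow_one]
      exact h2X.mono (by norm_num) (by norm_num)
  | more n ih0 ih1 =>
    simp only [hP, Polynomial.eval_sub, Polynomial.eval_mul, Polynomial.eval_ofNat,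
      Polynomial.eval_X]
    refine ((h2X.mul ih1).sub ih0).mono ?_ ?_
    · rw [pow_succ, pow_succ, pow_succ]
      have : (0 : ℝ) < 5 ^ n := by positivity
      linarith
    · rw [pow_succ, pow_succ, pow_succ]
      have : (0 : ℝ) < 5 ^ n := by positivity
      linarith

theorem liftBound_T (hs : 0 ≤ s) (i : Fin m) (k : ℤ) :
    LiftBound d (fun y : EuclideanSpace ℝ (Fin m) =>
      (Polynomial.Chebyshev.T ℝ k).eval (y i / (s + 1))) s (5 ^ k.natAbs) (5 ^ k.natAbs) := by
  have h := liftBound_recurrence (d := d) (P := fun n : ℕ => Polynomial.Chebyshev.T ℝ n)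
    (fun n => by push_cast; exact Polynomial.Chebyshev.T_add_two ℝ n)
    (Polynomial.Chebyshev.T_zero ℝ) (Or.inl (Polynomial.Chebyshev.T_one ℝ)) hs i k.natAbs
  have e : Polynomial.Chebyshev.T ℝ (k.natAbs : ℤ) = Polynomial.Chebyshev.T ℝ k :=
    Polynomial.Chebyshev.T_natAbs ℝ k
  simpa only [e] using h

/-- The index shift is harmless: `k = 0` gives `U_{-1} = 0`, and `U_{-n-2} = -U_n` reduces negative
`k` to positive ones. -/
theorem liftBound_U (hs : 0 ≤ s) (i : Fin m) (k : ℤ) :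
    LiftBound d (fun y : EuclideanSpace ℝ (Fin m) =>
      (Polynomial.Chebyshev.U ℝ (k - 1)).eval (y i / (s + 1))) s (5 ^ k.natAbs)
        (5 ^ k.natAbs) := by
  have h := liftBound_recurrence (d := d) (P := fun n : ℕ => Polynomial.Chebyshev.U ℝ n)
    (fun n => by push_cast; exact Polynomial.Chebyshev.U_add_two ℝ n)
    (Polynomial.Chebyshev.U_zero ℝ) (Or.inr (Polynomial.Chebyshev.U_one ℝ)) hs i
  have hpow : ∀ n : ℕ, (5 : ℝ) ^ n ≤ 5 ^ (n + 1) := fun n =>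
    pow_le_pow_right₀ (by norm_num) (Nat.le_succ n)
  obtain ⟨n, rfl | rfl⟩ := k.eq_nat_or_neg
  · cases n with
    | zero =>
      simp only [Nat.cast_zero, zero_sub, Polynomial.Chebyshev.U_neg_one, Polynomial.eval_zero]
      exact (liftBound_const s 0).mono (by simp) (by positivity)
    | succ n =>
      have := (h n).mono (hpow n) (hpow n)
      have e : ((n + 1 : ℕ) : ℤ) - 1 = n := by push_cast; ring
      rwa [e, Int.natAbs_natCast]
  · cases n with
    | zero =>
      simp only [Nat.cast_zero, neg_zero, zero_sub, Polynomial.Chebyshev.U_neg_one,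
        Polynomial.eval_zero]
      exact (liftBound_const s 0).mono (by simp) (by positivity)
    | succ n =>
      have := ((h n).const_mul (-1)).mono (M' := 5 ^ (n + 1)) (L' := 5 ^ (n + 1))
        (by simpa using hpow n) (by simpa using hpow n)
      have e : Polynomial.Chebyshev.U ℝ (-((n + 1 : ℕ) : ℤ) - 1) =
          -Polynomial.Chebyshev.U ℝ (n : ℤ) := by
        rw [← Polynomial.Chebyshev.U_neg_sub_two]; congr 1; push_cast; ring
      simp only [e, Polynomial.eval_neg, Int.natAbs_neg, Int.natAbs_natCast]
      simpa only [neg_one_mul] using this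

/-- Functions with a Chebyshev expansion act on majorized functions. -/
theorem HasChebyshevExpansion.exists_liftBound (H : HasChebyshevExpansion f) (hs : 0 ≤ s) :
    ∃ M L, LiftBound d f s M L := by
  -- The expansion is taken on the larger cube of radius `s + 1`, because it holds only strictly
  -- inside its cube.
  obtain ⟨c, Q, K, hQ, hc, hsum⟩ := H (s + 1) (by linarith)
  have h1 : ∀ i k, LiftBound d (fun y : EuclideanSpace ℝ (Fin m) =>
      (Q i k).eval (y i / (s + 1))) s (5 ^ k.natAbs) (5 ^ k.natAbs) := by
    intro i k
    rcases hQ i with h | h <;> rw [h]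
    · exact liftBound_T hs i k
    · exact liftBound_U hs i k
  -- Coefficients of order `10^{-∑|k_i|}` against growth `5^{∑|k_i|}` leave the summable weight
  -- `2^{-∑|k_i|}`.
  have h2 : ∀ k : Fin m → ℤ, LiftBound d (fun y => c k * ∏ i, (Q i (k i)).eval (y i / (s + 1))) s
      (K * geomWeight (1 / 2) k) (m * (K * geomWeight (1 / 2) k)) := by
    intro k
    have h3 := (LiftBound.prod (S := Finset.univ) (fun i => h1 i (k i))).const_mul (c k)
    have h5 : (∏ i, (5 : ℝ) ^ (k i).natAbs) = geomWeight 5 k := rfl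
    have h4 : |c k| * ∏ i, (5 : ℝ) ^ (k i).natAbs ≤ K * geomWeight (1 / 2) k := by
      rw [h5]
      refine (mul_le_mul_of_nonneg_right (hc k) (geomWeight_nonneg (by norm_num) k)).trans
        (le_of_eq ?_)
      rw [mul_assoc, geomWeight, geomWeight, geomWeight, ← Finset.prod_mul_distrib]
      simp only [← mul_pow]
      norm_num
    refine h3.mono h4 ?_
    rw [Finset.card_univ, Fintype.card_fin, mul_left_comm]
    exact mul_le_mul_of_nonneg_left h4 (by positivity)
  have hw := (summable_geomWeight (m := m) (q := 1 / 2) (by norm_num) (by norm_num)).mul_left K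
  exact ⟨_, _, LiftBound.tsum h2 hw (hw.mul_left _) fun y hy =>
    hsum y fun i => (hy i).trans_lt (by linarith)⟩

end Lift

end GenFun
end

/-! ### Differentiation, time integration and the regained derivative -/

noncomputable section

namespace GenFun

open MeasureTheory Set Complex

variable {d m : ℕ}

/-- The partial derivative `∂_j` of a real function. -/
def partialDeriv (j : Fin d) (h : (Fin d → ℝ) → ℝ) (x : Fin d → ℝ) : ℝ :=
  fderiv ℝ h x (Pi.single j 1)

/-- The linear phase as a continuous linear map. -/
def phaseCLM (α : Fin d → ℤ) : (Fin d → ℝ) →L[ℝ] ℝ :=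
  ∑ j, (α j : ℝ) • ContinuousLinearMap.proj (R := ℝ) (φ := fun _ : Fin d => ℝ) j

theorem phaseCLM_apply (α : Fin d → ℤ) (x : Fin d → ℝ) : phaseCLM α x = phase α x := by
  simp [phaseCLM, phase]

theorem norm_phaseCLM_le (α : Fin d → ℤ) : ‖phaseCLM α‖ ≤ d * freqNorm α := by
  refine ContinuousLinearMap.opNorm_le_bound _
    (mul_nonneg (Nat.cast_nonneg _) (freqNorm_nonneg _)) fun x => ?_
  rw [phaseCLM_apply, phase]
  refine (norm_sum_le _ _).trans ?_
  have : ∀ j ∈ Finset.univ, ‖(α j : ℝ) * x j‖ ≤ freqNorm α * ‖x‖ := by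
    intro j _
    rw [norm_mul]
    exact mul_le_mul (abs_le_freqNorm α j) (norm_le_pi_norm x j) (norm_nonneg _)
      (freqNorm_nonneg _)
  refine (Finset.sum_le_card_nsmul _ _ _ this).trans (le_of_eq ?_)
  simp [mul_assoc]

theorem hasFDerivAt_character (α : Fin d → ℤ) (c : ℂ) (x : Fin d → ℝ) :
    HasFDerivAt (fun x => c * character α x)
      ((c * character α x * Complex.I) • (Complex.ofRealCLM.comp (phaseCLM α))) x := by
  have h1 : HasFDerivAt (fun x => ((phase α x : ℝ) : ℂ)) (Complex.ofRealCLM.comp (phaseCLM α)) x := by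
    have := (Complex.ofRealCLM.comp (phaseCLM α)).hasFDerivAt (x := x)
    refine this.congr_of_eventuallyEq (Filter.Eventually.of_forall fun y => ?_)
    simp [phaseCLM_apply]
  have h2 := ((h1.const_mul Complex.I).cexp).const_mul c
  refine h2.congr_fderiv ?_
  rw [smul_smul, smul_smul, character]

/-- Termwise differentiation of a sum of modes. -/
theorem hasSum_partialDeriv {ι : Type} {ν : ι → Fin d → ℤ} {b : ι → ℂ} {h : (Fin d → ℝ) → ℝ}
    (hb : Summable fun i => freqNorm (ν i) * ‖b i‖)
    (hh : ∀ x, HasSum (fun i => b i * character (ν i) x) ((h x : ℝ) : ℂ)) (x : Fin d → ℝ) :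
    DifferentiableAt ℝ h x ∧ ∀ j, HasSum (fun i => b i * (Complex.I * ν i j) * character (ν i) x)
      ((partialDeriv j h x : ℝ) : ℂ) := by
  set f' : ι → (Fin d → ℝ) → (Fin d → ℝ) →L[ℝ] ℂ := fun i x =>
    (b i * character (ν i) x * Complex.I) • (Complex.ofRealCLM.comp (phaseCLM (ν i)))
  have hbound : ∀ i x, ‖f' i x‖ ≤ d * (freqNorm (ν i) * ‖b i‖) := by
    intro i x
    have h2 : ‖Complex.ofRealCLM.comp (phaseCLM (ν i))‖ ≤ d * freqNorm (ν i) := by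
      refine (ContinuousLinearMap.opNorm_comp_le _ _).trans ?_
      rw [Complex.ofRealCLM_norm, one_mul]
      exact norm_phaseCLM_le _
    simp only [f']
    rw [norm_smul, norm_mul, norm_mul, norm_character, Complex.norm_I, mul_one, mul_one]
    calc ‖b i‖ * _ ≤ ‖b i‖ * (d * freqNorm (ν i)) := by gcongr
      _ = _ := by ring
  have hs : Summable fun i => (d : ℝ) * (freqNorm (ν i) * ‖b i‖) := hb.mul_left _
  have h1 := hasFDerivAt_tsum hs (fun i x => hasFDerivAt_character (ν i) (b i) x) hbound
    (x₀ := x) (hh x).summable x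
  have h2 : (fun y => ∑' i, b i * character (ν i) y) = fun y => ((h y : ℝ) : ℂ) := by
    ext y; exact (hh y).tsum_eq
  rw [h2] at h1
  have h3 : HasFDerivAt h (Complex.reCLM.comp (∑' i, f' i x)) x := Complex.reCLM.hasFDerivAt.comp x h1
  refine ⟨h3.differentiableAt, fun j => ?_⟩
  have h4 : HasFDerivAt (fun y => ((h y : ℝ) : ℂ)) (Complex.ofRealCLM.comp (fderiv ℝ h x)) x :=
    Complex.ofRealCLM.hasFDerivAt.comp x h3.differentiableAt.hasFDerivAt
  have h5 := h1.unique h4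
  have h6 : HasSum (fun i => f' i x) (∑' i, f' i x) :=
    (Summable.of_norm_bounded hs fun i => hbound i x).hasSum
  rw [h5] at h6
  have h7 := h6.mapL (ContinuousLinearMap.apply ℝ ℂ (Pi.single (M := fun _ : Fin d => ℝ) j (1 : ℝ)))
  refine (h7.congr_fun fun i => ?_)
  simp only [f', ContinuousLinearMap.apply_apply, _root_.smul_apply,
    ContinuousLinearMap.comp_apply, phaseCLM_apply, smul_eq_mul, Complex.ofRealCLM_apply]
  have : phase (ν i) (Pi.single j 1) = ν i j := by
    rw [phase, Finset.sum_eq_single j]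
    · simp
    · intro b _ hb; simp [hb]
    · simp
  rw [this]
  push_cast
  ring

/-- The time interval on which the radius `R - C (t - t₀)` is positive. -/
def timeSet (t₀ R C : ℝ) : Set ℝ := {t | t₀ ≤ t ∧ 0 < R - C * (t - t₀)}

section Time

variable {t₀ R C : ℝ}

theorem Icc_subset_timeSet (hC : 0 ≤ C) {t : ℝ} (ht : t ∈ timeSet t₀ R C) :
    Icc t₀ t ⊆ timeSet t₀ R C := by
  intro τ hτ
  refine ⟨hτ.1, ?_⟩
  have := ht.2
  have := mul_le_mul_of_nonneg_left (sub_le_sub_right hτ.2 t₀) hC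
  linarith

/-- The time interval is open on the right, so limits and derivatives at `t` can be computed on a
compact interval starting at `t₀`, where bounds are uniform. -/
theorem exists_later {t : ℝ} (ht : t ∈ timeSet t₀ R C) :
    ∃ t₁ ∈ timeSet t₀ R C, t < t₁ ∧ Icc t₀ t₁ ∈ 𝓝[timeSet t₀ R C] t := by
  have h : ∀ᶠ τ in 𝓝[>] t, 0 < R - C * (τ - t₀) := by
    have hc : Continuous fun τ => R - C * (τ - t₀) := by fun_prop
    exact nhdsWithin_le_nhds (hc.continuousAt.eventually (lt_mem_nhds ht.2))
  obtain ⟨t₁, ht₁, hlt⟩ := (h.and self_mem_nhdsWithin).exists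
  have hlt : t < t₁ := hlt
  refine ⟨t₁, ⟨ht.1.trans hlt.le, ht₁⟩, hlt, ?_⟩
  refine Filter.mem_of_superset (inter_mem_nhdsWithin _ (Iio_mem_nhds hlt)) fun τ hτ => ?_
  exact ⟨hτ.1.1, hτ.2.le⟩

theorem hasDerivWithinAt_primitive {E : Type*} [NormedAddCommGroup E] [NormedSpace ℝ E]
    [CompleteSpace E] (hC : 0 ≤ C) {g : ℝ → E} (hg : ContinuousOn g (timeSet t₀ R C)) {t : ℝ}
    (ht : t ∈ timeSet t₀ R C) :
    HasDerivWithinAt (fun t => ∫ τ in t₀..t, g τ) (g t) (timeSet t₀ R C) t := by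
  obtain ⟨t₁, ht₁, hlt, hn⟩ := exists_later ht
  have h01 : t₀ ≤ t₁ := ht₁.1
  have hgc : ContinuousOn g (Icc t₀ t₁) := hg.mono (Icc_subset_timeSet hC ht₁)
  -- The constant extension beyond `[t₀, t₁]` is continuous on the line, so the two-sided
  -- fundamental theorem applies even at the endpoint `t₀`.
  set G : ℝ → E := Set.IccExtend h01 ((Icc t₀ t₁).domRestrict g)
  have hG : Continuous G := (continuousOn_iff_continuous_domRestrict.1 hgc).Icc_extend'
  have hGg : ∀ τ ∈ Icc t₀ t₁, G τ = g τ := fun τ hτ => Set.IccExtend_of_mem h01 _ hτ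
  have h1 : HasDerivAt (fun t => ∫ τ in t₀..t, G τ) (G t) t :=
    intervalIntegral.integral_hasDerivAt_right (hG.intervalIntegrable _ _)
      hG.stronglyMeasurable.stronglyMeasurableAtFilter hG.continuousAt
  rw [hGg t ⟨ht.1, hlt.le⟩] at h1
  have heq : ∀ s ∈ Icc t₀ t₁, ∫ τ in t₀..s, g τ = ∫ τ in t₀..s, G τ := by
    intro s hs
    refine intervalIntegral.integral_congr fun τ hτ => ?_
    rw [uIcc_of_le hs.1] at hτ
    exact (hGg τ ⟨hτ.1, hτ.2.trans hs.2⟩).symm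
  refine h1.hasDerivWithinAt.congr_of_eventuallyEq ?_ (heq t ⟨ht.1, hlt.le⟩)
  filter_upwards [hn] with s hs using heq s hs

theorem continuousOn_primitive {E : Type*} [NormedAddCommGroup E] [NormedSpace ℝ E]
    [CompleteSpace E] (hC : 0 ≤ C) {g : ℝ → E} (hg : ContinuousOn g (timeSet t₀ R C)) :
    ContinuousOn (fun t => ∫ τ in t₀..t, g τ) (timeSet t₀ R C) :=
  fun _ ht => (hasDerivWithinAt_primitive hC hg ht).continuousWithinAt

theorem intervalIntegrable_of_timeSet {E : Type*} [NormedAddCommGroup E]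
    (hC : 0 ≤ C) {g : ℝ → E} (hg : ContinuousOn g (timeSet t₀ R C)) {t : ℝ}
    (ht : t ∈ timeSet t₀ R C) : IntervalIntegrable g volume t₀ t := by
  refine ContinuousOn.intervalIntegrable ?_
  rw [uIcc_of_le ht.1]
  exact hg.mono (Icc_subset_timeSet hC ht)

/-- Mode sums which converge uniformly on compact subintervals of the time interval. -/
structure IsLocalExpansion {ι : Type} (t₀ R C : ℝ) (h : ℝ → (Fin d → ℝ) → ℝ)
    (ν : ι → Fin d → ℤ) (b : ι → ℝ → ℂ) : Prop where
  cont : ∀ i, ContinuousOn (b i) (timeSet t₀ R C)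
  bound : ∀ t ∈ timeSet t₀ R C, ∃ B : ι → ℝ, Summable B ∧ ∀ i, ∀ τ ∈ Icc t₀ t, ‖b i τ‖ ≤ B i
  hasSum : ∀ t ∈ timeSet t₀ R C, ∀ x,
    HasSum (fun i => b i t * character (ν i) x) ((h t x : ℝ) : ℂ)

variable {ι : Type} {ν : ι → Fin d → ℤ} {b : ι → ℝ → ℂ} {h : ℝ → (Fin d → ℝ) → ℝ}

theorem IsLocalExpansion.continuousOn (hC : 0 ≤ C) (H : IsLocalExpansion t₀ R C h ν b)
    (x : Fin d → ℝ) : ContinuousOn (fun t => h t x) (timeSet t₀ R C) := by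
  intro t ht
  obtain ⟨t₁, ht₁, hlt, hn⟩ := exists_later ht
  obtain ⟨B, hB, hbB⟩ := H.bound t₁ ht₁
  have h1 : ContinuousOn (fun t => ∑' i, b i t * character (ν i) x) (Icc t₀ t₁) :=
    continuousOn_tsum (fun i => ((H.cont i).mono (Icc_subset_timeSet hC ht₁)).mul continuousOn_const)
      hB fun i τ hτ => by rw [norm_mul, norm_character, mul_one]; exact hbB i τ hτ
  have h2 : ContinuousOn (fun t => h t x) (Icc t₀ t₁) := by
    have := Complex.continuous_re.comp_continuousOn h1
    refine this.congr fun τ hτ => ?_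
    rw [Function.comp_apply, (H.hasSum τ (Icc_subset_timeSet hC ht₁ hτ) x).tsum_eq,
      Complex.ofReal_re]
  exact (h2 t ⟨ht.1, hlt.le⟩).mono_of_mem_nhdsWithin hn

/-- The weighted bound is required only after integration in time. Before it, a differentiated
expansion is controlled merely on compact subintervals. -/
theorem IsLocalExpansion.integral [Countable ι] (hC : 0 ≤ C) (H : IsLocalExpansion t₀ R C h ν b)
    {μ : ι → ℝ} (hμ : Summable μ) (hμ0 : ∀ i, 0 ≤ μ i) {r : ℝ → ℝ}
    (hbound : ∀ i, ∀ t ∈ timeSet t₀ R C,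
      ∫ τ in t₀..t, Real.exp (r t * freqNorm (ν i)) * ‖b i τ‖ ≤ μ i) :
    IsModeExpansion (timeSet t₀ R C) r (fun t x => ∫ τ in t₀..t, h τ x) ν
      (fun i t => ∫ τ in t₀..t, b i τ) μ := by
  refine ⟨fun i => continuousOn_primitive hC (H.cont i), hμ0, fun i t ht => ?_, hμ,
    fun t ht x => ?_⟩
  · refine le_trans ?_ (hbound i t ht)
    rw [intervalIntegral.integral_const_mul]
    gcongr
    exact intervalIntegral.norm_integral_le_integral_norm ht.1
  · obtain ⟨B, hB, hbB⟩ := H.bound t ht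
    have h1 := intervalIntegral.hasSum_integral_of_dominated_convergence (μ := volume)
      (a := t₀) (b := t) (F := fun i τ => b i τ * character (ν i) x)
      (f := fun τ => ((h τ x : ℝ) : ℂ)) (fun i _ => B i) ?_ ?_ ?_ ?_ ?_
    · rw [intervalIntegral.integral_ofReal] at h1
      refine h1.congr_fun fun i => ?_
      rw [intervalIntegral.integral_mul_const]
    · intro i
      rw [uIoc_of_le ht.1]
      have : ContinuousOn (fun τ => b i τ * character (ν i) x) (Icc t₀ t) :=
        ((H.cont i).mono (Icc_subset_timeSet hC ht)).mul continuousOn_const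
      exact (this.mono Ioc_subset_Icc_self).aestronglyMeasurable measurableSet_Ioc
    · intro i
      refine Filter.Eventually.of_forall fun τ hτ => ?_
      rw [uIoc_of_le ht.1] at hτ
      rw [norm_mul, norm_character, mul_one]
      exact hbB i τ (Ioc_subset_Icc_self hτ)
    · exact Filter.Eventually.of_forall fun _ _ => hB
    · exact intervalIntegrable_const
    · refine Filter.Eventually.of_forall fun τ hτ => ?_
      rw [uIoc_of_le ht.1] at hτ
      exact H.hasSum τ (Icc_subset_timeSet hC ht (Ioc_subset_Icc_self hτ)) x

/-- The radius decreasing at speed `C`. -/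
def radius (t₀ R C t : ℝ) : ℝ := R - C * (t - t₀)

theorem radius_pos {t : ℝ} (ht : t ∈ timeSet t₀ R C) : 0 < radius t₀ R C t := ht.2

theorem radius_nonneg : ∀ t ∈ timeSet t₀ R C, 0 ≤ radius t₀ R C t := fun _ ht => (radius_pos ht).le

theorem radius_anti (hC : 0 ≤ C) {τ t : ℝ} (h : τ ≤ t) : radius t₀ R C t ≤ radius t₀ R C τ := by
  have := mul_le_mul_of_nonneg_left (sub_le_sub_right h t₀) hC
  unfold radius
  linarith

theorem sub_le_of_mem_timeSet (hC : 0 < C) {t : ℝ} (ht : t ∈ timeSet t₀ R C) : t - t₀ ≤ R / C := by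
  have := ht.2
  rw [le_div_iff₀ hC]
  linarith

theorem IsModeExpansion.isLocalExpansion {μ : ι → ℝ} (hC : 0 ≤ C)
    (H : IsModeExpansion (timeSet t₀ R C) (radius t₀ R C) h ν b μ) :
    IsLocalExpansion t₀ R C h ν b :=
  ⟨H.cont, fun _ ht => ⟨μ, H.summable, fun i _ hτ =>
    H.norm_le radius_nonneg i (Icc_subset_timeSet hC ht hτ)⟩, H.hasSum⟩

theorem Majorized.continuousOn {M : ℝ} (hC : 0 ≤ C)
    (H : Majorized (timeSet t₀ R C) (radius t₀ R C) h M) (x : Fin d → ℝ) :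
    ContinuousOn (fun t => h t x) (timeSet t₀ R C) := by
  obtain ⟨ι, _, ν, b, μ, H, hM⟩ := H
  exact (H.isLocalExpansion hC).continuousOn hC x

/-- Time integration gains the length of the time interval. -/
theorem Majorized.integral {M : ℝ} (hC : 0 < C)
    (H : Majorized (timeSet t₀ R C) (radius t₀ R C) h M) :
    Majorized (timeSet t₀ R C) (radius t₀ R C) (fun t x => ∫ τ in t₀..t, h τ x) (|R / C| * M) := by
  obtain ⟨ι, hι, ν, b, μ, H, hM⟩ := H
  refine ⟨ι, hι, ν, _, fun i => |R / C| * μ i, (H.isLocalExpansion hC.le).integral hC.le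
    (H.summable.mul_left _) (fun i => mul_nonneg (abs_nonneg _) (H.nonneg i)) fun i t ht => ?_, ?_⟩
  · have h1 : ∫ τ in t₀..t, Real.exp (radius t₀ R C t * freqNorm (ν i)) * ‖b i τ‖ ≤
        ∫ _τ in t₀..t, μ i := by
      refine intervalIntegral.integral_mono_on ht.1 ?_ intervalIntegrable_const fun τ hτ => ?_
      · exact intervalIntegrable_of_timeSet hC.le (continuousOn_const.mul (H.cont i).norm) ht
      · refine le_trans ?_ (H.bound i τ (Icc_subset_timeSet hC.le ht hτ))
        gcongr
        · exact freqNorm_nonneg _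
        · exact radius_anti hC.le hτ.2
    refine h1.trans ?_
    rw [intervalIntegral.integral_const, smul_eq_mul]
    exact mul_le_mul_of_nonneg_right ((sub_le_of_mem_timeSet hC ht).trans (le_abs_self _))
      (H.nonneg i)
  · rw [tsum_mul_left]
    exact mul_le_mul_of_nonneg_left hM (abs_nonneg _)

theorem mul_exp_neg_le {a n : ℝ} (ha : 0 < a) : n * Real.exp (-(a * n)) ≤ 1 / a := by
  rw [Real.exp_neg, ← div_eq_mul_inv, div_le_div_iff₀ (Real.exp_pos _) ha]
  have := Real.add_one_le_exp (a * n)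
  linarith

/-- Here a derivative is regained. A radius shrinking at speed `C` damps the frequency `n` by
`e^{-C(t-τ)n}`, and the integrand is the exact derivative of `e^{-C(t-τ)n}/C`, so the bound does not
depend on `n`. -/
theorem integral_mul_exp_le (hC : 0 < C) (n t₀ t : ℝ) :
    ∫ τ in t₀..t, n * Real.exp (-(C * (t - τ) * n)) ≤ 1 / C := by
  have h : ∀ τ ∈ uIcc t₀ t, HasDerivAt (fun τ => 1 / C * Real.exp (-(C * (t - τ) * n)))
      (n * Real.exp (-(C * (t - τ) * n))) τ := by
    intro τ _
    have h1 : HasDerivAt (fun τ => -(C * (t - τ) * n)) (C * n) τ := by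
      have := ((((hasDerivAt_id τ).const_sub t).const_mul C).mul_const n).fun_neg
      simpa using this
    have h2 := h1.exp.const_mul (1 / C)
    refine h2.congr_deriv ?_
    field_simp
  rw [intervalIntegral.integral_eq_sub_of_hasDerivAt h
    (Continuous.intervalIntegrable (by fun_prop) _ _)]
  simp only [sub_self, mul_zero, zero_mul, neg_zero, Real.exp_zero, mul_one]
  have : 0 ≤ 1 / C * Real.exp (-(C * (t - t₀) * n)) := by positivity
  linarith

theorem IsModeExpansion.summable_freqNorm_mul {μ : ι → ℝ} {J : Set ℝ} {r : ℝ → ℝ}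
    (H : IsModeExpansion J r h ν b μ) {t : ℝ} (ht : t ∈ J) (hr : 0 < r t) :
    Summable fun i => freqNorm (ν i) * ‖b i t‖ := by
  refine Summable.of_nonneg_of_le (fun i => mul_nonneg (freqNorm_nonneg _) (norm_nonneg _))
    (fun i => ?_) (H.summable.mul_left (1 / r t))
  calc freqNorm (ν i) * ‖b i t‖ = freqNorm (ν i) * Real.exp (-(r t * freqNorm (ν i))) *
        (Real.exp (r t * freqNorm (ν i)) * ‖b i t‖) := by
        rw [Real.exp_neg]; field_simp
    _ ≤ 1 / r t * μ i := mul_le_mul (mul_exp_neg_le hr) (H.bound i t ht) (by positivity)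
        (by positivity)

theorem Majorized.differentiableAt {M : ℝ} {J : Set ℝ} {r : ℝ → ℝ}
    (H : Majorized J r h M) {t : ℝ} (ht : t ∈ J) (hr : 0 < r t) (x : Fin d → ℝ) :
    DifferentiableAt ℝ (h t) x := by
  obtain ⟨ι, hι, ν, b, μ, H, hM⟩ := H
  exact (hasSum_partialDeriv (H.summable_freqNorm_mul ht hr) (H.hasSum t ht) x).1

variable {ι' : Type} {ν' : ι' → Fin d → ℤ} {b' : ι' → ℝ → ℂ} {g : ℝ → (Fin d → ℝ) → ℝ}

/-- The loss of radius `C (t - τ)` between `τ` and `t` is spent entirely on the differentiated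
factor. For the other factor it suffices that the radius decreases. -/
theorem IsModeExpansion.mul_partialDeriv_bound {μ : ι → ℝ} {μ' : ι' → ℝ} (hC : 0 < C)
    (H : IsModeExpansion (timeSet t₀ R C) (radius t₀ R C) g ν b μ)
    (H' : IsModeExpansion (timeSet t₀ R C) (radius t₀ R C) h ν' b' μ') (j : Fin d) {τ t : ℝ}
    (ht : t ∈ timeSet t₀ R C) (hτ : τ ∈ Icc t₀ t) (p : ι × ι') :
    Real.exp (radius t₀ R C t * freqNorm (ν p.1 + ν' p.2)) *
      ‖b p.1 τ * (b' p.2 τ * (Complex.I * ν' p.2 j))‖ ≤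
    freqNorm (ν' p.2) * Real.exp (-(C * (t - τ) * freqNorm (ν' p.2))) * (μ p.1 * μ' p.2) := by
  have hτ' := Icc_subset_timeSet hC.le ht hτ
  set ρ := radius t₀ R C
  have e1 : Real.exp (ρ t * freqNorm (ν p.1 + ν' p.2)) ≤ Real.exp (ρ τ * freqNorm (ν p.1)) *
      (Real.exp (ρ τ * freqNorm (ν' p.2)) * Real.exp (-(C * (t - τ) * freqNorm (ν' p.2)))) := by
    rw [← Real.exp_add, ← Real.exp_add, Real.exp_le_exp]
    have h1 : ρ t = ρ τ - C * (t - τ) := by simp only [ρ, radius]; ring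
    have h2 := mul_le_mul_of_nonneg_left (freqNorm_add_le (ν p.1) (ν' p.2)) (radius_nonneg t ht)
    have h3 := mul_le_mul_of_nonneg_right (radius_anti (t₀ := t₀) (R := R) hC.le hτ.2)
      (freqNorm_nonneg (ν p.1))
    have h4 : ρ t * freqNorm (ν' p.2) = ρ τ * freqNorm (ν' p.2) -
      C * (t - τ) * freqNorm (ν' p.2) := by rw [h1]; ring
    rw [mul_add] at h2
    linarith
  have e2 : ‖b p.1 τ * (b' p.2 τ * (Complex.I * ν' p.2 j))‖ ≤
      ‖b p.1 τ‖ * (‖b' p.2 τ‖ * freqNorm (ν' p.2)) := by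
    rw [norm_mul, norm_mul, norm_mul, Complex.norm_I, one_mul]
    gcongr
    have : ‖((ν' p.2 j : ℤ) : ℂ)‖ = |(ν' p.2 j : ℝ)| := by
      rw [← Complex.ofReal_intCast, Complex.norm_real, Real.norm_eq_abs]
    rw [this]
    exact abs_le_freqNorm _ _
  have hf := freqNorm_nonneg (ν' p.2)
  calc _ ≤ _ := mul_le_mul e1 e2 (norm_nonneg _) (by positivity)
    _ = freqNorm (ν' p.2) * Real.exp (-(C * (t - τ) * freqNorm (ν' p.2))) *
        ((Real.exp (ρ τ * freqNorm (ν p.1)) * ‖b p.1 τ‖) *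
          (Real.exp (ρ τ * freqNorm (ν' p.2)) * ‖b' p.2 τ‖)) := by ring
    _ ≤ _ := by
        refine mul_le_mul_of_nonneg_left ?_ (by positivity)
        exact mul_le_mul (H.bound _ τ hτ') (H'.bound _ τ hτ') (by positivity) (H.nonneg _)

/-- At a fixed time the derivative costs a factor `1 / radius`. This is bounded on compact
subintervals but blows up as the radius vanishes, so only a local expansion results. -/
theorem IsModeExpansion.mul_partialDeriv {μ : ι → ℝ} {μ' : ι' → ℝ} (hC : 0 < C)
    (H : IsModeExpansion (timeSet t₀ R C) (radius t₀ R C) g ν b μ)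
    (H' : IsModeExpansion (timeSet t₀ R C) (radius t₀ R C) h ν' b' μ') (j : Fin d) :
    IsLocalExpansion t₀ R C (fun t x => g t x * partialDeriv j (h t) x)
      (fun p : ι × ι' => ν p.1 + ν' p.2)
      (fun p t => b p.1 t * (b' p.2 t * (Complex.I * ν' p.2 j))) := by
  have hs : Summable fun p : ι × ι' => μ p.1 * μ' p.2 :=
    H.summable.mul_of_nonneg H'.summable H.nonneg H'.nonneg
  have hbound : ∀ t ∈ timeSet t₀ R C, ∀ p : ι × ι', ∀ τ ∈ Icc t₀ t,
      ‖b p.1 τ * (b' p.2 τ * (Complex.I * ν' p.2 j))‖ ≤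
        1 / radius t₀ R C t * (μ p.1 * μ' p.2) := by
    intro t ht p τ hτ
    have hτ' := Icc_subset_timeSet hC.le ht hτ
    have hρ := radius_pos hτ'
    have hρt := radius_pos ht
    have e1 : ‖b p.1 τ‖ ≤ μ p.1 := H.norm_le radius_nonneg _ hτ'
    have e2 : freqNorm (ν' p.2) * ‖b' p.2 τ‖ ≤ 1 / radius t₀ R C t * μ' p.2 := by
      calc freqNorm (ν' p.2) * ‖b' p.2 τ‖ =
          freqNorm (ν' p.2) * Real.exp (-(radius t₀ R C τ * freqNorm (ν' p.2))) *
          (Real.exp (radius t₀ R C τ * freqNorm (ν' p.2)) * ‖b' p.2 τ‖) := by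
            rw [Real.exp_neg]; field_simp
        _ ≤ 1 / radius t₀ R C τ * μ' p.2 := mul_le_mul (mul_exp_neg_le hρ)
            (H'.bound _ τ hτ') (by positivity) (by positivity)
        _ ≤ _ := mul_le_mul_of_nonneg_right
            (one_div_le_one_div_of_le hρt (radius_anti hC.le hτ.2)) (H'.nonneg _)
    have e3 : ‖((ν' p.2 j : ℤ) : ℂ)‖ ≤ freqNorm (ν' p.2) := by
      rw [← Complex.ofReal_intCast, Complex.norm_real, Real.norm_eq_abs]
      exact abs_le_freqNorm _ _
    rw [norm_mul, norm_mul, norm_mul, Complex.norm_I, one_mul]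
    calc ‖b p.1 τ‖ * (‖b' p.2 τ‖ * ‖((ν' p.2 j : ℤ) : ℂ)‖)
        ≤ μ p.1 * (1 / radius t₀ R C t * μ' p.2) := by
          refine mul_le_mul e1 ?_ (by positivity) (H.nonneg _)
          refine le_trans ?_ e2
          rw [mul_comm]
          gcongr
      _ = _ := by ring
  refine ⟨fun p => (H.cont p.1).mul ((H'.cont p.2).mul continuousOn_const),
    fun t ht => ⟨_, hs.mul_left _, hbound t ht⟩, fun t ht x => ?_⟩
  have hd := (hasSum_partialDeriv (H'.summable_freqNorm_mul ht (radius_pos ht))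
    (H'.hasSum t ht) x).2 j
  have h1 := (H.hasSum t ht x).mul hd (Summable.of_norm_bounded
    (hs.mul_left (1 / radius t₀ R C t)) fun p => by
      have := hbound t ht p t ⟨ht.1, le_rfl⟩
      simp only [norm_mul, norm_character, mul_one] at this ⊢
      exact this)
  rw [Complex.ofReal_mul]
  refine h1.congr_fun fun p => ?_
  rw [character_add_left]
  ring

theorem Majorized.continuousOn_mul_partialDeriv {M M' : ℝ} (hC : 0 < C)
    (H : Majorized (timeSet t₀ R C) (radius t₀ R C) g M)
    (H' : Majorized (timeSet t₀ R C) (radius t₀ R C) h M') (j : Fin d) (x : Fin d → ℝ) :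
    ContinuousOn (fun t => g t x * partialDeriv j (h t) x) (timeSet t₀ R C) := by
  obtain ⟨ι, hι, ν, b, μ, H, hM⟩ := H
  obtain ⟨ι', hι', ν', b', μ', H', hM'⟩ := H'
  exact (H.mul_partialDeriv hC H' j).continuousOn hC.le x

/-- Time integration compensates the loss of one derivative, with a gain `1 / C`. -/
theorem Majorized.integral_mul_partialDeriv {M M' : ℝ} (hC : 0 < C)
    (H : Majorized (timeSet t₀ R C) (radius t₀ R C) g M)
    (H' : Majorized (timeSet t₀ R C) (radius t₀ R C) h M') (j : Fin d) :
    Majorized (timeSet t₀ R C) (radius t₀ R C)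
      (fun t x => ∫ τ in t₀..t, g τ x * partialDeriv j (h τ) x) (1 / C * (M * M')) := by
  have hM0 := H.nonneg
  obtain ⟨ι, hι, ν, b, μ, H, hM⟩ := H
  obtain ⟨ι', hι', ν', b', μ', H', hM'⟩ := H'
  have hs : Summable fun p : ι × ι' => μ p.1 * μ' p.2 :=
    H.summable.mul_of_nonneg H'.summable H.nonneg H'.nonneg
  have hL := H.mul_partialDeriv hC H' j
  refine ⟨ι × ι', inferInstance, _, _, fun p => 1 / C * (μ p.1 * μ' p.2),
    hL.integral hC.le (hs.mul_left _) (fun p => ?_) fun p t ht => ?_, ?_⟩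
  · have := H.nonneg p.1
    have := H'.nonneg p.2
    positivity
  · have h1 : ∫ τ in t₀..t, Real.exp (radius t₀ R C t * freqNorm (ν p.1 + ν' p.2)) *
        ‖b p.1 τ * (b' p.2 τ * (Complex.I * ν' p.2 j))‖ ≤
        ∫ τ in t₀..t, freqNorm (ν' p.2) * Real.exp (-(C * (t - τ) * freqNorm (ν' p.2))) *
          (μ p.1 * μ' p.2) := by
      refine intervalIntegral.integral_mono_on ht.1 ?_
        (Continuous.intervalIntegrable (by fun_prop) _ _)
        fun τ hτ => H.mul_partialDeriv_bound hC H' j ht hτ p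
      exact intervalIntegrable_of_timeSet hC.le (continuousOn_const.mul (hL.cont p).norm) ht
    refine h1.trans ?_
    rw [intervalIntegral.integral_mul_const]
    exact mul_le_mul_of_nonneg_right (integral_mul_exp_le hC _ _ _)
      (mul_nonneg (H.nonneg _) (H'.nonneg _))
  · rw [tsum_mul_left, ← H.summable.tsum_mul_tsum H'.summable hs]
    refine mul_le_mul_of_nonneg_left ?_ (by positivity)
    exact mul_le_mul hM hM' (tsum_nonneg H'.nonneg) hM0

end Time

end GenFun
end

/-! ### From mode expansions to generator functions and back -/

noncomputable section

namespace GenFun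

open MeasureTheory Set Complex

variable {d m : ℕ}

/-- The generator function of a scalar function. -/
def scalarGen (h : (Fin d → ℝ) → ℝ) (z : ℝ) : ENNReal :=
  ∑' α : Fin d → ℤ,
    ENNReal.ofReal (Real.exp (z * freqNorm α) * ‖coeff (fun x => ((h x : ℝ) : ℂ)) α‖)

theorem gen_le_sum_scalarGen (f : (Fin d → ℝ) → EuclideanSpace ℝ (Fin m)) (z : ℝ) :
    Gen f z ≤ ∑ i, scalarGen (fun x => f x i) z := by
  have h : ∀ α, ENNReal.ofReal (Real.exp (z * freqNorm α) * ‖fourierCoeff f α‖) ≤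
      ∑ i, ENNReal.ofReal (Real.exp (z * freqNorm α) *
        ‖coeff (fun x => ((f x i : ℝ) : ℂ)) α‖) := by
    intro α
    rw [← ENNReal.ofReal_sum_of_nonneg fun i _ => by positivity, ← Finset.mul_sum]
    exact ENNReal.ofReal_le_ofReal
      (mul_le_mul_of_nonneg_left (norm_le_sum_norm _) (Real.exp_pos _).le)
  refine (ENNReal.tsum_le_tsum h).trans (le_of_eq ?_)
  exact Summable.tsum_finsetSum fun i _ => ENNReal.summable

/-- The coefficient at `α` is the sum of the modes of frequency `α`; the triangle inequality and an
exchange of sums in `[0, ∞]` give the bound. -/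
theorem scalarGen_le_of_hasSum {ι : Type} [Countable ι] {ν : ι → Fin d → ℤ} {b : ι → ℂ}
    {h : (Fin d → ℝ) → ℝ} (hb : Summable fun i => ‖b i‖)
    (hh : ∀ x, HasSum (fun i => b i * character (ν i) x) ((h x : ℝ) : ℂ)) (z : ℝ) :
    scalarGen h z ≤ ∑' i, ENNReal.ofReal (Real.exp (z * freqNorm (ν i)) * ‖b i‖) := by
  have h1 : ∀ α, ENNReal.ofReal (Real.exp (z * freqNorm α) * ‖coeff (fun x => ((h x : ℝ) : ℂ)) α‖) ≤
      ∑' i, if ν i = α then ENNReal.ofReal (Real.exp (z * freqNorm (ν i)) * ‖b i‖) else 0 := by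
    intro α
    have hs : Summable fun i => ‖if ν i = α then b i else 0‖ :=
      Summable.of_nonneg_of_le (fun _ => norm_nonneg _)
        (fun i => by split_ifs <;> simp) hb
    have h2 : ‖coeff (fun x => ((h x : ℝ) : ℂ)) α‖ ≤ ∑' i, ‖if ν i = α then b i else 0‖ := by
      rw [← (coeff_of_hasSum hb hh α).tsum_eq]
      exact norm_tsum_le_tsum_norm hs
    calc _ ≤ ENNReal.ofReal (Real.exp (z * freqNorm α) * ∑' i, ‖if ν i = α then b i else 0‖) :=
          ENNReal.ofReal_le_ofReal (mul_le_mul_of_nonneg_left h2 (Real.exp_pos _).le)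
      _ = ∑' i, ENNReal.ofReal (Real.exp (z * freqNorm α) * ‖if ν i = α then b i else 0‖) := by
          rw [← tsum_mul_left, ENNReal.ofReal_tsum_of_nonneg (fun i => by positivity)
            (hs.mul_left _)]
      _ = _ := by
          refine tsum_congr fun i => ?_
          split_ifs with hi
          · rw [hi]
          · simp
  refine (ENNReal.tsum_le_tsum h1).trans (le_of_eq ?_)
  rw [ENNReal.tsum_comm]
  exact tsum_congr fun i => tsum_ite_eq' (ν i) _

section Majorized

variable {J : Set ℝ} {r : ℝ → ℝ} {h : ℝ → (Fin d → ℝ) → ℝ} {M : ℝ}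

theorem Majorized.scalarGen_le (H : Majorized J r h M) (hr : ∀ t ∈ J, 0 ≤ r t) {t : ℝ}
    (ht : t ∈ J) : scalarGen (h t) (r t) ≤ ENNReal.ofReal M := by
  obtain ⟨ι, hι, ν, b, μ, H, hM⟩ := H
  have hb : Summable fun i => ‖b i t‖ :=
    Summable.of_nonneg_of_le (fun _ => norm_nonneg _) (fun i => H.norm_le hr i ht) H.summable
  refine (scalarGen_le_of_hasSum hb (H.hasSum t ht) _).trans ?_
  calc _ ≤ ∑' i, ENNReal.ofReal (μ i) :=
        ENNReal.tsum_le_tsum fun i => ENNReal.ofReal_le_ofReal (H.bound i t ht)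
    _ = ENNReal.ofReal (∑' i, μ i) := (ENNReal.ofReal_tsum_of_nonneg H.nonneg H.summable).symm
    _ ≤ _ := ENNReal.ofReal_le_ofReal hM

theorem Majorized.boxPeriodic (H : Majorized J r h M) {t : ℝ} (ht : t ∈ J) :
    BoxPeriodic (h t) := by
  obtain ⟨ι, hι, ν, b, μ, H, hM⟩ := H
  intro x j
  have h1 := H.hasSum t ht (x + Pi.single j (2 * Real.pi))
  simp only [boxPeriodic_character _ x j] at h1
  exact Complex.ofReal_injective (h1.unique (H.hasSum t ht x))

theorem Majorized.continuous (H : Majorized J r h M) (hr : ∀ t ∈ J, 0 ≤ r t) {t : ℝ}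
    (ht : t ∈ J) : Continuous (h t) := by
  obtain ⟨ι, hι, ν, b, μ, H, hM⟩ := H
  have h1 : Continuous fun x => ∑' i, b i t * character (ν i) x :=
    continuous_tsum (fun i => continuous_const.mul (continuous_character _)) H.summable
      fun i x => by rw [norm_mul, norm_character, mul_one]; exact H.norm_le hr i ht
  have h2 := Complex.continuous_re.comp h1
  refine h2.congr fun x => ?_
  rw [Function.comp_apply, (H.hasSum t ht x).tsum_eq, Complex.ofReal_re]

/-- Dominated convergence over the modes, with dominating weights `2 μ`. The strict inequality for
`s` keeps the radius above `s` for all times near `t'`. -/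
theorem Majorized.tendsto_scalarGen_sub {t₀ R C : ℝ}
    (H : Majorized (timeSet t₀ R C) (radius t₀ R C) h M) {t' s : ℝ} (ht' : t' ∈ timeSet t₀ R C)
    (hs : s < radius t₀ R C t') :
    Filter.Tendsto (fun t => scalarGen (fun x => h t x - h t' x) s)
      (𝓝[timeSet t₀ R C] t') (𝓝 0) := by
  obtain ⟨ι, hι, ν, b, μ, H, hM⟩ := H
  set J := timeSet t₀ R C
  have hev : ∀ᶠ t in 𝓝[J] t', t ∈ J ∧ s < radius t₀ R C t := by
    refine Filter.Eventually.and self_mem_nhdsWithin (nhdsWithin_le_nhds ?_)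
    have hc : Continuous (radius t₀ R C) := by unfold radius; fun_prop
    exact hc.continuousAt.eventually (lt_mem_nhds hs)
  have hb : ∀ t ∈ J, s < radius t₀ R C t → ∀ i,
      Real.exp (s * freqNorm (ν i)) * ‖b i t‖ ≤ μ i := by
    intro t ht hst i
    refine le_trans ?_ (H.bound i t ht)
    gcongr
    exact freqNorm_nonneg _
  have hbd : ∀ t ∈ J, s < radius t₀ R C t → ∀ i,
      Real.exp (s * freqNorm (ν i)) * ‖b i t - b i t'‖ ≤ 2 * μ i := by
    intro t ht hst i
    have h1 := hb t ht hst i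
    have h2 := hb t' ht' hs i
    have h3 := mul_le_mul_of_nonneg_left (norm_sub_le (b i t) (b i t'))
      (Real.exp_pos (s * freqNorm (ν i))).le
    linarith
  have hlim : Filter.Tendsto
      (fun t => ∑' i, Real.exp (s * freqNorm (ν i)) * ‖b i t - b i t'‖) (𝓝[J] t')
      (𝓝 (∑' _ : ι, (0 : ℝ))) := by
    refine tendsto_tsum_of_dominated_convergence (H.summable.mul_left 2) (fun i => ?_) ?_
    · have h1 : Filter.Tendsto (fun t => ‖b i t - b i t'‖) (𝓝[J] t') (𝓝 0) := by
        have := ((H.cont i t' ht').tendsto.sub_const (b i t')).norm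
        simpa using this
      simpa using h1.const_mul (Real.exp (s * freqNorm (ν i)))
    · filter_upwards [hev] with t ht i
      rw [Real.norm_of_nonneg (by positivity)]
      exact hbd t ht.1 ht.2 i
  rw [tsum_zero] at hlim
  have hlim2 := (ENNReal.continuous_ofReal.tendsto 0).comp hlim
  rw [ENNReal.ofReal_zero] at hlim2
  refine tendsto_of_tendsto_of_tendsto_of_le_of_le' tendsto_const_nhds hlim2
    (Filter.Eventually.of_forall fun _ => zero_le) ?_
  filter_upwards [hev] with t ht
  have hsum : Summable fun i => ‖b i t - b i t'‖ :=
    Summable.of_nonneg_of_le (fun _ => norm_nonneg _) (fun i => (norm_sub_le _ _).trans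
      (add_le_add (H.norm_le radius_nonneg i ht.1) (H.norm_le radius_nonneg i ht')))
      (H.summable.add H.summable)
  refine (scalarGen_le_of_hasSum (b := fun i => b i t - b i t') (ν := ν) hsum (fun x => ?_) s).trans
    (le_of_eq ?_)
  · rw [Complex.ofReal_sub]
    refine ((H.hasSum t ht.1 x).sub (H.hasSum t' ht' x)).congr_fun fun i => ?_
    ring
  · rw [Function.comp_apply, ENNReal.ofReal_tsum_of_nonneg (fun i => by positivity)]
    exact Summable.of_nonneg_of_le (fun i => by positivity) (hbd t ht.1 ht.2)
      (H.summable.mul_left 2)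

end Majorized

theorem gen_mono (f : (Fin d → ℝ) → EuclideanSpace ℝ (Fin m)) {z z' : ℝ} (h : z ≤ z') :
    Gen f z ≤ Gen f z' := by
  refine ENNReal.tsum_le_tsum fun α => ENNReal.ofReal_le_ofReal ?_
  have := freqNorm_nonneg α
  gcongr

theorem mul_norm_fourierCoeff_le {f : (Fin d → ℝ) → EuclideanSpace ℝ (Fin m)} {z : ℝ}
    (h : Gen f z < ⊤) (α : Fin d → ℤ) :
    Real.exp (z * freqNorm α) * ‖fourierCoeff f α‖ ≤ (Gen f z).toReal := by
  rw [← ENNReal.ofReal_le_iff_le_toReal h.ne]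
  exact ENNReal.le_tsum α

theorem summable_of_gen_lt_top {f : (Fin d → ℝ) → EuclideanSpace ℝ (Fin m)} {z : ℝ}
    (h : Gen f z < ⊤) :
    HasSum (fun α => Real.exp (z * freqNorm α) * ‖fourierCoeff f α‖) (Gen f z).toReal := by
  have h0 : ∀ α, 0 ≤ Real.exp (z * freqNorm α) * ‖fourierCoeff f α‖ := fun α => by positivity
  have hs : Summable fun α => Real.exp (z * freqNorm α) * ‖fourierCoeff f α‖ := by
    have := ENNReal.summable_toReal h.ne
    simpa only [ENNReal.toReal_ofReal (h0 _)] using this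
  have e : (Gen f z).toReal = ∑' α, Real.exp (z * freqNorm α) * ‖fourierCoeff f α‖ := by
    rw [Gen, ← ENNReal.ofReal_tsum_of_nonneg h0 hs, ENNReal.toReal_ofReal (tsum_nonneg h0)]
  rw [e]
  exact hs.hasSum

theorem norm_coeff_le_norm_fourierCoeff (f : (Fin d → ℝ) → EuclideanSpace ℝ (Fin m))
    (α : Fin d → ℤ) (i : Fin m) :
    ‖coeff (fun x => ((f x i : ℝ) : ℂ)) α‖ ≤ ‖fourierCoeff f α‖ :=
  norm_apply_le_norm (fourierCoeff f α) i

/-- Fourier inversion for elements of `X_z`, `z ≥ 0`. -/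
theorem hasSum_of_mem_X {f : (Fin d → ℝ) → EuclideanSpace ℝ (Fin m)} {z : ℝ} (hz : 0 ≤ z)
    (h : f ∈ X d m z) (i : Fin m) (x : Fin d → ℝ) :
    HasSum (fun α => coeff (fun x => ((f x i : ℝ) : ℂ)) α * character α x)
      ((f x i : ℝ) : ℂ) := by
  obtain ⟨hc, hp, hg⟩ := h
  refine hasSum_coeff (h := fun x => ((f x i : ℝ) : ℂ)) (fun x j => by simp only [hp x j])
    (by fun_prop) ?_ x
  refine Summable.of_nonneg_of_le (fun _ => norm_nonneg _) (fun α => ?_)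
    (summable_of_gen_lt_top hg).summable
  refine (norm_coeff_le_norm_fourierCoeff f α i).trans
    (le_mul_of_one_le_left (norm_nonneg _) (Real.one_le_exp ?_))
  exact mul_nonneg hz (freqNorm_nonneg _)

theorem majorized_of_mem_X {f : (Fin d → ℝ) → EuclideanSpace ℝ (Fin m)} {R C t₀ : ℝ}
    (hR : 0 ≤ R) (hC : 0 ≤ C) (h : f ∈ X d m R) :
    VMajorized (timeSet t₀ R C) (radius t₀ R C) (fun _ x => f x) (Gen f R).toReal := by
  intro i
  have hs := summable_of_gen_lt_top h.2.2
  refine ⟨Fin d → ℤ, inferInstance, fun α => α, fun α _ => coeff (fun x => ((f x i : ℝ) : ℂ)) α,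
    fun α => Real.exp (R * freqNorm α) * ‖fourierCoeff f α‖,
    ⟨fun α => continuousOn_const, fun α => by positivity, fun α t ht => ?_, hs.summable,
      fun t ht x => hasSum_of_mem_X hR h i x⟩, hs.tsum_eq.le⟩
  have h1 : radius t₀ R C t ≤ R := by
    have := mul_nonneg hC (sub_nonneg.2 ht.1)
    unfold radius; linarith
  have := freqNorm_nonneg α
  gcongr
  exact norm_coeff_le_norm_fourierCoeff f α i

end GenFun
end

/-! ### Estimates for the integrated right-hand side -/

noncomputable section

namespace GenFun

open MeasureTheory Set Complex

variable {d m : ℕ}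

variable {A : EuclideanSpace ℝ (Fin m) → (Fin d → EuclideanSpace ℝ (Fin m)) →
  EuclideanSpace ℝ (Fin m)} {s M L : ℝ}

/-- The quasilinear form of `A`, with composition bounds on its coefficients for
arguments majorized by `s`. -/
structure QuasilinearBound (A : EuclideanSpace ℝ (Fin m) → (Fin d → EuclideanSpace ℝ (Fin m)) →
    EuclideanSpace ℝ (Fin m)) (s M L : ℝ) : Prop where
  eq : ∀ y p, A y p = A y 0 + ∑ j, ∑ i, p j i • slope A j i y
  bound_zero : ∀ l, LiftBound d (fun y => A y 0 l) s M L
  bound_slope : ∀ j i l, LiftBound d (fun y => slope A j i y l) s M L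
  nonneg : 0 ≤ s
  nonneg_bound : 0 ≤ M
  nonneg_lipschitz : 0 ≤ L

theorem exists_quasilinearBound (hd : 1 ≤ d) (hA : Continuous (Function.uncurry A)) {C₀ : ℝ}
    {F : ℝ → ℝ} (hF : AnalyticOnNhd ℝ F (Set.Ici 0)) (hb : GeneratorBound A C₀ F)
    (hs : 0 ≤ s) : ∃ M L, QuasilinearBound A s M L := by
  choose M₁ L₁ h₁ using fun l => (hasChebyshevExpansion_zero hd hA hF hb l).exists_liftBound
    (d := d) hs
  choose M₂ L₂ h₂ using fun p : Fin d × Fin m × Fin m =>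
    (hasChebyshevExpansion_slope hA hF hb p.1 p.2.1 p.2.2).exists_liftBound (d := d) hs
  have e1 : 0 ≤ ∑ l, M₁ l := Finset.sum_nonneg fun l _ => (h₁ l).nonneg
  have e2 : 0 ≤ ∑ l, L₁ l := Finset.sum_nonneg fun l _ => (h₁ l).nonneg'
  have e3 : 0 ≤ ∑ p, M₂ p := Finset.sum_nonneg fun p _ => (h₂ p).nonneg
  have e4 : 0 ≤ ∑ p, L₂ p := Finset.sum_nonneg fun p _ => (h₂ p).nonneg'
  refine ⟨(∑ l, M₁ l) + ∑ p, M₂ p, (∑ l, L₁ l) + ∑ p, L₂ p,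
    eq_add_sum_slope hA hF hb, fun l => (h₁ l).mono ?_ ?_,
    fun j i l => (h₂ (j, i, l)).mono ?_ ?_, hs, add_nonneg e1 e3, add_nonneg e2 e4⟩
  · have := Finset.single_le_sum (fun l _ => (h₁ l).nonneg) (Finset.mem_univ l)
    linarith
  · have := Finset.single_le_sum (fun l _ => (h₁ l).nonneg') (Finset.mem_univ l)
    linarith
  · have := Finset.single_le_sum (fun p _ => (h₂ p).nonneg) (Finset.mem_univ (j, i, l))
    linarith
  · have := Finset.single_le_sum (fun p _ => (h₂ p).nonneg') (Finset.mem_univ (j, i, l))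
    linarith

theorem grad_apply {f : (Fin d → ℝ) → EuclideanSpace ℝ (Fin m)} {x : Fin d → ℝ}
    (hf : ∀ i, DifferentiableAt ℝ (fun x => f x i) x) (j : Fin d) (i : Fin m) :
    grad f x j i = partialDeriv j (fun x => f x i) x := by
  have h1 : DifferentiableAt ℝ f x := differentiableAt_euclidean.2 hf
  have h2 := ((EuclideanSpace.proj (𝕜 := ℝ) i).hasFDerivAt (x := f x)).comp x h1.hasFDerivAt
  have h3 : HasFDerivAt (fun x => f x i) ((EuclideanSpace.proj i).comp (fderiv ℝ f x)) x := h2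
  rw [partialDeriv, h3.fderiv]
  rfl

section Rhs

variable {t₀ R C : ℝ} {u v : ℝ → (Fin d → ℝ) → EuclideanSpace ℝ (Fin m)} {δ : ℝ}

theorem QuasilinearBound.apply_eq (H : QuasilinearBound A s M L)
    (hu : VMajorized (timeSet t₀ R C) (radius t₀ R C) u δ) {t : ℝ} (ht : t ∈ timeSet t₀ R C) (x : Fin d → ℝ) (l : Fin m) :
    A (u t x) (grad (u t) x) l = A (u t x) 0 l + ∑ j, ∑ i,
      slope A j i (u t x) l * partialDeriv j (fun x => u t x i) x := by
  rw [H.eq]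
  simp only [PiLp.add_apply, PiLp.smul_apply, WithLp.ofLp_sum, Finset.sum_apply, smul_eq_mul]
  congr 1
  refine Finset.sum_congr rfl fun j _ => Finset.sum_congr rfl fun i _ => ?_
  rw [grad_apply (fun i => (hu i).differentiableAt ht (radius_pos ht) x), mul_comm]

theorem QuasilinearBound.continuousOn (H : QuasilinearBound A s M L) (hC : 0 < C)
    (hu : VMajorized (timeSet t₀ R C) (radius t₀ R C) u s) (x : Fin d → ℝ) (l : Fin m) :
    ContinuousOn (fun t => A (u t x) (grad (u t) x) l) (timeSet t₀ R C) := by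
  have h : ContinuousOn (fun t => A (u t x) 0 l + ∑ j, ∑ i,
      slope A j i (u t x) l * partialDeriv j (fun x => u t x i) x) (timeSet t₀ R C) := by
    refine (((H.bound_zero l).bound _ _ radius_nonneg u hu).continuousOn hC.le x).add ?_
    refine continuousOn_finsetSum _ fun j _ => continuousOn_finsetSum _ fun i _ => ?_
    exact ((H.bound_slope j i l).bound _ _ radius_nonneg u hu).continuousOn_mul_partialDeriv hC
      (hu i) j x
  exact h.congr fun t ht => H.apply_eq hu ht x l

theorem QuasilinearBound.integral_eq (H : QuasilinearBound A s M L) (hC : 0 < C)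
    (hu : VMajorized (timeSet t₀ R C) (radius t₀ R C) u s) {t : ℝ} (ht : t ∈ timeSet t₀ R C) (x : Fin d → ℝ) (l : Fin m) :
    ∫ τ in t₀..t, A (u τ x) (grad (u τ) x) l = (∫ τ in t₀..t, A (u τ x) 0 l) + ∑ j, ∑ i,
      ∫ τ in t₀..t, slope A j i (u τ x) l * partialDeriv j (fun x => u τ x i) x := by
  have i1 := intervalIntegrable_of_timeSet hC.le
    (((H.bound_zero l).bound _ _ radius_nonneg u hu).continuousOn hC.le x) ht
  have i2 := fun j i => intervalIntegrable_of_timeSet hC.le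
    (((H.bound_slope j i l).bound _ _ radius_nonneg u hu).continuousOn_mul_partialDeriv hC
      (hu i) j x) ht
  have i3 : ∀ j, IntervalIntegrable (fun τ => ∑ i, slope A j i (u τ x) l *
      partialDeriv j (fun x => u τ x i) x) volume t₀ t := fun j => by
    have := IntervalIntegrable.sum Finset.univ (fun i _ => i2 j i)
    simpa only [Finset.sum_fn] using this
  have i4 : IntervalIntegrable (fun τ => ∑ j, ∑ i, slope A j i (u τ x) l *
      partialDeriv j (fun x => u τ x i) x) volume t₀ t := by
    have := IntervalIntegrable.sum Finset.univ (fun j _ => i3 j)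
    simpa only [Finset.sum_fn] using this
  have e : ∫ τ in t₀..t, A (u τ x) (grad (u τ) x) l = ∫ τ in t₀..t, (A (u τ x) 0 l + ∑ j, ∑ i,
      slope A j i (u τ x) l * partialDeriv j (fun x => u τ x i) x) := by
    refine intervalIntegral.integral_congr fun τ hτ => ?_
    rw [uIcc_of_le ht.1] at hτ
    exact H.apply_eq hu (Icc_subset_timeSet hC.le ht hτ) x l
  rw [e, intervalIntegral.integral_add i1 i4, intervalIntegral.integral_finsetSum fun j _ => i3 j]
  congr 1
  exact Finset.sum_congr rfl fun j _ => intervalIntegral.integral_finsetSum fun i _ => i2 j i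

theorem QuasilinearBound.majorized_integral (H : QuasilinearBound A s M L) (hR : 0 ≤ R)
    (hC : 0 < C) (hu : VMajorized (timeSet t₀ R C) (radius t₀ R C) u s) (l : Fin m) :
    Majorized (timeSet t₀ R C) (radius t₀ R C) (fun t x => ∫ τ in t₀..t, A (u τ x) (grad (u τ) x) l)
      ((R * M + d * m * (M * s)) / C) := by
  have h1 := ((H.bound_zero l).bound _ _ radius_nonneg u hu).integral hC
  have h2 := fun j i => ((H.bound_slope j i l).bound _ _ radius_nonneg u hu).integral_mul_partialDeriv hC
      (hu i) j
  have h3 := h1.add radius_nonneg (Majorized.sum radius_nonneg fun j =>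
    Majorized.sum radius_nonneg fun i => h2 j i)
  refine (h3.mono (le_of_eq ?_)).congr fun t ht x => H.integral_eq hC hu ht x l
  rw [abs_of_nonneg (by positivity)]
  simp only [Finset.sum_const, Finset.card_univ, Fintype.card_fin, nsmul_eq_mul]
  field_simp

theorem partialDeriv_sub {f g : (Fin d → ℝ) → ℝ} {x : Fin d → ℝ} (hf : DifferentiableAt ℝ f x)
    (hg : DifferentiableAt ℝ g x) (j : Fin d) :
    partialDeriv j (fun x => f x - g x) x = partialDeriv j f x - partialDeriv j g x := by
  simp only [partialDeriv]
  rw [fderiv_fun_sub hf hg]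
  rfl

/-- The splitting is `a(u) ∂u - a(v) ∂v = (a(u) - a(v)) ∂u + a(v) ∂(u - v)`. The first part costs `L
s δ`, the second `M δ`, and both gain `1/C` from the time integration. -/
theorem QuasilinearBound.majorized_integral_sub (H : QuasilinearBound A s M L) (hR : 0 ≤ R)
    (hC : 0 < C) (hu : VMajorized (timeSet t₀ R C) (radius t₀ R C) u s) (hv : VMajorized (timeSet t₀ R C) (radius t₀ R C) v s) (hδ : 0 ≤ δ)
    (huv : VMajorized (timeSet t₀ R C) (radius t₀ R C) (fun t x => u t x - v t x) δ) (l : Fin m) :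
    Majorized (timeSet t₀ R C) (radius t₀ R C) (fun t x => (∫ τ in t₀..t, A (u τ x) (grad (u τ) x) l) -
      ∫ τ in t₀..t, A (v τ x) (grad (v τ) x) l)
      ((R * L + d * m * (L * s + M)) / C * δ) := by
  have b1 := (H.bound_zero l).lipschitz _ _ radius_nonneg u v δ hδ hu hv huv
  have b2 := fun j i => (H.bound_slope j i l).lipschitz _ _ radius_nonneg u v δ hδ hu hv huv
  have b3 := fun j i => (H.bound_slope j i l).bound _ _ radius_nonneg v hv
  have h1 := b1.integral hC
  have h2 := fun j i => (b2 j i).integral_mul_partialDeriv hC (hu i) j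
  have h3 := fun j i => (b3 j i).integral_mul_partialDeriv hC (huv i) j
  have h4 := h1.add radius_nonneg (Majorized.sum radius_nonneg fun j =>
    Majorized.sum radius_nonneg fun i => (h2 j i).add radius_nonneg (h3 j i))
  refine (h4.mono (le_of_eq ?_)).congr fun t ht x => ?_
  · rw [abs_of_nonneg (by positivity)]
    simp only [Finset.sum_const, Finset.card_univ, Fintype.card_fin, nsmul_eq_mul]
    field_simp
  · rw [H.integral_eq hC hu ht x l, H.integral_eq hC hv ht x l, add_sub_add_comm]
    congr 1
    · rw [intervalIntegral.integral_sub]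
      · exact intervalIntegrable_of_timeSet hC.le
          (((H.bound_zero l).bound _ _ radius_nonneg u hu).continuousOn hC.le x) ht
      · exact intervalIntegrable_of_timeSet hC.le
          (((H.bound_zero l).bound _ _ radius_nonneg v hv).continuousOn hC.le x) ht
    · rw [← Finset.sum_sub_distrib]
      refine Finset.sum_congr rfl fun j _ => ?_
      rw [← Finset.sum_sub_distrib]
      refine Finset.sum_congr rfl fun i _ => ?_
      rw [← intervalIntegral.integral_sub, ← intervalIntegral.integral_add]
      · refine intervalIntegral.integral_congr fun τ hτ => ?_
        rw [uIcc_of_le ht.1] at hτ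
        have hτ' := Icc_subset_timeSet hC.le ht hτ
        have := partialDeriv_sub ((hu i).differentiableAt hτ' (radius_pos hτ') x)
          ((hv i).differentiableAt hτ' (radius_pos hτ') x) j
        simp only [PiLp.sub_apply]
        rw [this]
        ring
      · exact intervalIntegrable_of_timeSet hC.le
          ((b2 j i).continuousOn_mul_partialDeriv hC (hu i) j x) ht
      · exact intervalIntegrable_of_timeSet hC.le
          ((b3 j i).continuousOn_mul_partialDeriv hC (huv i) j x) ht
      · exact intervalIntegrable_of_timeSet hC.le
          (((H.bound_slope j i l).bound _ _ radius_nonneg u hu).continuousOn_mul_partialDeriv hC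
            (hu i) j x) ht
      · exact intervalIntegrable_of_timeSet hC.le
          ((b3 j i).continuousOn_mul_partialDeriv hC (hv i) j x) ht

end Rhs

end GenFun

end

/-! ### Picard iteration and existence -/

noncomputable section

namespace GenFun

open MeasureTheory Set Complex

variable {d m : ℕ}

variable {A : EuclideanSpace ℝ (Fin m) → (Fin d → EuclideanSpace ℝ (Fin m)) →
  EuclideanSpace ℝ (Fin m)} {s s₀ M L t₀ R C δ : ℝ}

/-- The Picard map of the Cauchy problem with value `w` at time `t₀`. -/
def picard (A : EuclideanSpace ℝ (Fin m) → (Fin d → EuclideanSpace ℝ (Fin m)) →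
    EuclideanSpace ℝ (Fin m)) (t₀ : ℝ) (w : (Fin d → ℝ) → EuclideanSpace ℝ (Fin m))
    (u : ℝ → (Fin d → ℝ) → EuclideanSpace ℝ (Fin m)) (t : ℝ) (x : Fin d → ℝ) :
    EuclideanSpace ℝ (Fin m) :=
  WithLp.toLp 2 fun l => w x l + ∫ τ in t₀..t, A (u τ x) (grad (u τ) x) l

variable {w : (Fin d → ℝ) → EuclideanSpace ℝ (Fin m)}
  {u v : ℝ → (Fin d → ℝ) → EuclideanSpace ℝ (Fin m)}

theorem VMajorized.mono {J : Set ℝ} {r : ℝ → ℝ} (hu : VMajorized J r u s) (h : s ≤ s₀) :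
    VMajorized J r u s₀ := fun i => (hu i).mono h

theorem QuasilinearBound.picard (H : QuasilinearBound A s M L) (hR : 0 ≤ R)
    (hC : 0 < C) (hK : R * M + d * m * (M * s) ≤ C)
    (hw : VMajorized (timeSet t₀ R C) (radius t₀ R C) (fun _ => w) s₀)
    (hu : VMajorized (timeSet t₀ R C) (radius t₀ R C) u s) :
    VMajorized (timeSet t₀ R C) (radius t₀ R C) (picard A t₀ w u) (s₀ + 1) := by
  intro l
  refine ((hw l).add radius_nonneg (H.majorized_integral hR hC hu l)).mono ?_
  have := (div_le_one hC).2 hK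
  linarith

theorem QuasilinearBound.picard_sub (H : QuasilinearBound A s M L) (hR : 0 ≤ R)
    (hC : 0 < C) (hK : 2 * (R * L + d * m * (L * s + M)) ≤ C)
    (hu : VMajorized (timeSet t₀ R C) (radius t₀ R C) u s)
    (hv : VMajorized (timeSet t₀ R C) (radius t₀ R C) v s) (hδ : 0 ≤ δ)
    (huv : VMajorized (timeSet t₀ R C) (radius t₀ R C) (fun t x => u t x - v t x) δ) :
    VMajorized (timeSet t₀ R C) (radius t₀ R C)
      (fun t x => GenFun.picard A t₀ w u t x - GenFun.picard A t₀ w v t x) (1 / 2 * δ) := by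
  intro l
  refine ((H.majorized_integral_sub hR hC hu hv hδ huv l).mono ?_).congr fun t _ x => ?_
  · refine mul_le_mul_of_nonneg_right ?_ hδ
    rw [div_le_iff₀ hC]
    linarith
  · simp [GenFun.picard]

/-- The Picard iterates converge to a fixed point on the whole time interval. -/
theorem QuasilinearBound.exists_fixedPoint (hs : s₀ + 2 ≤ s) (H : QuasilinearBound A s M L)
    (hR : 0 ≤ R) (hC : 0 < C) (hK : R * M + d * m * (M * s) ≤ C)
    (hK' : 2 * (R * L + d * m * (L * s + M)) ≤ C)
    (hw : VMajorized (timeSet t₀ R C) (radius t₀ R C) (fun _ => w) s₀) :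
    ∃ u : ℝ → (Fin d → ℝ) → EuclideanSpace ℝ (Fin m),
      VMajorized (timeSet t₀ R C) (radius t₀ R C) u s ∧
      ∀ t ∈ timeSet t₀ R C, ∀ x, u t x = GenFun.picard A t₀ w u t x := by
  set J := timeSet t₀ R C
  set r := radius t₀ R C
  have hr : ∀ t ∈ J, 0 ≤ r t := radius_nonneg
  let U : ℕ → ℝ → (Fin d → ℝ) → EuclideanSpace ℝ (Fin m) := fun n =>
    (GenFun.picard A t₀ w)^[n] fun _ => w
  have hU1 : ∀ n, U (n + 1) = GenFun.picard A t₀ w (U n) := fun n =>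
    Function.iterate_succ_apply' _ _ _
  have hU : ∀ n, VMajorized J r (U n) s := by
    intro n
    cases n with
    | zero => exact hw.mono (by linarith)
    | succ n =>
      induction n with
      | zero => rw [hU1]; exact (H.picard hR hC hK hw (hw.mono (by linarith))).mono (by linarith)
      | succ n ih => rw [hU1]; exact (H.picard hR hC hK hw ih).mono (by linarith)
  have hD : ∀ n, VMajorized J r (fun t x => U (n + 1) t x - U n t x) ((1 / 2) ^ n) := by
    intro n
    induction n with
    | zero =>
      intro l
      refine ((H.majorized_integral hR hC (hU 0) l).mono ?_).congr fun t _ x => ?_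
      · simpa using (div_le_one hC).2 hK
      · rw [hU1]; simp [GenFun.picard, U]
    | succ n ih =>
      rw [hU1 (n + 1)]
      nth_rw 2 [hU1 n]
      rw [pow_succ']
      exact H.picard_sub hR hC hK' (hU _) (hU _) (by positivity) ih
  have hgeo : Summable fun n : ℕ => (1 / 2 : ℝ) ^ n :=
    summable_geometric_of_lt_one (by norm_num) (by norm_num)
  -- The limit is the telescoping series of the increments. Its values outside the time interval
  -- play no role.
  let u : ℝ → (Fin d → ℝ) → EuclideanSpace ℝ (Fin m) := fun t x => WithLp.toLp 2 fun i =>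
    w x i + ∑' n, (U (n + 1) t x i - U n t x i)
  have hsum : ∀ i, ∀ t ∈ J, ∀ x, HasSum (fun n => U (n + 1) t x i - U n t x i)
      (u t x i - w x i) := by
    intro i t ht x
    have h1 : Summable fun n => U (n + 1) t x i - U n t x i :=
      Summable.of_norm_bounded hgeo fun n => (hD n i).abs_le hr ht x
    simpa [u] using h1.hasSum
  -- The iterates have norm at most `s₀ + 1`, but the limit is measured through the sum of its
  -- increments, which is at most `2`; hence the assumption `s₀ + 2 ≤ s`.
  have huw : VMajorized J r (fun t x => u t x - w x) 2 := by
    intro i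
    exact (Majorized.tsum hr (fun n => hD n i) hgeo (hsum i)).mono tsum_geometric_two.le
  have hu : VMajorized J r u s := by
    intro i
    refine (((hw i).add hr (huw i)).mono hs).congr fun t _ x => ?_
    simp
  have huU : ∀ n, VMajorized J r (fun t x => u t x - U n t x) (2 * (1 / 2) ^ n) := by
    intro n i
    refine (Majorized.tsum hr (fun k => hD (k + n) i) ((summable_nat_add_iff n).2 hgeo)
      fun t ht x => ?_).mono ?_
    · have h1 := (hasSum_nat_add_iff' n).2 (hsum i t ht x)
      rw [Finset.sum_range_sub fun n => U n t x i] at h1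
      simpa [U] using h1
    · simp only [pow_add]
      rw [tsum_mul_right, tsum_geometric_two]
  refine ⟨u, hu, fun t ht x => ?_⟩
  ext i
  have hlim : Filter.Tendsto (fun n : ℕ => 2 * (1 / 2 : ℝ) ^ n) Filter.atTop (𝓝 (2 * 0)) :=
    (tendsto_pow_atTop_nhds_zero_of_lt_one (by norm_num) (by norm_num)).const_mul 2
  -- The iterate of index `n + 1` is within `2^{-n}` both of the limit and of the image of the limit
  -- under the Picard map.
  have hle : ∀ n : ℕ, |u t x i - GenFun.picard A t₀ w u t x i| ≤ 2 * (1 / 2) ^ n := by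
    intro n
    have h1 := (huU (n + 1) i).abs_le hr ht x
    have h2 := (H.picard_sub (w := w) hR hC hK' hu (hU n) (by positivity) (huU n) i).abs_le hr ht x
    rw [← hU1 n] at h2
    simp only [PiLp.sub_apply] at h1 h2
    rw [abs_sub_comm] at h2
    have := abs_sub_le (u t x i) (U (n + 1) t x i) (GenFun.picard A t₀ w u t x i)
    rw [pow_succ] at h1
    linarith
  have := ge_of_tendsto' hlim hle
  rw [mul_zero] at this
  exact sub_eq_zero.1 (abs_nonpos_iff.1 this)

theorem timeSet_zero (ρ C : ℝ) : timeSet 0 ρ C = {t | 0 ≤ t ∧ 0 < ρ - C * t} := by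
  simp [timeSet]

theorem VMajorized.mem_X (hu : VMajorized (timeSet t₀ R C) (radius t₀ R C) u s) {t : ℝ}
    (ht : t ∈ timeSet t₀ R C) : u t ∈ X d m (radius t₀ R C t) := by
  refine ⟨?_, fun x j => ?_, ?_⟩
  · have h : Continuous fun x => (u t x).ofLp :=
      continuous_pi fun i => (hu i).continuous radius_nonneg ht
    exact (PiLp.continuous_toLp 2 _).comp h
  · ext i
    exact (hu i).boxPeriodic ht x j
  · refine (gen_le_sum_scalarGen _ _).trans_lt (ENNReal.sum_lt_top.2 fun i _ => ?_)
    exact ((hu i).scalarGen_le radius_nonneg ht).trans_lt ENNReal.ofReal_lt_top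

theorem VMajorized.tendsto_gen_sub
    (hu : VMajorized (timeSet t₀ R C) (radius t₀ R C) u s) {t' z : ℝ}
    (ht' : t' ∈ timeSet t₀ R C) (hz : z < radius t₀ R C t') :
    Filter.Tendsto (fun t => Gen (u t - u t') z) (𝓝[timeSet t₀ R C] t') (𝓝 0) := by
  have h : Filter.Tendsto (fun t => ∑ i, scalarGen (fun x => u t x i - u t' x i) z)
      (𝓝[timeSet t₀ R C] t') (𝓝 (∑ _i : Fin m, 0)) :=
    tendsto_finsetSum _ fun i _ => (hu i).tendsto_scalarGen_sub ht' hz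
  rw [Finset.sum_const_zero] at h
  exact tendsto_of_tendsto_of_tendsto_of_le_of_le tendsto_const_nhds h (fun _ => zero_le)
    fun t => gen_le_sum_scalarGen _ _

theorem QuasilinearBound.hasDerivWithinAt (H : QuasilinearBound A s M L) (hC : 0 < C)
    (hu : VMajorized (timeSet t₀ R C) (radius t₀ R C) u s)
    (hfix : ∀ t ∈ timeSet t₀ R C, ∀ x, u t x = GenFun.picard A t₀ w u t x) {t : ℝ}
    (ht : t ∈ timeSet t₀ R C) (x : Fin d → ℝ) :
    HasDerivWithinAt (fun τ => u τ x) (A (u t x) (grad (u t) x)) (timeSet t₀ R C) t := by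
  have h1 : HasDerivWithinAt (fun τ => (GenFun.picard A t₀ w u τ x).ofLp)
      (A (u t x) (grad (u t) x)).ofLp (timeSet t₀ R C) t := by
    rw [hasDerivWithinAt_pi]
    intro l
    exact (hasDerivWithinAt_primitive hC.le (H.continuousOn hC hu x l) ht).const_add (w x l)
  have h2 := (PiLp.continuousLinearEquiv 2 ℝ fun _ : Fin m => ℝ).symm.hasFDerivAt.comp_hasDerivWithinAt
    t h1
  exact h2.congr (fun τ hτ => hfix τ hτ x) (hfix t ht x)

theorem QuasilinearBound.isSolution (H : QuasilinearBound A s M L) {ρ : ℝ} (hρ : 0 < ρ)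
    (hC : 0 < C) (hu : VMajorized (timeSet 0 ρ C) (radius 0 ρ C) u s)
    (hfix : ∀ t ∈ timeSet 0 ρ C, ∀ x, u t x = GenFun.picard A 0 w u t x) :
    IsSolution A ρ C w u := by
  have e := timeSet_zero ρ C
  have er : ∀ t, radius 0 ρ C t = ρ - C * t := fun t => by simp [radius]
  have hmem : ∀ t, 0 ≤ t → 0 < ρ - C * t → t ∈ timeSet 0 ρ C := fun t h0 h1 => by
    rw [e]; exact ⟨h0, h1⟩
  refine ⟨?_, fun t h0 h1 => ?_, fun t h0 h1 z hz => ?_, fun t h0 h1 x => ?_⟩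
  · ext x i
    rw [hfix 0 (hmem 0 le_rfl (by simpa using hρ))]
    simp [GenFun.picard]
  · rw [← er]; exact hu.mem_X (hmem t h0 h1)
  · rw [← e]
    exact hu.tendsto_gen_sub (hmem t h0 h1) (by rwa [er])
  · rw [← e]
    exact H.hasDerivWithinAt hC hu hfix (hmem t h0 h1) x

theorem exists_isSolution (hd : 1 ≤ d) (hA : Continuous (Function.uncurry A)) {C₀ : ℝ}
    {F : ℝ → ℝ} (hF : AnalyticOnNhd ℝ F (Set.Ici 0)) (hb : GeneratorBound A C₀ F) {ρ : ℝ}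
    (hρ : 0 < ρ) (hw : w ∈ X d m ρ) : ∃ C₁, 0 < C₁ ∧ ∃ u, IsSolution A ρ C₁ w u := by
  set s := (Gen w ρ).toReal + 2
  have hs : 0 ≤ s := by positivity
  obtain ⟨M, L, H⟩ := exists_quasilinearBound hd hA hF hb hs
  have hM := H.nonneg_bound
  have hL := H.nonneg_lipschitz
  -- The first summand keeps the Picard map in the ball, the second makes it contract by `1/2`, and
  -- the last ensures positivity. There is no circularity: `M` and `L` depend on `s`, and `s` comes
  -- from `Gen w ρ` alone, whatever the speed.
  set C := (ρ * M + d * m * (M * s)) + 2 * (ρ * L + d * m * (L * s + M)) + 1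
  have e1 : 0 ≤ ρ * M + d * m * (M * s) := by positivity
  have e2 : 0 ≤ ρ * L + d * m * (L * s + M) := by positivity
  have hC : 0 < C := by simp only [C]; linarith
  obtain ⟨u, hu, hfix⟩ := H.exists_fixedPoint le_rfl hρ.le hC (by simp only [C]; linarith)
    (by simp only [C]; linarith) (majorized_of_mem_X (t₀ := 0) hρ.le hC.le hw)
  exact ⟨C, hC, u, H.isSolution hρ hC hu hfix⟩

end GenFun

end

/-! ### Uniqueness -/

noncomputable section

namespace GenFun

open MeasureTheory Set Complex

variable {d m : ℕ}

variable {A : EuclideanSpace ℝ (Fin m) → (Fin d → EuclideanSpace ℝ (Fin m)) →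
  EuclideanSpace ℝ (Fin m)} {s M L t₀ R C ρ C₁ : ℝ}
  {w : (Fin d → ℝ) → EuclideanSpace ℝ (Fin m)}
  {u v : ℝ → (Fin d → ℝ) → EuclideanSpace ℝ (Fin m)}

theorem fourierCoeff_sub {f g : (Fin d → ℝ) → EuclideanSpace ℝ (Fin m)} (hf : Continuous f)
    (hg : Continuous g) (α : Fin d → ℤ) :
    fourierCoeff (f - g) α = fourierCoeff f α - fourierCoeff g α := by
  ext i
  simp only [PiLp.sub_apply, fourierCoeff_apply, Pi.sub_apply]
  push_cast
  exact coeff_sub (by fun_prop) (by fun_prop) α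

theorem gen_le_gen_sub_add {f g : (Fin d → ℝ) → EuclideanSpace ℝ (Fin m)} (hf : Continuous f)
    (hg : Continuous g) (z : ℝ) : Gen f z ≤ Gen (f - g) z + Gen g z := by
  simp only [Gen]
  rw [← ENNReal.tsum_add]
  refine ENNReal.tsum_le_tsum fun α => ?_
  rw [← ENNReal.ofReal_add (by positivity) (by positivity), fourierCoeff_sub hf hg, ← mul_add]
  refine ENNReal.ofReal_le_ofReal (mul_le_mul_of_nonneg_left ?_ (Real.exp_pos _).le)
  have := norm_add_le (fourierCoeff f α - fourierCoeff g α) (fourierCoeff g α)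
  rwa [sub_add_cancel] at this

theorem summable_exp_neg_mul_freqNorm (hd : 1 ≤ d) {ε : ℝ} (hε : 0 < ε) :
    Summable fun α : Fin d → ℤ => Real.exp (-(ε * freqNorm α)) := by
  have hd' : (0 : ℝ) < d := by exact_mod_cast hd
  have hq : Real.exp (-(ε / d)) < 1 := Real.exp_lt_one_iff.2 (neg_neg_of_pos (by positivity))
  refine Summable.of_nonneg_of_le (fun _ => (Real.exp_pos _).le) (fun α => ?_)
    (summable_geomWeight (m := d) (Real.exp_pos _).le hq)
  rw [geomWeight_eq_exp (Real.exp_pos _), Real.log_exp, Real.exp_le_exp]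
  have h1 : ∑ j, |(α j : ℝ)| ≤ d * freqNorm α := by
    refine (Finset.sum_le_card_nsmul _ _ _ fun j _ => abs_le_freqNorm α j).trans (le_of_eq ?_)
    simp
  rw [neg_mul, neg_le_neg_iff]
  calc ε / d * ∑ j, |(α j : ℝ)| ≤ ε / d * (d * freqNorm α) := by gcongr
    _ = _ := by field_simp

theorem IsSolution.continuousOn_coeff (hu : IsSolution A ρ C₁ w u) (i : Fin m) (α : Fin d → ℤ) :
    ContinuousOn (fun t => coeff (fun x => ((u t x i : ℝ) : ℂ)) α)
      {t | 0 ≤ t ∧ 0 < ρ - C₁ * t} := by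
  intro t ht
  rw [ContinuousWithinAt, tendsto_iff_norm_sub_tendsto_zero]
  -- At radius zero the generator function is the sum of the norms of all coefficients, so it
  -- controls each of them.
  have h1 := hu.continuous_scale t ht.1 ht.2 0 ht.2
  have h2 := (ENNReal.tendsto_toReal ENNReal.zero_ne_top).comp h1
  refine squeeze_zero' (Filter.Eventually.of_forall fun _ => norm_nonneg _) ?_ h2
  filter_upwards [self_mem_nhdsWithin, h1.eventually (gt_mem_nhds ENNReal.zero_lt_top)]
    with τ hτ hlt
  have hc := (hu.mem t ht.1 ht.2).1
  have hc' := (hu.mem τ hτ.1 hτ.2).1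
  have e : coeff (fun x => ((u τ x i : ℝ) : ℂ)) α - coeff (fun x => ((u t x i : ℝ) : ℂ)) α =
      coeff (fun x => (((u τ - u t) x i : ℝ) : ℂ)) α := by
    simp only [Pi.sub_apply, PiLp.sub_apply]
    push_cast
    exact (coeff_sub (by fun_prop) (by fun_prop) α).symm
  rw [e]
  refine (norm_coeff_le_norm_fourierCoeff _ α i).trans ?_
  simpa using mul_norm_fourierCoeff_le hlt α

/-- Near each time, a solution is majorized on all sufficiently short time intervals. -/
theorem IsSolution.exists_vMajorized (hd : 1 ≤ d) (hu : IsSolution A ρ C₁ w u)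
    (h0 : 0 ≤ t₀) (h1 : 0 < ρ - C₁ * t₀) (hR : 4 * R = ρ - C₁ * t₀) :
    ∃ S C', ∀ C, C' ≤ C → 0 < C → timeSet t₀ R C ⊆ {t | 0 ≤ t ∧ 0 < ρ - C₁ * t} →
      VMajorized (timeSet t₀ R C) (radius t₀ R C) u S := by
  have hR0 : 0 < R := by linarith
  -- The radius available at `t₀` is `4R`. Continuity bounds the solution at radius `2R` uniformly
  -- over short times, and the drop from `2R` to `R` supplies the factor `e^{-R|α|}` that makes the
  -- suprema over time summable in `α`.
  have hev := (hu.continuous_scale t₀ h0 h1 (2 * R) (by linarith)).eventually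
    (gt_mem_nhds zero_lt_one)
  obtain ⟨ε, hε, hball⟩ := Metric.mem_nhdsWithin_iff.1 hev
  set M₀ := (1 + Gen (u t₀) (2 * R)).toReal
  have hfin : 1 + Gen (u t₀) (2 * R) < ⊤ :=
    ENNReal.add_lt_top.2 ⟨ENNReal.one_lt_top,
      (gen_mono _ (by linarith)).trans_lt (hu.mem t₀ h0 h1).2.2⟩
  -- The time interval has length at most `R / C`, so a speed of at least `2R/ε` keeps it within the
  -- neighbourhood of size `ε`.
  refine ⟨∑' α : Fin d → ℤ, M₀ * Real.exp (-(R * freqNorm α)), 2 * R / ε,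
    fun C hC hC0 hsub i => ?_⟩
  refine ⟨Fin d → ℤ, inferInstance, fun α => α, fun α t => coeff (fun x => ((u t x i : ℝ) : ℂ)) α,
    fun α => M₀ * Real.exp (-(R * freqNorm α)),
    ⟨fun α => (hu.continuousOn_coeff i α).mono hsub, fun α => by positivity, fun α t ht => ?_,
      (summable_exp_neg_mul_freqNorm hd hR0).mul_left _, fun t ht x => ?_⟩, le_rfl⟩
  · have htI := hsub ht
    have hlt : t - t₀ < ε := by
      have e1 := sub_le_of_mem_timeSet hC0 ht
      have e2 : R / C ≤ ε / 2 := by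
        rw [div_le_iff₀ hε] at hC
        rw [div_le_div_iff₀ hC0 two_pos]
        linarith
      linarith
    have h2 : Gen (u t - u t₀) (2 * R) < 1 := by
      refine hball ⟨?_, htI⟩
      rw [Metric.mem_ball, Real.dist_eq, abs_of_nonneg (sub_nonneg.2 ht.1)]
      exact hlt
    have h3 : Gen (u t) (2 * R) ≤ 1 + Gen (u t₀) (2 * R) :=
      (gen_le_gen_sub_add (hu.mem t htI.1 htI.2).1 (hu.mem t₀ h0 h1).1 _).trans
        (by gcongr)
    have h4 := mul_norm_fourierCoeff_le (h3.trans_lt hfin) α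
    have h5 := norm_coeff_le_norm_fourierCoeff (u t) α i
    have h6 := ENNReal.toReal_mono hfin.ne h3
    have h7 : radius t₀ R C t ≤ R := by
      have := mul_nonneg hC0.le (sub_nonneg.2 ht.1)
      unfold radius
      linarith
    have hf := freqNorm_nonneg α
    calc Real.exp (radius t₀ R C t * freqNorm α) * ‖coeff (fun x => ((u t x i : ℝ) : ℂ)) α‖
        ≤ Real.exp (R * freqNorm α) * ‖fourierCoeff (u t) α‖ := by gcongr
      _ = Real.exp (-(R * freqNorm α)) *
          (Real.exp (2 * R * freqNorm α) * ‖fourierCoeff (u t) α‖) := by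
          rw [← mul_assoc, ← Real.exp_add]; congr 2; ring
      _ ≤ Real.exp (-(R * freqNorm α)) * M₀ := by gcongr; exact h4.trans h6
      _ = _ := mul_comm _ _
  · have htI := hsub ht
    exact hasSum_of_mem_X htI.2.le (hu.mem t htI.1 htI.2) i x

/-- The majorization makes the right-hand side continuous in time, so the fundamental theorem of
calculus applies to the pointwise equation. -/
theorem IsSolution.eq_picard (H : QuasilinearBound A s M L) (hC : 0 < C)
    (hsol : IsSolution A ρ C₁ w u) (hsub : timeSet t₀ R C ⊆ {t | 0 ≤ t ∧ 0 < ρ - C₁ * t})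
    (hu : VMajorized (timeSet t₀ R C) (radius t₀ R C) u s) {t : ℝ} (ht : t ∈ timeSet t₀ R C)
    (x : Fin d → ℝ) : u t x = GenFun.picard A t₀ (u t₀) u t x := by
  ext l
  have hI : Icc t₀ t ⊆ {t | 0 ≤ t ∧ 0 < ρ - C₁ * t} := (Icc_subset_timeSet hC.le ht).trans hsub
  have hder : ∀ τ ∈ Icc t₀ t, HasDerivWithinAt (fun τ => u τ x l) (A (u τ x) (grad (u τ) x) l)
      {t | 0 ≤ t ∧ 0 < ρ - C₁ * t} τ := by
    intro τ hτ
    have h1 := hsol.equation τ (hI hτ).1 (hI hτ).2 x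
    exact (EuclideanSpace.proj (𝕜 := ℝ) l).hasFDerivAt.comp_hasDerivWithinAt τ h1
  have h2 := intervalIntegral.integral_eq_sub_of_hasDeriv_right (a := t₀) (b := t)
    (f := fun τ => u τ x l) (f' := fun τ => A (u τ x) (grad (u τ) x) l) ?_ ?_
    (intervalIntegrable_of_timeSet hC.le (H.continuousOn hC hu x l) ht)
  · simp only [GenFun.picard]
    rw [h2]
    ring
  · rw [uIcc_of_le ht.1]
    exact fun τ hτ => (hder τ hτ).continuousWithinAt.mono hI
  · intro τ hτ
    rw [min_eq_left ht.1, max_eq_right ht.1] at hτ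
    refine (hder τ (Ioo_subset_Icc_self hτ)).mono_of_mem_nhdsWithin ?_
    exact Filter.mem_of_superset (Ioo_mem_nhdsGT hτ.2)
      fun y hy => hI ⟨hτ.1.le.trans hy.1.le, hy.2.le⟩

theorem QuasilinearBound.fixedPoint_unique (H : QuasilinearBound A s M L) (hR : 0 ≤ R)
    (hC : 0 < C) (hK : 2 * (R * L + d * m * (L * s + M)) ≤ C)
    (hu : VMajorized (timeSet t₀ R C) (radius t₀ R C) u s)
    (hv : VMajorized (timeSet t₀ R C) (radius t₀ R C) v s)
    (hu' : ∀ t ∈ timeSet t₀ R C, ∀ x, u t x = GenFun.picard A t₀ w u t x)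
    (hv' : ∀ t ∈ timeSet t₀ R C, ∀ x, v t x = GenFun.picard A t₀ w v t x) :
    ∀ t ∈ timeSet t₀ R C, u t = v t := by
  have h : ∀ n : ℕ, VMajorized (timeSet t₀ R C) (radius t₀ R C) (fun t x => u t x - v t x)
      ((1 / 2) ^ n * (s + s)) := by
    intro n
    induction n with
    | zero =>
      intro i
      rw [pow_zero, one_mul]
      exact (hu i).sub radius_nonneg (hv i)
    | succ n ih =>
      have hs := H.nonneg
      rw [pow_succ', mul_assoc]
      intro i
      refine (H.picard_sub (w := w) hR hC hK hu hv (by positivity) ih i).congr fun t ht x => ?_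
      simp only [← hu' t ht, ← hv' t ht]
  intro t ht
  ext x i
  have hlim : Filter.Tendsto (fun n : ℕ => (1 / 2 : ℝ) ^ n * (s + s)) Filter.atTop
      (𝓝 (0 * (s + s))) :=
    (tendsto_pow_atTop_nhds_zero_of_lt_one (by norm_num) (by norm_num)).mul_const _
  have := ge_of_tendsto' hlim fun n => (h n i).abs_le radius_nonneg ht x
  rw [zero_mul] at this
  exact sub_eq_zero.1 (abs_nonpos_iff.1 this)

/-- The problem is restarted at `t₀` with a quarter of the available radius and a larger speed.
There both solutions have finite norm and are fixed points of one contraction. -/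
theorem IsSolution.eventually_eq (hd : 1 ≤ d) (hA : Continuous (Function.uncurry A)) {C₀ : ℝ}
    {F : ℝ → ℝ} (hF : AnalyticOnNhd ℝ F (Set.Ici 0)) (hb : GeneratorBound A C₀ F)
    (hu : IsSolution A ρ C₁ w u) (hv : IsSolution A ρ C₁ w v) (h0 : 0 ≤ t₀)
    (h1 : 0 < ρ - C₁ * t₀) (heq : u t₀ = v t₀) : ∀ᶠ t in 𝓝[>] t₀, u t = v t := by
  set R := (ρ - C₁ * t₀) / 4
  have hR4 : 4 * R = ρ - C₁ * t₀ := by simp only [R]; ring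
  have hR : 0 < R := by linarith
  obtain ⟨S, C', hS⟩ := hu.exists_vMajorized hd h0 h1 hR4
  obtain ⟨S', C'', hS'⟩ := hv.exists_vMajorized hd h0 h1 hR4
  set s := max 0 (max S S')
  have hs : 0 ≤ s := le_max_left _ _
  obtain ⟨M, L, H⟩ := exists_quasilinearBound hd hA hF hb hs
  set K := 2 * (R * L + d * m * (L * s + M))
  -- The speed exceeds the thresholds for the majorization of both solutions, the contraction
  -- threshold `K`, and `C₁`; the last keeps the new time interval inside the old one.
  set C := max (max (max C' C'') (max K C₁)) 1
  have hC : 0 < C := zero_lt_one.trans_le (le_max_right _ _)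
  have hCC' : C' ≤ C := by simp [C]
  have hCC'' : C'' ≤ C := by simp [C]
  have hCK : K ≤ C := by simp [C]
  have hCC₁ : C₁ ≤ C := by simp [C]
  have hsub : timeSet t₀ R C ⊆ {t | 0 ≤ t ∧ 0 < ρ - C₁ * t} := by
    intro t ht
    refine ⟨h0.trans ht.1, ?_⟩
    have e1 := ht.2
    have e2 := mul_le_mul_of_nonneg_right hCC₁ (sub_nonneg.2 ht.1)
    linarith
  have hu' := (hS C hCC' hC hsub).mono
    ((le_max_left S S').trans (le_max_right 0 _) : S ≤ s)
  have hv' := (hS' C hCC'' hC hsub).mono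
    ((le_max_right S S').trans (le_max_right 0 _) : S' ≤ s)
  have hall := H.fixedPoint_unique (w := u t₀) hR.le hC hCK hu' hv'
    (fun t ht x => hu.eq_picard H hC hsub hu' ht x)
    (fun t ht x => by rw [heq]; exact hv.eq_picard H hC hsub hv' ht x)
  have hmem : t₀ ∈ timeSet t₀ R C := ⟨le_rfl, by simpa using hR⟩
  obtain ⟨t₁, ht₁, hlt, -⟩ := exists_later hmem
  filter_upwards [Ioo_mem_nhdsGT hlt] with t ht
  exact hall t (Icc_subset_timeSet hC.le ht₁ ⟨ht.1.le, ht.2.le⟩)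

/-- Continuous induction on the set of times of agreement. The argument works for every positive
speed `C₁`, not only for the one found in the existence proof. -/
theorem IsSolution.unique (hd : 1 ≤ d) (hA : Continuous (Function.uncurry A)) {C₀ : ℝ}
    {F : ℝ → ℝ} (hF : AnalyticOnNhd ℝ F (Set.Ici 0)) (hb : GeneratorBound A C₀ F)
    (hC₁ : 0 < C₁) (hu : IsSolution A ρ C₁ w u) (hv : IsSolution A ρ C₁ w v) {t : ℝ} (h0 : 0 ≤ t)
    (h1 : 0 < ρ - C₁ * t) : u t = v t := by
  have hI : Icc 0 t ⊆ {t | 0 ≤ t ∧ 0 < ρ - C₁ * t} := by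
    intro τ hτ
    have := mul_le_mul_of_nonneg_left hτ.2 hC₁.le
    exact ⟨hτ.1, by linarith⟩
  -- Continuity for pointwise convergence in `x` is enough to make the set of times of agreement
  -- closed.
  have hcont : ∀ u, IsSolution A ρ C₁ w u → ContinuousOn u (Icc 0 t) := by
    intro u hu
    refine continuousOn_pi.2 fun x τ hτ => ?_
    exact (hu.equation τ (hI hτ).1 (hI hτ).2 x).continuousWithinAt.mono hI
  have hclosed : IsClosed ({τ | u τ = v τ} ∩ Icc 0 t) := by
    have := ((hcont u hu).sub (hcont v hv)).preimage_isClosed_of_isClosed isClosed_Icc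
      (isClosed_singleton (x := 0))
    convert this using 1
    ext τ
    simp [sub_eq_zero, and_comm]
  have hsub := hclosed.Icc_subset_of_forall_mem_nhdsWithin
    (by rw [Set.mem_ofPred_eq, hu.initial, hv.initial]) fun τ hτ =>
      hu.eventually_eq hd hA hF hb hv (hI (Ico_subset_Icc_self hτ.2)).1
        (hI (Ico_subset_Icc_self hτ.2)).2 hτ.1
  exact hsub ⟨h0, le_rfl⟩

end GenFun

end

theorem theorem2p1 (d m : ℕ) (hd : 1 ≤ d)
    (A : EuclideanSpace ℝ (Fin m) → (Fin d → EuclideanSpace ℝ (Fin m)) →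
      EuclideanSpace ℝ (Fin m))
    (hA : Continuous (Function.uncurry A))
    (C₀ : ℝ) (F : ℝ → ℝ) (hF : AnalyticOnNhd ℝ F (Set.Ici 0))
    (hbound : GenFun.GeneratorBound A C₀ F)
    (ρ : ℝ) (hρ : 0 < ρ)
    (u₀ : (Fin d → ℝ) → EuclideanSpace ℝ (Fin m)) (hu₀ : u₀ ∈ GenFun.X d m ρ) :
    ∃ C₁ : ℝ, 0 < C₁ ∧
      (∃ u : ℝ → (Fin d → ℝ) → EuclideanSpace ℝ (Fin m), GenFun.IsSolution A ρ C₁ u₀ u) ∧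
      (∀ u v : ℝ → (Fin d → ℝ) → EuclideanSpace ℝ (Fin m),
        GenFun.IsSolution A ρ C₁ u₀ u → GenFun.IsSolution A ρ C₁ u₀ v →
        ∀ t : ℝ, 0 ≤ t → 0 < ρ - C₁ * t → u t = v t) := by
  obtain ⟨C₁, hC₁, hu⟩ := GenFun.exists_isSolution hd hA hF hbound hρ hu₀
  exact ⟨C₁, hC₁, hu, fun _ _ hu hv _ h0 h1 => hu.unique hd hA hF hbound hC₁ hv h0 h1⟩
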